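/- Let $d\ge 1$, $T>0$, $1/4<H<1$, and let $X=(X_t)_{t\ge 0}$ be a $d$-dimensional fractional Brownian motion with Hurst index $H$ (almost surely continuous, with independent components that are real fractional Brownian motions: centred Gaussian processes with covariance $\tfrac12(s^{2H}+t^{2H}-|t-s|^{2H})$). Put $X_t:=0$ for $t<0$ and, for $\varepsilon>0$, $$D^0_\varepsilon X_t:=\frac{X_{t+\varepsilon}-X_{t-\varepsilon}}{2\varepsilon}.$$ For $\alpha>0$ let $$K_\alpha(x)=\frac{1}{\Gamma(\alpha)(4\pi)^{d/2}}\int_0^\infty t^{\alpha-d/2}e^{-|x|^2/(4t)-t}\,\frac{dt}{t}\qquad(x\in\mathbb R^d\setminus\{0\})$$ be the kernel of $(1-\Delta)^{-\alpha}$ on $\mathbb R^d$, and let $$Z_{\alpha,\varepsilon}:=\int_0^T\!\!\int_0^T K_\alpha(X_t-X_s)\,\langle D^0_\varepsilon X_t,D^0_\varepsilon X_s\rangle\,dt\,ds,\qquad \eta_{\alpha,\varepsilon}(x):=\int_0^T K_{\alpha/2}(x-X_t)\,D^0_\varepsilon X_t\,dt .$$ Consider the condition (B): $\int_0^T\int_0^T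 \widehat K_\alpha(X_t-X_s)\,dt\,ds<\infty$ almost surely, where $\widehat K_\alpha=K_\alpha$ off the origin and $\widehat K_\alpha(0)=+\infty$. Let $\alpha_H:=\frac d2-1+\frac1{2H}$. Then for every $\alpha$ with $0<\alpha<\alpha_H$: (i) if $\alpha>\frac d2-\frac1{2H}$, then (B) holds; (ii) whenever (B) holds (so that $Z_{\alpha,\varepsilon}$ is almost surely an absolutely convergent integral), $Z_{\alpha,\varepsilon}\ge 0$ almost surely for every $\varepsilon>0$, and $$\liminf_{\varepsilon\to0^+}E\,[Z_{\alpha,\varepsilon}]=+\infty ;$$ (iii) in all cases (also if (B) fails, when $\|\eta_{\alpha,\varepsilon}\|^2_{L^2(\mathbb R^d;\mathbb R^d)}\in[0,\infty]$ takes the place of the double integral), $$\liminf_{\varepsilon\to0^+}E\,\big[\|\eta_{\alpha,\varepsilon}\|^2_{L^2(\mathbb R^d;\mathbb R^d)}\big]=+\infty .$$ Expectations of nonnegative variables are taken in $[0,\infty]$. -/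

import Mathlib

open MeasureTheory ProbabilityTheory Filter Topology Set
open scoped ENNReal NNReal

noncomputable section

namespace FBMCurrent

/-- A real fractional Brownian motion with Hurst index `H`: a centred Gaussian process
`(B_t)_{t ≥ 0}` with covariance `(s^{2H} + t^{2H} - |t - s|^{2H}) / 2` and almost surely continuous
paths. -/
structure IsRealFBM {Ω : Type*} [MeasurableSpace Ω] (B : ℝ≥0 → Ω → ℝ) (H : ℝ) (P : Measure Ω) :
    Prop where
  measurable : ∀ t, Measurable (B t)
  gaussian : IsGaussianProcess B P
  mean_zero : ∀ t, ∫ ω, B t ω ∂P = 0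
  covariance_eq : ∀ s t : ℝ≥0, covariance (B s) (B t) P =
    ((s : ℝ) ^ (2 * H) + (t : ℝ) ^ (2 * H) - |(t : ℝ) - (s : ℝ)| ^ (2 * H)) / 2
  continuous_paths : ∀ᵐ ω ∂P, Continuous fun t => B t ω

/-- A `d`-dimensional fractional Brownian motion with Hurst index `H`: its components are
independent real fractional Brownian motions with Hurst index `H`. -/
structure IsFBM {Ω : Type*} [MeasurableSpace Ω] {d : ℕ} (X : ℝ≥0 → Ω → EuclideanSpace ℝ (Fin d))
    (H : ℝ) (P : Measure Ω) : Prop where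
  component : ∀ i : Fin d, IsRealFBM (fun t ω => X t ω i) H P
  independent : iIndepFun (fun (i : Fin d) (ω : Ω) (t : ℝ≥0) => X t ω i) P

/-- The kernel `K_α` of the operator `(1 - Δ)^{-α}` on `ℝ^d`, for `α > 0`, at a point `x ≠ 0`. -/
def kernel {d : ℕ} (α : ℝ) (x : EuclideanSpace ℝ (Fin d)) : ℝ :=
  1 / (Real.Gamma α * (4 * Real.pi) ^ ((d : ℝ) / 2)) *
    ∫ t in Ioi (0 : ℝ), t ^ (α - (d : ℝ) / 2) * Real.exp (-‖x‖ ^ 2 / (4 * t) - t) / t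

/-- The kernel `K_α` with the value `+∞` at the origin. -/
def kernelHat {d : ℕ} (α : ℝ) (x : EuclideanSpace ℝ (Fin d)) : ℝ≥0∞ :=
  open Classical in if x = 0 then ⊤ else ENNReal.ofReal (kernel α x)

variable {Ω : Type*} {d : ℕ}

/-- The position at the real time `t`, with the convention that it is `0` at negative times. -/
def position (X : ℝ≥0 → Ω → EuclideanSpace ℝ (Fin d)) (t : ℝ) (ω : Ω) :
    EuclideanSpace ℝ (Fin d) :=
  if 0 ≤ t then X t.toNNReal ω else 0

/-- The symmetric difference quotient `(X_{t+ε} - X_{t-ε}) / (2ε)`. -/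
def symmQuotient (X : ℝ≥0 → Ω → EuclideanSpace ℝ (Fin d)) (ε t : ℝ) (ω : Ω) :
    EuclideanSpace ℝ (Fin d) :=
  (1 / (2 * ε)) • (position X (t + ε) ω - position X (t - ε) ω)

/-- The double integral of `K_α(X_t - X_s)` over `[0,T]²` converges. -/
def KernelIntegrable (X : ℝ≥0 → Ω → EuclideanSpace ℝ (Fin d)) (T α : ℝ) (ω : Ω) : Prop :=
  ∫⁻ t in Icc (0 : ℝ) T, ∫⁻ s in Icc (0 : ℝ) T,
    kernelHat α (position X t ω - position X s ω) < ⊤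

/-- The double integral `Z_{α,ε}` of `K_α(X_t - X_s) ⟨D_ε X_t, D_ε X_s⟩` over `[0,T]²`. -/
def energy (X : ℝ≥0 → Ω → EuclideanSpace ℝ (Fin d)) (T α ε : ℝ) (ω : Ω) : ℝ :=
  ∫ t in (0 : ℝ)..T, ∫ s in (0 : ℝ)..T,
    kernel α (position X t ω - position X s ω) *
      inner ℝ (symmQuotient X ε t ω) (symmQuotient X ε s ω)

/-- The vector field `η_{α,ε}(x) = ∫₀ᵀ K_{α/2}(x - X_t) D_ε X_t dt`. -/
def currentField (X : ℝ≥0 → Ω → EuclideanSpace ℝ (Fin d)) (T α ε : ℝ) (ω : Ω)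
    (x : EuclideanSpace ℝ (Fin d)) : EuclideanSpace ℝ (Fin d) :=
  ∫ t in (0 : ℝ)..T, kernel (α / 2) (x - position X t ω) • symmQuotient X ε t ω

/-- The squared norm of `η_{α,ε}` in `L²(ℝ^d; ℝ^d)`, a number in `[0, ∞]`. -/
def currentNormSq (X : ℝ≥0 → Ω → EuclideanSpace ℝ (Fin d)) (T α ε : ℝ) (ω : Ω) : ℝ≥0∞ :=
  ∫⁻ x : EuclideanSpace ℝ (Fin d), ‖currentField X T α ε ω x‖ₑ ^ 2

/-- The critical exponent `α_H = d/2 - 1 + 1/(2H)`. -/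
def criticalExponent (d : ℕ) (H : ℝ) : ℝ := (d : ℝ) / 2 - 1 + 1 / (2 * H)

end FBMCurrent

end

/-! The divergence is read off in frequency space. The Fourier transform of `kernel (α / 2)` is `(1
+ 4π²|ξ|²)^(-α/2)`, so the squared norm of the current dominates, for any fixed component `i`, the
integral over `ξ` of `(1 + 4π²|ξ|²)^(-α)` times the squared modulus of `∫₀ᵀ exp(-2πi⟨X_t, ξ⟩) D_ε
X_t^i dt`. Only this one-sided Plancherel inequality is needed. It holds for integrable fields whose
norm may be infinite, which is why claim (iii) needs no condition (B).

Put `l = 2πξ` and `h = t - s`. Gaussian calculus expresses the second moment of the oscillatory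
integral over `[ε, T]` as the double integral of `(quotientCov - (l_i incrementCov)²)
exp(-|l|²|h|^(2H)/2)`. Take `|l| = r^(-H)` with `r` a small multiple of `ε`. The exponential
confines `|h|` to the order of `r`, well below `ε`. There `quotientCov` is at least of order
`ε^(2H-2)`, while the squared term is smaller by a factor `(r/ε)^(2-2H)`. Hence the second moment is
at least of order `ε^(2H-2) r`, that is `ε^(2H-1)`. The times before `ε`, where the convention at
negative times intervenes, contribute only `O(ε^(2H))`.

A ball of such frequencies has volume of order `ε^(-Hd)` and carries the weight `ε^(2Hα)`. The
expectation is therefore at least of order `ε^(2Hα - Hd + 2H - 1) = ε^(2H(α - α_H))`, which blows up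
exactly when `α < α_H`. The steps are `exists_le_integral_quotientCov`,
`IsFBM.exists_le_lintegral_oscillatory_sq` and `IsFBM.exists_le_lintegral_currentNormSq`.

Claim (ii) follows from (iii): the convolution identity `K_{α/2} * K_{α/2} = K_α`, obtained by
writing the kernel as a Gamma mixture of heat kernels, and Fubini, licensed by (B), identify the
double integral with the squared norm. Claim (i) is a first moment estimate: the mean of the kernel
at `X_t - X_s` is bounded by an integrable power of `|t - s|`. -/

noncomputable section

namespace FBMCurrent

section

/-! ### Gamma laws -/

lemma gammaPDF_mul_left {a u : ℝ} (hu : 0 < u) (x : ℝ) :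
    gammaPDF a 1 (u * x) =
      ENNReal.ofReal (u ^ (a - 1) * Real.exp (x - u * x)) * gammaPDF a 1 x := by
  rcases lt_or_ge x 0 with hx | hx
  · rw [gammaPDF_of_neg hx, gammaPDF_of_neg (mul_neg_of_pos_of_neg hu hx), mul_zero]
  · rw [gammaPDF_of_nonneg hx, gammaPDF_of_nonneg (by positivity),
      ← ENNReal.ofReal_mul (by positivity)]
    congr 1
    rw [Real.mul_rpow hu.le hx]
    have : Real.exp (-(1 * (u * x))) = Real.exp (x - u * x) * Real.exp (-(1 * x)) := by
      rw [← Real.exp_add]; ring_nf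
    rw [this]; ring

/-- The substitution `x ↦ u x` pulls all dependence on `u` out of the convolution. The Beta integral
that remains is left unevaluated. -/
lemma lintegral_gammaPDF_mul_gammaPDF_sub {a b u : ℝ} (ha : 0 < a) (hb : 0 < b) (hu : 0 < u) :
    ∫⁻ x, gammaPDF a 1 x * gammaPDF b 1 (u - x) =
      (ENNReal.ofReal (Real.exp 1 * Real.Gamma (a + b)) *
        ∫⁻ x, gammaPDF a 1 x * gammaPDF b 1 (1 - x)) * gammaPDF (a + b) 1 u := by
  have key : ∫⁻ x, gammaPDF a 1 x * gammaPDF b 1 (u - x) =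
      ENNReal.ofReal u * ∫⁻ x, gammaPDF a 1 (u * x) * gammaPDF b 1 (u - u * x) := by
    nth_rewrite 1 [← Real.smul_map_volume_mul_left hu.ne']
    rw [lintegral_smul_measure, lintegral_map (by unfold gammaPDF; fun_prop) (by fun_prop),
      abs_of_pos hu, smul_eq_mul]
  rw [key]
  have h2 : ∀ x, gammaPDF a 1 (u * x) * gammaPDF b 1 (u - u * x) =
      ENNReal.ofReal (u ^ (a - 1) * u ^ (b - 1) * Real.exp (1 - u)) *
        (gammaPDF a 1 x * gammaPDF b 1 (1 - x)) := by
    intro x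
    have : u - u * x = u * (1 - x) := by ring
    rw [this, gammaPDF_mul_left hu, gammaPDF_mul_left hu]
    rw [mul_mul_mul_comm, ← ENNReal.ofReal_mul (by positivity)]
    congr 2
    have : Real.exp (1 - u) = Real.exp (x - u * x) * Real.exp (1 - x - u * (1 - x)) := by
      rw [← Real.exp_add]; ring_nf
    rw [this]; ring
  simp_rw [h2]
  rw [lintegral_const_mul _ (by unfold gammaPDF; fun_prop), gammaPDF_of_nonneg hu.le]
  rw [← mul_assoc, mul_right_comm (ENNReal.ofReal (Real.exp 1 * _)),
    ← ENNReal.ofReal_mul (by positivity), ← ENNReal.ofReal_mul (by positivity)]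
  congr 2
  have h3 : u ^ (a + b - 1) = u * (u ^ (a - 1) * u ^ (b - 1)) := by
    rw [← Real.rpow_add hu, mul_comm, ← Real.rpow_add_one hu.ne']; ring_nf
  have : Real.exp (1 - u) = Real.exp 1 * Real.exp (-(1 * u)) := by
    rw [← Real.exp_add]; ring_nf
  have hG := (Real.Gamma_pos_of_pos (add_pos ha hb)).ne'
  rw [h3, this, Real.one_rpow]
  field_simp

/-- The two sides have proportional densities, and both are probability measures, so the constant of
proportionality is `1`; this replaces the Beta function identity. -/
lemma gammaMeasure_conv_gammaMeasure {a b : ℝ} (ha : 0 < a) (hb : 0 < b) :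
    (gammaMeasure a 1).conv (gammaMeasure b 1) = gammaMeasure (a + b) 1 := by
  have := isProbabilityMeasure_gammaMeasure ha one_pos
  have := isProbabilityMeasure_gammaMeasure hb one_pos
  have := isProbabilityMeasure_gammaMeasure (add_pos ha hb) one_pos
  set k := ENNReal.ofReal (Real.exp 1 * Real.Gamma (a + b)) *
        ∫⁻ x, gammaPDF a 1 x * gammaPDF b 1 (1 - x) with hk
  have m : ∀ c, Measurable (gammaPDF c 1) := fun c => by unfold gammaPDF; fun_prop
  have key : ∀ f : ℝ → ℝ≥0∞, Measurable f →
      ∫⁻ u, f u ∂((gammaMeasure a 1).conv (gammaMeasure b 1)) =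
      k * ∫⁻ u, f u ∂(gammaMeasure (a + b) 1) := by
    intro f hf
    rw [Measure.lintegral_conv hf]
    simp only [gammaMeasure]
    rw [lintegral_withDensity_eq_lintegral_mul _ (m a) (by
      exact Measurable.lintegral_prod_right' (f := fun p : ℝ × ℝ => f (p.1 + p.2)) (by fun_prop))]
    rw [lintegral_withDensity_eq_lintegral_mul _ (m _) hf, ← lintegral_const_mul _ (by fun_prop)]
    calc ∫⁻ x, (gammaPDF a 1 * fun x => ∫⁻ y, f (x + y) ∂(volume.withDensity (gammaPDF b 1))) x
        = ∫⁻ x, ∫⁻ u, gammaPDF a 1 x * gammaPDF b 1 (u - x) * f u := by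
          refine lintegral_congr fun x => ?_
          simp only [Pi.mul_apply]
          rw [lintegral_withDensity_eq_lintegral_mul _ (m b) (by fun_prop),
            ← lintegral_sub_right_eq_self _ x, ← lintegral_const_mul _ (by fun_prop)]
          refine lintegral_congr fun u => ?_
          simp [mul_assoc]
      _ = ∫⁻ u, ∫⁻ x, gammaPDF a 1 x * gammaPDF b 1 (u - x) * f u := by
          rw [lintegral_lintegral_swap]
          exact Measurable.aemeasurable (by fun_prop)
      _ = ∫⁻ u, k * (gammaPDF (a + b) 1 * f) u := by
          have h0 : ∀ᵐ u : ℝ, u ≠ 0 := by simp [ae_iff]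
          refine lintegral_congr_ae (h0.mono fun u hu => ?_)
          simp only [Pi.mul_apply]
          rw [lintegral_mul_const _ (by fun_prop), ← mul_assoc]
          congr 1
          rcases lt_or_gt_of_ne hu with hu | hu
          · rw [gammaPDF_of_neg hu, mul_zero, lintegral_eq_zero_iff (by fun_prop)]
            refine Eventually.of_forall fun x => ?_
            rcases lt_or_ge x 0 with hx | hx
            · simp [gammaPDF_of_neg hx]
            · simp [gammaPDF_of_neg (show u - x < 0 by linarith)]
          · exact lintegral_gammaPDF_mul_gammaPDF_sub ha hb hu
  have hk1 : k = 1 := by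
    have := key (fun _ => 1) measurable_const
    simpa using this.symm
  refine Measure.ext_of_lintegral _ fun f hf => ?_
  rw [key f hf, hk1, one_mul]

/-! ### The heat kernel -/

variable {d : ℕ}

/-- The heat kernel `(4πu)^{-d/2} exp(-|x|²/(4u))`. -/
def heat (u : ℝ) (x : EuclideanSpace ℝ (Fin d)) : ℝ :=
  (4 * Real.pi * u) ^ (-(d : ℝ) / 2) * Real.exp (-‖x‖ ^ 2 / (4 * u))

lemma heat_nonneg {u : ℝ} (hu : 0 ≤ u) (x : EuclideanSpace ℝ (Fin d)) : 0 ≤ heat u x := by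
  unfold heat; positivity

@[fun_prop]
lemma measurable_heat : Measurable fun p : ℝ × EuclideanSpace ℝ (Fin d) => heat p.1 p.2 := by
  unfold heat; fun_prop

lemma integrable_heat {u : ℝ} (hu : 0 < u) :
    Integrable (heat u : EuclideanSpace ℝ (Fin d) → ℝ) := by
  unfold heat
  refine Integrable.const_mul ?_ _
  have := (GaussianFourier.integrable_cexp_neg_mul_sq_norm_add (V := EuclideanSpace ℝ (Fin d))
    (b := ((1 / (4 * u) : ℝ) : ℂ)) (by rw [Complex.ofReal_re]; positivity) 0 0).re
  refine this.congr (Eventually.of_forall fun x => ?_)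
  simp only [inner_zero_left, RCLike.re_eq_complex_re]
  rw [← Complex.exp_ofReal_re]
  congr 2
  push_cast
  ring

lemma integral_heat {u : ℝ} (hu : 0 < u) :
    ∫ x : EuclideanSpace ℝ (Fin d), heat u x = 1 := by
  unfold heat
  rw [integral_const_mul]
  have := GaussianFourier.integral_rexp_neg_mul_sq_norm (V := EuclideanSpace ℝ (Fin d))
    (b := 1 / (4 * u)) (by positivity)
  have h2 : ∀ x : EuclideanSpace ℝ (Fin d), Real.exp (-‖x‖ ^ 2 / (4 * u)) =
      Real.exp (-(1 / (4 * u)) * ‖x‖ ^ 2) := fun x => by congr 1; ring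
  simp_rw [h2, this, finrank_euclideanSpace, Fintype.card_fin]
  rw [show Real.pi / (1 / (4 * u)) = 4 * Real.pi * u by field_simp,
    ← Real.rpow_add (by positivity)]
  simp [neg_div]

lemma lintegral_heat {u : ℝ} (hu : 0 < u) :
    ∫⁻ x : EuclideanSpace ℝ (Fin d), ENNReal.ofReal (heat u x) = 1 := by
  rw [← ofReal_integral_eq_lintegral_ofReal (integrable_heat hu)
    (Eventually.of_forall fun x => heat_nonneg hu.le x), integral_heat hu, ENNReal.ofReal_one]

lemma heat_neg (u : ℝ) (x : EuclideanSpace ℝ (Fin d)) : heat u (-x) = heat u x := by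
  simp [heat]

lemma heat_sub_comm (u : ℝ) (x y : EuclideanSpace ℝ (Fin d)) : heat u (x - y) = heat u (y - x) := by
  rw [← neg_sub, heat_neg]

/-- Completing the square: the weighted barycentre of `a` and `b` is the centre of the Gaussian in
`x`, and the leftover depends on `a - b` alone. Integrating in `x` then gives the heat semigroup
law. -/
lemma heat_mul_heat {u v : ℝ} (hu : 0 < u) (hv : 0 < v) (x a b : EuclideanSpace ℝ (Fin d)) :
    heat u (x - a) * heat v (x - b) =
      heat (u + v) (a - b) *
        heat (u * v / (u + v)) (x - ((v / (u + v)) • a + (u / (u + v)) • b)) := by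
  unfold heat
  rw [mul_mul_mul_comm, mul_mul_mul_comm ((4 * Real.pi * (u + v)) ^ _), ← Real.exp_add,
    ← Real.exp_add,
    ← Real.mul_rpow (by positivity) (by positivity),
    ← Real.mul_rpow (by positivity) (by positivity)]
  have huv : u + v ≠ 0 := by positivity
  congr 2
  · field_simp
  · have e1 : x - ((v / (u + v)) • a + (u / (u + v)) • b) =
        (v / (u + v)) • (x - a) + (u / (u + v)) • (x - b) := by
      have : x = (v / (u + v)) • x + (u / (u + v)) • x := by
        rw [← add_smul, ← add_div, add_comm v u, div_self huv, one_smul]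
      nth_rewrite 1 [this]
      module
    have e2 : a - b = (x - b) - (x - a) := by abel
    rw [e1, e2]
    generalize x - a = p, x - b = q
    rw [norm_sub_sq_real, norm_add_sq_real, norm_smul, norm_smul, inner_smul_left,
      inner_smul_right, real_inner_comm]
    simp only [Real.norm_eq_abs, mul_pow, sq_abs, conj_trivial]
    field_simp
    ring

lemma lintegral_heat_mul_heat {u v : ℝ} (hu : 0 < u) (hv : 0 < v)
    (a b : EuclideanSpace ℝ (Fin d)) :
    ∫⁻ x, ENNReal.ofReal (heat u (x - a)) * ENNReal.ofReal (heat v (x - b)) =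
      ENNReal.ofReal (heat (u + v) (a - b)) := by
  have h : ∀ x, ENNReal.ofReal (heat u (x - a)) * ENNReal.ofReal (heat v (x - b)) =
      ENNReal.ofReal (heat (u + v) (a - b)) * ENNReal.ofReal
        (heat (u * v / (u + v)) (x - ((v / (u + v)) • a + (u / (u + v)) • b))) := by
    intro x
    rw [← ENNReal.ofReal_mul (heat_nonneg hu.le _), heat_mul_heat hu hv,
      ENNReal.ofReal_mul (heat_nonneg (by positivity) _)]
  simp_rw [h]
  rw [lintegral_const_mul _ (by fun_prop),
    lintegral_sub_right_eq_self (fun x => ENNReal.ofReal (heat (u * v / (u + v)) x)),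
    lintegral_heat (by positivity), mul_one]

/-! ### The kernel as a mixture of heat kernels -/

/-- The kernel `K_α` with values in `[0, ∞]`. -/
def kernelE (α : ℝ) (x : EuclideanSpace ℝ (Fin d)) : ℝ≥0∞ :=
  ∫⁻ u, ENNReal.ofReal (heat u x) ∂(gammaMeasure α 1)

@[fun_prop]
lemma measurable_kernelE {α : ℝ} (hα : 0 < α) :
    Measurable (kernelE α : EuclideanSpace ℝ (Fin d) → ℝ≥0∞) := by
  have := isProbabilityMeasure_gammaMeasure hα one_pos
  exact Measurable.lintegral_prod_right'
    (f := fun p : EuclideanSpace ℝ (Fin d) × ℝ => ENNReal.ofReal (heat p.2 p.1)) (by fun_prop)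

lemma ae_pos_gammaMeasure (α : ℝ) : ∀ᵐ u ∂(gammaMeasure α 1), 0 < u := by
  have h0 : ∀ᵐ u : ℝ, u ≠ 0 := by simp [ae_iff]
  rw [gammaMeasure, ae_withDensity_iff (by unfold gammaPDF; fun_prop)]
  filter_upwards [h0] with u hu h
  by_contra hneg
  exact h (gammaPDF_of_neg (lt_of_le_of_ne (not_lt.1 hneg) hu))

lemma lintegral_gammaMeasure {α : ℝ} {f : ℝ → ℝ≥0∞} (hf : Measurable f) :
    ∫⁻ u, f u ∂(gammaMeasure α 1) =
      ∫⁻ u in Ioi (0 : ℝ),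
        ENNReal.ofReal (1 / Real.Gamma α * u ^ (α - 1) * Real.exp (-u)) * f u := by
  rw [gammaMeasure, lintegral_withDensity_eq_lintegral_mul _ (by unfold gammaPDF; fun_prop) hf,
    ← lintegral_indicator measurableSet_Ioi]
  have h0 : ∀ᵐ u : ℝ, u ≠ 0 := by simp [ae_iff]
  refine lintegral_congr_ae (h0.mono fun u hu => ?_)
  simp only [Pi.mul_apply, indicator, mem_Ioi]
  split_ifs with h
  · rw [gammaPDF_of_nonneg h.le]; simp
  · rw [gammaPDF_of_neg (lt_of_le_of_ne (not_lt.1 h) hu), zero_mul]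

lemma gamma_mul_heat_eq {α u : ℝ} (hu : 0 < u) (x : EuclideanSpace ℝ (Fin d)) :
    1 / Real.Gamma α * u ^ (α - 1) * Real.exp (-u) * heat u x =
      1 / (Real.Gamma α * (4 * Real.pi) ^ ((d : ℝ) / 2)) *
        (u ^ (α - (d : ℝ) / 2) * Real.exp (-‖x‖ ^ 2 / (4 * u) - u) / u) := by
  unfold heat
  rw [Real.mul_rpow (by positivity) hu.le, neg_div, Real.rpow_neg (by positivity),
    sub_eq_add_neg (-‖x‖ ^ 2 / (4 * u)), Real.exp_add, Real.rpow_sub_one hu.ne', sub_eq_add_neg,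
    Real.rpow_add hu]
  rw [one_div, one_div, mul_inv]
  ring

/-- This remains true where the integral diverges, which can happen at the origin: the Bochner
integral then takes its default value `0`, as does `ENNReal.toReal ⊤`. -/
lemma kernel_eq_toReal_kernelE {α : ℝ} (hα : 0 < α) (x : EuclideanSpace ℝ (Fin d)) :
    kernel α x = (kernelE α x).toReal := by
  rw [kernel, kernelE, lintegral_gammaMeasure (by fun_prop), ← integral_const_mul,
    integral_eq_lintegral_of_nonneg_ae]
  · congr 1
    refine setLIntegral_congr_fun measurableSet_Ioi fun u hu => ?_
    have hu : 0 < u := hu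
    have := Real.Gamma_pos_of_pos hα
    rw [← ENNReal.ofReal_mul (by positivity), gamma_mul_heat_eq hu]
  · filter_upwards [ae_restrict_mem measurableSet_Ioi] with u hu
    have hu : 0 < u := hu
    have := Real.Gamma_pos_of_pos hα
    simp only [Pi.zero_apply]
    positivity
  · exact Measurable.aestronglyMeasurable (by fun_prop)

/-- Away from the origin the exponential beats any power: `exp y ≥ y^n / n!` trades the Gaussian
factor for `u^n`, which offsets the singularity `u^(-d/2)` at small `u`. -/
lemma heat_le_pow {u : ℝ} (hu : 0 < u) {x : EuclideanSpace ℝ (Fin d)} (hx : x ≠ 0) (n : ℕ) :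
    heat u x ≤ (4 * Real.pi) ^ (-(d : ℝ) / 2) * n.factorial * (4 / ‖x‖ ^ 2) ^ n *
      u ^ ((n : ℝ) - (d : ℝ) / 2) := by
  have hx' : 0 < ‖x‖ := norm_pos_iff.2 hx
  have h1 : Real.exp (-‖x‖ ^ 2 / (4 * u)) ≤ n.factorial * (4 / ‖x‖ ^ 2) ^ n * u ^ n := by
    have := Real.pow_div_factorial_le_exp (‖x‖ ^ 2 / (4 * u)) (by positivity) n
    rw [neg_div, Real.exp_neg]
    rw [inv_le_comm₀ (Real.exp_pos _) (by positivity)]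
    refine le_trans (le_of_eq ?_) this
    rw [div_pow, div_pow, mul_pow]
    field_simp
  unfold heat
  rw [Real.mul_rpow (by positivity) hu.le, sub_eq_add_neg, Real.rpow_add hu, Real.rpow_natCast,
    ← neg_div]
  calc _ ≤ (4 * Real.pi) ^ (-(d : ℝ) / 2) * u ^ (-(d : ℝ) / 2) *
        (n.factorial * (4 / ‖x‖ ^ 2) ^ n * u ^ n) := by gcongr
    _ = _ := by ring

lemma kernelE_lt_top {α : ℝ} (hα : 0 < α) {x : EuclideanSpace ℝ (Fin d)} (hx : x ≠ 0) :
    kernelE α x < ⊤ := by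
  -- With `n > d/2` the dominating integrand is that of `Γ(α + n - d/2)`, whose argument is
  -- positive.
  obtain ⟨n, hn⟩ := exists_nat_gt ((d : ℝ) / 2)
  have hG := Real.Gamma_pos_of_pos hα
  set C := (4 * Real.pi) ^ (-(d : ℝ) / 2) * n.factorial * (4 / ‖x‖ ^ 2) ^ n
  have hC : 0 ≤ C := by positivity
  rw [kernelE, lintegral_gammaMeasure (by fun_prop)]
  have hint := (Real.GammaIntegral_convergent (s := α + (n - (d : ℝ) / 2)) (by linarith)).const_mul
    (1 / Real.Gamma α * C)
  refine lt_of_le_of_lt ?_ hint.lintegral_lt_top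
  refine setLIntegral_mono' measurableSet_Ioi fun u hu => ?_
  have hu : 0 < u := hu
  rw [← ENNReal.ofReal_mul (by positivity)]
  refine ENNReal.ofReal_le_ofReal ?_
  calc _ ≤ 1 / Real.Gamma α * u ^ (α - 1) * Real.exp (-u) * (C * u ^ ((n : ℝ) - (d : ℝ) / 2)) := by
        gcongr; exact heat_le_pow hu hx n
    _ = _ := by
        rw [show α + (n - (d : ℝ) / 2) - 1 = (α - 1) + (n - (d : ℝ) / 2) by ring, Real.rpow_add hu]
        ring

lemma ofReal_kernel {α : ℝ} (hα : 0 < α) {x : EuclideanSpace ℝ (Fin d)} (hx : x ≠ 0) :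
    ENNReal.ofReal (kernel α x) = kernelE α x := by
  rw [kernel_eq_toReal_kernelE hα, ENNReal.ofReal_toReal (kernelE_lt_top hα hx).ne]

lemma kernelE_le_kernelHat {α : ℝ} (hα : 0 < α) (x : EuclideanSpace ℝ (Fin d)) :
    kernelE α x ≤ kernelHat α x := by
  rw [kernelHat]
  split_ifs with h
  · exact le_top
  · rw [ofReal_kernel hα h]

lemma kernelHat_of_ne_zero {α : ℝ} (hα : 0 < α) {x : EuclideanSpace ℝ (Fin d)} (hx : x ≠ 0) :
    kernelHat α x = kernelE α x := by
  rw [kernelHat, if_neg hx, ofReal_kernel hα hx]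

lemma kernel_nonneg {α : ℝ} (hα : 0 < α) (x : EuclideanSpace ℝ (Fin d)) : 0 ≤ kernel α x := by
  rw [kernel_eq_toReal_kernelE hα]; exact ENNReal.toReal_nonneg

@[fun_prop]
lemma measurable_kernel {α : ℝ} (hα : 0 < α) :
    Measurable (kernel α : EuclideanSpace ℝ (Fin d) → ℝ) := by
  simp_rw [funext (kernel_eq_toReal_kernelE (d := d) hα)]
  exact (measurable_kernelE hα).ennreal_toReal

@[fun_prop]
lemma measurable_kernelHat {α : ℝ} (hα : 0 < α) :
    Measurable (kernelHat α : EuclideanSpace ℝ (Fin d) → ℝ≥0∞) := by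
  unfold kernelHat
  exact Measurable.ite (measurableSet_singleton 0) measurable_const
    (measurable_kernel hα).ennreal_ofReal

lemma lintegral_kernelE {α : ℝ} (hα : 0 < α) :
    ∫⁻ x : EuclideanSpace ℝ (Fin d), kernelE α x = 1 := by
  have := isProbabilityMeasure_gammaMeasure hα one_pos
  unfold kernelE
  rw [lintegral_lintegral_swap (Measurable.aemeasurable (by fun_prop))]
  rw [lintegral_congr_ae ((ae_pos_gammaMeasure α).mono fun u hu => lintegral_heat hu)]
  simp

/-- Mixing the heat semigroup law over two Gamma laws produces the law of the sum of the two times,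
which is Gamma with parameter `α + β`. With values in `[0, ∞]` the identity also covers `a = b`. -/
lemma lintegral_kernelE_mul_kernelE {α β : ℝ} (hα : 0 < α) (hβ : 0 < β)
    (a b : EuclideanSpace ℝ (Fin d)) :
    ∫⁻ x, kernelE α (x - a) * kernelE β (x - b) = kernelE (α + β) (a - b) := by
  have := isProbabilityMeasure_gammaMeasure hα one_pos
  have := isProbabilityMeasure_gammaMeasure hβ one_pos
  have h1 : ∀ x, kernelE α (x - a) * kernelE β (x - b) =
      ∫⁻ u, ∫⁻ v, ENNReal.ofReal (heat u (x - a)) * ENNReal.ofReal (heat v (x - b))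
        ∂(gammaMeasure β 1) ∂(gammaMeasure α 1) := by
    intro x
    unfold kernelE
    rw [← lintegral_mul_const _ (by fun_prop)]
    refine lintegral_congr fun u => ?_
    rw [← lintegral_const_mul _ (by fun_prop)]
  simp_rw [h1]
  rw [lintegral_lintegral_swap]
  swap
  · exact Measurable.aemeasurable (Measurable.lintegral_prod_right'
      (f := fun p : (EuclideanSpace ℝ (Fin d) × ℝ) × ℝ =>
      ENNReal.ofReal (heat p.1.2 (p.1.1 - a)) * ENNReal.ofReal (heat p.2 (p.1.1 - b)))
      (by fun_prop))
  rw [kernelE, ← gammaMeasure_conv_gammaMeasure hα hβ, Measure.lintegral_conv (by fun_prop)]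
  refine lintegral_congr_ae ((ae_pos_gammaMeasure α).mono fun u hu => ?_)
  simp only
  rw [lintegral_lintegral_swap (Measurable.aemeasurable (by fun_prop))]
  refine lintegral_congr_ae ((ae_pos_gammaMeasure β).mono fun v hv => ?_)
  exact lintegral_heat_mul_heat hu hv a b

end

/-! ### Fourier transforms: one-sided Plancherel inequality and the symbol of the kernel -/

section

variable {d : ℕ}

open FourierTransform

lemma ennreal_mul_le_half_add_sq (p q : ℝ≥0∞) : p * q ≤ 2⁻¹ * (p ^ 2 + q ^ 2) := by
  have h2 : (2⁻¹ : ℝ≥0∞) ≠ 0 := ENNReal.inv_ne_zero.2 ENNReal.ofNat_ne_top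
  induction p with
  | top => simp [h2]
  | coe p =>
    induction q with
    | top => simp [h2]
    | coe q =>
      rw [← ENNReal.coe_two, ← ENNReal.coe_inv two_ne_zero]
      norm_cast
      rw [← NNReal.coe_le_coe]
      push_cast
      nlinarith [sq_nonneg ((p : ℝ) - q)]

/-- A Schur test: `f x * f y` is at most the mean of the two squares, and the heat kernel has mass
one in either variable. -/
lemma lintegral_mul_heat_le {u : ℝ} (hu : 0 < u) {f : EuclideanSpace ℝ (Fin d) → ℝ≥0∞}
    (hf : Measurable f) :
    ∫⁻ x, ∫⁻ y, f x * f y * ENNReal.ofReal (heat u (x - y)) ≤ ∫⁻ x, f x ^ 2 := by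
  have h1 : ∀ x y, f x * f y * ENNReal.ofReal (heat u (x - y)) ≤
      2⁻¹ * (f x ^ 2 * ENNReal.ofReal (heat u (y - x))) +
        2⁻¹ * (f y ^ 2 * ENNReal.ofReal (heat u (y - x))) := by
    intro x y
    rw [heat_sub_comm u x y, ← mul_add, ← add_mul, ← mul_assoc]
    exact mul_le_mul_left (ennreal_mul_le_half_add_sq _ _) _
  have hh : ∀ x : EuclideanSpace ℝ (Fin d), ∫⁻ y, ENNReal.ofReal (heat u (y - x)) = 1 := fun x => by
    rw [lintegral_sub_right_eq_self (fun y => ENNReal.ofReal (heat u y)), lintegral_heat hu]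
  have h2 : ∫⁻ x, ∫⁻ y, 2⁻¹ * (f x ^ 2 * ENNReal.ofReal (heat u (y - x))) =
      2⁻¹ * ∫⁻ x, f x ^ 2 := by
    rw [← lintegral_const_mul _ (by fun_prop)]
    refine lintegral_congr fun x => ?_
    rw [lintegral_const_mul _ (by fun_prop), lintegral_const_mul _ (by fun_prop), hh, mul_one]
  have h3 : ∫⁻ x, ∫⁻ y, 2⁻¹ * (f y ^ 2 * ENNReal.ofReal (heat u (y - x))) =
      2⁻¹ * ∫⁻ x, f x ^ 2 := by
    rw [lintegral_lintegral_swap (Measurable.aemeasurable (by fun_prop)), ← h2]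
    refine lintegral_congr fun x => lintegral_congr fun y => ?_
    rw [heat_sub_comm]
  calc _ ≤ ∫⁻ x, ∫⁻ y, (2⁻¹ * (f x ^ 2 * ENNReal.ofReal (heat u (y - x))) +
        2⁻¹ * (f y ^ 2 * ENNReal.ofReal (heat u (y - x)))) :=
        lintegral_mono fun x => lintegral_mono fun y => h1 x y
    _ = ∫⁻ x, f x ^ 2 := by
        have : ∀ x, ∫⁻ y, (2⁻¹ * (f x ^ 2 * ENNReal.ofReal (heat u (y - x))) +
          2⁻¹ * (f y ^ 2 * ENNReal.ofReal (heat u (y - x)))) =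
          (∫⁻ y, 2⁻¹ * (f x ^ 2 * ENNReal.ofReal (heat u (y - x)))) +
          ∫⁻ y, 2⁻¹ * (f y ^ 2 * ENNReal.ofReal (heat u (y - x))) := fun x =>
          lintegral_add_left (by fun_prop) _
        simp_rw [this]
        rw [lintegral_add_left, h2, h3, ← add_mul, ENNReal.inv_two_add_inv_two, one_mul]
        exact Measurable.lintegral_prod_right' (f := fun p : _ × _ =>
          2⁻¹ * (f p.1 ^ 2 * ENNReal.ofReal (heat u (p.2 - p.1)))) (by fun_prop)

lemma enorm_ofReal_complex (r : ℝ) : ‖(r : ℂ)‖ₑ = ‖r‖ₑ := by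
  rw [← ofReal_norm, ← ofReal_norm, Complex.norm_real]

lemma conj_fourier (f : EuclideanSpace ℝ (Fin d) → ℂ) (ξ : EuclideanSpace ℝ (Fin d)) :
    (starRingEnd ℂ) (𝓕 f ξ) = 𝓕 (fun x => (starRingEnd ℂ) (f x)) (-ξ) := by
  rw [Real.fourier_eq', Real.fourier_eq', ← integral_conj]
  refine integral_congr_ae (Eventually.of_forall fun x => ?_)
  simp only [smul_eq_mul, map_mul, ← Complex.exp_conj, Complex.conj_I, Complex.conj_ofReal]
  congr 2
  simp

lemma norm_fourier_le (f : EuclideanSpace ℝ (Fin d) → ℂ) (ξ : EuclideanSpace ℝ (Fin d)) :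
    ‖𝓕 f ξ‖ ≤ ∫ x, ‖f x‖ :=
  VectorFourier.norm_fourierIntegral_le_integral_norm _ _ _ _ _

lemma continuous_fourier_of_integrable {f : EuclideanSpace ℝ (Fin d) → ℂ} (hf : Integrable f) :
    Continuous (𝓕 f) :=
  VectorFourier.fourierIntegral_continuous Real.continuous_fourierChar
    (innerSL ℝ).continuous₂ hf

lemma integral_fourier_mul_eq {f g : EuclideanSpace ℝ (Fin d) → ℂ} (hf : Integrable f)
    (hg : Integrable g) : ∫ ξ, 𝓕 f ξ * g ξ = ∫ x, f x * 𝓕 g x := by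
  have := VectorFourier.integral_fourierIntegral_smul_eq_flip (μ := volume) (ν := volume)
    (L := innerₗ (EuclideanSpace ℝ (Fin d))) Real.continuous_fourierChar
    (innerSL ℝ).continuous₂ hf hg
  simp only [flip_innerₗ, smul_eq_mul] at this
  exact this

lemma ofReal_heat_eq {b : ℝ} (hb : 0 < b) (x : EuclideanSpace ℝ (Fin d)) :
    (heat (b / (4 * Real.pi ^ 2)) x : ℂ) = (Real.pi / b) ^ ((d : ℂ) / 2) *
      Complex.exp (-Real.pi ^ 2 * ‖x‖ ^ 2 / b) := by
  unfold heat
  rw [show 4 * Real.pi * (b / (4 * Real.pi ^ 2)) = (Real.pi / b)⁻¹ by field_simp,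
    neg_div, Real.rpow_neg (by positivity), ← Real.inv_rpow (by positivity), inv_inv]
  push_cast
  rw [Complex.ofReal_cpow (by positivity)]
  push_cast
  congr 2
  have : (b : ℂ) ≠ 0 := by exact_mod_cast hb.ne'
  have : (Real.pi : ℂ) ≠ 0 := by exact_mod_cast Real.pi_ne_zero
  field_simp

lemma integrable_cexp_neg_mul_sq {b : ℝ} (hb : 0 < b) :
    Integrable fun ξ : EuclideanSpace ℝ (Fin d) => Complex.exp (-b * ‖ξ‖ ^ 2) := by
  simpa using GaussianFourier.integrable_cexp_neg_mul_sq_norm_add (V := EuclideanSpace ℝ (Fin d))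
    (b := (b : ℂ)) (by simpa using hb) 0 0

/-- The Gaussian weighted `L²` norm of a Fourier transform. -/
lemma integral_gaussian_mul_fourier {b : ℝ} (hb : 0 < b) {f : EuclideanSpace ℝ (Fin d) → ℂ}
    (hf : Integrable f) :
    ∫ ξ, 𝓕 f ξ * (Complex.exp (-b * ‖ξ‖ ^ 2) * (starRingEnd ℂ) (𝓕 f ξ)) =
      ∫ x, f x * ∫ y, (starRingEnd ℂ) (f y) * (heat (b / (4 * Real.pi ^ 2)) (x - y) : ℂ) := by
  have hg : Integrable fun ξ => Complex.exp (-b * ‖ξ‖ ^ 2) * (starRingEnd ℂ) (𝓕 f ξ) := by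
    refine (integrable_cexp_neg_mul_sq hb).mul_bdd (c := ∫ x, ‖f x‖) ?_ ?_
    · exact (Complex.continuous_conj.comp
        (continuous_fourier_of_integrable hf)).aestronglyMeasurable
    · exact Eventually.of_forall fun ξ => by simpa using norm_fourier_le f ξ
  rw [integral_fourier_mul_eq hf hg]
  congr 1 with x
  congr 1
  have hcf : Integrable fun x => (starRingEnd ℂ) (f x) := by
    simpa using Complex.conjLIE.integrable_comp_iff.2 hf
  -- A Gaussian modulated by `x` has as Fourier transform the heat kernel centred at `x`, so a
  -- second use of the multiplication formula evaluates the inner transform.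
  have hgau : Integrable fun v : EuclideanSpace ℝ (Fin d) =>
      Complex.exp (-b * ‖v‖ ^ 2 + 2 * Real.pi * Complex.I * inner ℝ x v) :=
    GaussianFourier.integrable_cexp_neg_mul_sq_norm_add (b := (b : ℂ)) (by simpa using hb) _ x
  have h := integral_fourier_mul_eq hcf hgau
  have h2 : ∀ y : EuclideanSpace ℝ (Fin d),
      𝓕 (fun v : EuclideanSpace ℝ (Fin d) =>
        Complex.exp (-b * ‖v‖ ^ 2 + 2 * Real.pi * Complex.I * inner ℝ x v)) y =
      (heat (b / (4 * Real.pi ^ 2)) (x - y) : ℂ) := by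
    intro y
    rw [fourier_gaussian_innerProductSpace' (by simpa using hb), ofReal_heat_eq hb]
    simp
  simp_rw [h2] at h
  rw [← h, Real.fourier_eq', ← integral_neg_eq_self]
  refine integral_congr_ae (Eventually.of_forall fun ξ => ?_)
  simp only [conj_fourier, neg_neg, smul_eq_mul, norm_neg, Complex.exp_add]
  have : Complex.exp (((-2 * Real.pi * inner ℝ (-ξ) x : ℝ) : ℂ) * Complex.I) =
      Complex.exp (2 * Real.pi * Complex.I * inner ℝ x ξ) := by
    rw [inner_neg_left, real_inner_comm]
    congr 1
    push_cast
    ring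
  rw [this]
  ring

/-- Half of Plancherel, without assuming `f` square integrable. Inserting the weight `exp(-b|ξ|²)`
turns the left side into a heat-kernel pairing of `f` with itself, bounded by the right side
uniformly in `b`; Fatou's lemma lets `b → 0`. -/
lemma lintegral_fourier_sq_le {f : EuclideanSpace ℝ (Fin d) → ℂ} (hf : Integrable f)
    (hfm : Measurable f) :
    ∫⁻ ξ, ‖𝓕 f ξ‖ₑ ^ 2 ≤ ∫⁻ x, ‖f x‖ₑ ^ 2 := by
  have key : ∀ b : ℝ, 0 < b →
      ∫⁻ ξ, ENNReal.ofReal (Real.exp (-b * ‖ξ‖ ^ 2)) * ‖𝓕 f ξ‖ₑ ^ 2 ≤ ∫⁻ x, ‖f x‖ₑ ^ 2 := by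
    intro b hb
    have hu : 0 < b / (4 * Real.pi ^ 2) := by positivity
    refine le_trans ?_ (lintegral_mul_heat_le hu (f := fun x => ‖f x‖ₑ) (by fun_prop))
    have hi : Integrable fun ξ : EuclideanSpace ℝ (Fin d) =>
        Real.exp (-b * ‖ξ‖ ^ 2) * ‖𝓕 f ξ‖ ^ 2 := by
      refine Integrable.mul_bdd (c := (∫ x, ‖f x‖) ^ 2) ?_ ?_ ?_
      · refine (integrable_cexp_neg_mul_sq hb).norm.congr (Eventually.of_forall fun ξ => ?_)
        simp only
        rw [Complex.norm_exp]
        norm_cast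
      · exact ((continuous_fourier_of_integrable hf).norm.pow 2).aestronglyMeasurable
      · refine Eventually.of_forall fun ξ => ?_
        rw [norm_pow, norm_norm]
        have := norm_fourier_le f ξ
        gcongr
    have e1 : ∫⁻ ξ, ENNReal.ofReal (Real.exp (-b * ‖ξ‖ ^ 2)) * ‖𝓕 f ξ‖ₑ ^ 2 =
        ‖∫ ξ, 𝓕 f ξ * (Complex.exp (-b * ‖ξ‖ ^ 2) * (starRingEnd ℂ) (𝓕 f ξ))‖ₑ := by
      have : ∀ ξ, 𝓕 f ξ * (Complex.exp (-b * ‖ξ‖ ^ 2) * (starRingEnd ℂ) (𝓕 f ξ)) =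
          ((Real.exp (-b * ‖ξ‖ ^ 2) * ‖𝓕 f ξ‖ ^ 2 : ℝ) : ℂ) := by
        intro ξ
        rw [mul_left_comm, Complex.mul_conj, Complex.normSq_eq_norm_sq]
        push_cast
        rfl
      simp_rw [this]
      rw [integral_complex_ofReal, enorm_ofReal_complex, Real.enorm_of_nonneg
        (integral_nonneg fun ξ => by positivity), ofReal_integral_eq_lintegral_ofReal hi
        (Eventually.of_forall fun ξ => by positivity)]
      refine lintegral_congr fun ξ => ?_
      rw [ENNReal.ofReal_mul (by positivity), ENNReal.ofReal_pow (by positivity), ofReal_norm]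
    rw [e1, integral_gaussian_mul_fourier hb hf]
    refine (enorm_integral_le_lintegral_enorm _).trans (lintegral_mono fun x => ?_)
    rw [enorm_mul]
    refine (mul_le_mul_right (enorm_integral_le_lintegral_enorm _) _).trans (le_of_eq ?_)
    have hm : Measurable fun y => (starRingEnd ℂ) (f y) :=
      Complex.continuous_conj.measurable.comp hfm
    rw [← lintegral_const_mul _ (by fun_prop)]
    refine lintegral_congr fun y => ?_
    rw [enorm_mul, mul_assoc, RCLike.enorm_conj, enorm_ofReal_complex,
      Real.enorm_of_nonneg (heat_nonneg hu.le _)]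
  have hlim : ∀ ξ, Tendsto (fun n : ℕ =>
      ENNReal.ofReal (Real.exp (-(1 / ((n : ℝ) + 1)) * ‖ξ‖ ^ 2)) *
      ‖𝓕 f ξ‖ₑ ^ 2) atTop (𝓝 (‖𝓕 f ξ‖ₑ ^ 2)) := by
    intro ξ
    have h1 : Tendsto (fun n : ℕ => Real.exp (-(1 / ((n : ℝ) + 1)) * ‖ξ‖ ^ 2)) atTop (𝓝 1) := by
      have := (tendsto_one_div_add_atTop_nhds_zero_nat (𝕜 := ℝ)).neg.mul_const (‖ξ‖ ^ 2)
      simpa [Function.comp_def] using (Real.continuous_exp.tendsto _).comp this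
    have h2 := ENNReal.Tendsto.mul_const (b := ‖𝓕 f ξ‖ₑ ^ 2) (ENNReal.tendsto_ofReal h1) (by simp)
    simpa using h2
  calc ∫⁻ ξ, ‖𝓕 f ξ‖ₑ ^ 2 = ∫⁻ ξ, liminf (fun n : ℕ =>
        ENNReal.ofReal (Real.exp (-(1 / ((n : ℝ) + 1)) * ‖ξ‖ ^ 2)) * ‖𝓕 f ξ‖ₑ ^ 2) atTop :=
        lintegral_congr fun ξ => ((hlim ξ).liminf_eq).symm
    _ ≤ liminf (fun n : ℕ => ∫⁻ ξ, ENNReal.ofReal (Real.exp (-(1 / ((n : ℝ) + 1)) * ‖ξ‖ ^ 2)) *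
        ‖𝓕 f ξ‖ₑ ^ 2) atTop := by
        refine lintegral_liminf_le fun n => ?_
        have := (continuous_fourier_of_integrable hf).measurable
        fun_prop
    _ ≤ ∫⁻ x, ‖f x‖ₑ ^ 2 := by
        refine liminf_le_of_frequently_le' (Frequently.of_forall fun n => ?_)
        exact key _ (by positivity)

/-! ### The Fourier transform of the kernel -/

lemma kernel_eq_integral {α : ℝ} (hα : 0 < α) (x : EuclideanSpace ℝ (Fin d)) :
    kernel α x = ∫ u, heat u x ∂(gammaMeasure α 1) := by
  rw [kernel_eq_toReal_kernelE hα, integral_eq_lintegral_of_nonneg_ae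
    ((ae_pos_gammaMeasure α).mono fun u hu => heat_nonneg hu.le x)
    (Measurable.aestronglyMeasurable (by fun_prop)), kernelE]

lemma fourier_eq_integral_mul (f : EuclideanSpace ℝ (Fin d) → ℂ) (ξ : EuclideanSpace ℝ (Fin d)) :
    𝓕 f ξ = ∫ x, Complex.exp (((-2 * Real.pi * inner ℝ x ξ : ℝ) : ℂ) * Complex.I) * f x :=
  Real.fourier_eq' f ξ

lemma fourier_heat {u : ℝ} (hu : 0 < u) (ξ : EuclideanSpace ℝ (Fin d)) :
    𝓕 (fun x => (heat u x : ℂ)) ξ = (Real.exp (-(4 * Real.pi ^ 2 * ‖ξ‖ ^ 2) * u) : ℂ) := by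
  have h1 : (fun x : EuclideanSpace ℝ (Fin d) => (heat u x : ℂ)) = fun x =>
      (((4 * Real.pi * u) ^ (-(d : ℝ) / 2) : ℝ) : ℂ) *
        Complex.exp (-((1 / (4 * u) : ℝ) : ℂ) * ‖x‖ ^ 2) := by
    ext x
    unfold heat
    push_cast
    congr 2
    ring
  rw [h1, fourier_eq_integral_mul]
  simp_rw [mul_left_comm]
  rw [integral_const_mul]
  rw [← fourier_eq_integral_mul, fourier_gaussian_innerProductSpace
    (by rw [Complex.ofReal_re]; positivity)]
  simp only [finrank_euclideanSpace, Fintype.card_fin]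
  have h2 : (Real.pi / ((1 / (4 * u) : ℝ) : ℂ)) = ((4 * Real.pi * u : ℝ) : ℂ) := by
    push_cast; field_simp
  rw [h2, show ((d : ℂ) / 2) = (((d : ℝ) / 2 : ℝ) : ℂ) by push_cast; rfl,
    ← Complex.ofReal_cpow (by positivity), ← mul_assoc, ← Complex.ofReal_mul,
    ← Real.rpow_add (by positivity)]
  have hu' : (u : ℂ) ≠ 0 := by exact_mod_cast hu.ne'
  simp only [neg_div, neg_add_cancel, Real.rpow_zero, Complex.ofReal_one, one_mul]
  push_cast
  congr 1
  field_simp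

lemma integral_exp_gammaMeasure {α c : ℝ} (hα : 0 < α) (hc : 0 ≤ c) :
    ∫ u, Real.exp (-c * u) ∂(gammaMeasure α 1) = (1 + c) ^ (-α) := by
  rw [integral_eq_lintegral_of_nonneg_ae (Eventually.of_forall fun u => (Real.exp_pos _).le)
    (Measurable.aestronglyMeasurable (by fun_prop)), lintegral_gammaMeasure (by fun_prop)]
  have hG := Real.Gamma_pos_of_pos hα
  have h1 : ∫⁻ u in Ioi (0 : ℝ), ENNReal.ofReal (1 / Real.Gamma α * u ^ (α - 1) * Real.exp (-u)) *
      ENNReal.ofReal (Real.exp (-c * u)) = ∫⁻ u in Ioi (0 : ℝ), ENNReal.ofReal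
        (1 / Real.Gamma α * (u ^ (α - 1) * Real.exp (-((1 + c) * u)))) := by
    refine setLIntegral_congr_fun measurableSet_Ioi fun u hu => ?_
    have hu : 0 < u := hu
    rw [← ENNReal.ofReal_mul (by positivity), mul_assoc, mul_assoc, ← Real.exp_add]
    congr 4
    ring
  rw [h1, ← integral_eq_lintegral_of_nonneg_ae, integral_const_mul,
    Real.integral_rpow_mul_exp_neg_mul_Ioi hα (by linarith), one_div (1 + c),
    Real.inv_rpow (by linarith), Real.rpow_neg (by linarith)]
  · field_simp
  · filter_upwards [ae_restrict_mem measurableSet_Ioi] with u hu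
    have hu : 0 < u := hu
    simp only [Pi.zero_apply]
    positivity
  · exact Measurable.aestronglyMeasurable (by fun_prop)

/-- The heat kernel at time `u` has transform `exp(-4π²|ξ|²u)`, and averaging it over the Gamma law
gives the Laplace transform of that law. -/
lemma fourier_kernel {α : ℝ} (hα : 0 < α) (ξ : EuclideanSpace ℝ (Fin d)) :
    𝓕 (fun x => (kernel α x : ℂ)) ξ = (((1 + 4 * Real.pi ^ 2 * ‖ξ‖ ^ 2) ^ (-α) : ℝ) : ℂ) := by
  have := isProbabilityMeasure_gammaMeasure hα one_pos
  rw [fourier_eq_integral_mul]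
  simp_rw [kernel_eq_integral hα, ← integral_complex_ofReal, ← integral_const_mul]
  rw [integral_integral_swap]
  · rw [← integral_exp_gammaMeasure hα (by positivity), ← integral_complex_ofReal]
    refine integral_congr_ae ((ae_pos_gammaMeasure α).mono fun u hu => ?_)
    simp only
    rw [← fourier_eq_integral_mul, fourier_heat hu]
  · have hm : AEStronglyMeasurable (fun p : EuclideanSpace ℝ (Fin d) × ℝ =>
        Complex.exp (((-2 * Real.pi * inner ℝ p.1 ξ : ℝ) : ℂ) * Complex.I) * (heat p.2 p.1 : ℂ))
        (volume.prod (gammaMeasure α 1)) := by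
      refine AEStronglyMeasurable.mul ?_ ?_
      · exact (Continuous.aestronglyMeasurable (by fun_prop))
      · exact Measurable.aestronglyMeasurable (by fun_prop)
    refine ⟨hm, ?_⟩
    simp only [Function.uncurry_def]
    rw [HasFiniteIntegral, lintegral_prod _ hm.enorm]
    have : ∀ x : EuclideanSpace ℝ (Fin d), ∫⁻ u, ‖Complex.exp (((-2 * Real.pi *
        inner ℝ x ξ : ℝ) : ℂ) * Complex.I) * (heat u x : ℂ)‖ₑ ∂(gammaMeasure α 1) =
          kernelE α x := by
      intro x
      refine lintegral_congr_ae ((ae_pos_gammaMeasure α).mono fun u hu => ?_)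
      simp only
      rw [← ofReal_norm, norm_mul, Complex.norm_exp_ofReal_mul_I, one_mul, Complex.norm_real,
        Real.norm_of_nonneg
        (heat_nonneg hu.le x)]
    simp_rw [this]
    rw [lintegral_kernelE hα]
    exact ENNReal.one_lt_top

end

section

variable {d : ℕ}

open FourierTransform

/-! ### Currents along deterministic measurable paths -/

/-- The two sides can differ only where `kernelE` is infinite, and total mass one makes that a null
set. -/
lemma ae_ofReal_kernel {β : ℝ} (hβ : 0 < β) (a : EuclideanSpace ℝ (Fin d)) :
    ∀ᵐ y : EuclideanSpace ℝ (Fin d), ENNReal.ofReal (kernel β (y - a)) = kernelE β (y - a) := by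
  have h1 : ∫⁻ y, kernelE β (y - a) ≠ ⊤ := by
    rw [lintegral_sub_right_eq_self (fun y => kernelE β y), lintegral_kernelE hβ]
    exact ENNReal.one_ne_top
  filter_upwards [ae_lt_top (by fun_prop (disch := assumption)) h1] with y hy
  rw [kernel_eq_toReal_kernelE hβ, ENNReal.ofReal_toReal hy.ne]

lemma lintegral_ofReal_kernel {β : ℝ} (hβ : 0 < β) (a : EuclideanSpace ℝ (Fin d)) :
    ∫⁻ y, ENNReal.ofReal (kernel β (y - a)) = 1 := by
  rw [lintegral_congr_ae (ae_ofReal_kernel hβ a),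
    lintegral_sub_right_eq_self (fun y => kernelE β y), lintegral_kernelE hβ]

lemma lintegral_ofReal_kernel_mul_kernel {β : ℝ} (hβ : 0 < β) (a b : EuclideanSpace ℝ (Fin d)) :
    ∫⁻ y, ENNReal.ofReal (kernel β (y - a) * kernel β (y - b)) = kernelE (2 * β) (a - b) := by
  rw [two_mul, ← lintegral_kernelE_mul_kernelE hβ hβ]
  refine lintegral_congr_ae ?_
  filter_upwards [ae_ofReal_kernel hβ a, ae_ofReal_kernel hβ b] with y h1 h2
  rw [ENNReal.ofReal_mul (kernel_nonneg hβ _), h1, h2]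

lemma integral_kernel_mul_kernel {β : ℝ} (hβ : 0 < β) (a b : EuclideanSpace ℝ (Fin d)) :
    ∫ y, kernel β (y - a) * kernel β (y - b) = kernel (2 * β) (a - b) := by
  have hm := measurable_kernel (d := d) hβ
  rw [integral_eq_lintegral_of_nonneg_ae (Eventually.of_forall fun y =>
    mul_nonneg (kernel_nonneg hβ _) (kernel_nonneg hβ _))
    (Measurable.aestronglyMeasurable (by fun_prop)), lintegral_ofReal_kernel_mul_kernel hβ,
    kernel_eq_toReal_kernelE (by linarith)]

section Path

variable {x v : ℝ → EuclideanSpace ℝ (Fin d)} {β T C : ℝ}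

lemma integrable_kernel_smul_prod (hβ : 0 < β) (hx : Measurable x) (hv : Measurable v)
    (hC : ∀ t ∈ Ioc 0 T, ‖v t‖ ≤ C) :
    Integrable (fun p : EuclideanSpace ℝ (Fin d) × ℝ => kernel β (p.1 - x p.2) • v p.2)
      (volume.prod (volume.restrict (Ioc 0 T))) := by
  have hm := measurable_kernel (d := d) hβ
  have hF : Measurable (fun p : EuclideanSpace ℝ (Fin d) × ℝ =>
      kernel β (p.1 - x p.2) • v p.2) := by
    fun_prop
  refine ⟨hF.aestronglyMeasurable, ?_⟩
  rw [HasFiniteIntegral, lintegral_prod_symm _ (by fun_prop)]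
  have h1 : ∀ t ∈ Ioc 0 T, ∫⁻ y, ‖kernel β (y - x t) • v t‖ₑ ≤ ENNReal.ofReal C := by
    intro t ht
    simp_rw [enorm_smul, Real.enorm_of_nonneg (kernel_nonneg hβ _)]
    rw [lintegral_mul_const _ (by fun_prop), lintegral_ofReal_kernel hβ, one_mul, ← ofReal_norm]
    exact ENNReal.ofReal_le_ofReal (hC t ht)
  refine lt_of_le_of_lt (setLIntegral_mono' measurableSet_Ioc h1) ?_
  simp [ENNReal.mul_lt_top]

lemma fourier_kernel_integral (hβ : 0 < β) (hT : 0 ≤ T) (hx : Measurable x) {w : ℝ → ℝ}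
    (hw : Measurable w) (hC : ∀ t ∈ Ioc 0 T, |w t| ≤ C) (ξ : EuclideanSpace ℝ (Fin d)) :
    𝓕 (fun y : EuclideanSpace ℝ (Fin d) =>
        ((∫ t in (0 : ℝ)..T, kernel β (y - x t) * w t : ℝ) : ℂ)) ξ =
      (((1 + 4 * Real.pi ^ 2 * ‖ξ‖ ^ 2) ^ (-β) : ℝ) : ℂ) *
        ∫ t in (0 : ℝ)..T, Complex.exp (((-2 * Real.pi * inner ℝ (x t) ξ : ℝ) : ℂ) * Complex.I) *
          (w t : ℂ) := by
  have hm := measurable_kernel (d := d) hβ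
  rw [fourier_eq_integral_mul]
  simp_rw [intervalIntegral.integral_of_le hT, ← integral_complex_ofReal, ← integral_const_mul]
  rw [integral_integral_swap]
  · refine integral_congr_ae (Eventually.of_forall fun t => ?_)
    simp only
    rw [← integral_add_right_eq_self _ (x t), ← fourier_kernel hβ ξ, fourier_eq_integral_mul,
      ← integral_mul_const]
    refine integral_congr_ae (Eventually.of_forall fun y => ?_)
    simp only [add_sub_cancel_right, inner_add_left]
    push_cast
    rw [mul_add, add_mul, Complex.exp_add]
    ring
  · have hF : Measurable (fun p : EuclideanSpace ℝ (Fin d) × ℝ =>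
        Complex.exp (((-2 * Real.pi * inner ℝ p.1 ξ : ℝ) : ℂ) * Complex.I) *
          ((kernel β (p.1 - x p.2) * w p.2 : ℝ) : ℂ)) := by fun_prop
    refine ⟨hF.aestronglyMeasurable, ?_⟩
    simp only [Function.uncurry_def]
    rw [HasFiniteIntegral, lintegral_prod_symm _ (by fun_prop)]
    have h1 : ∀ t ∈ Ioc 0 T, ∫⁻ y : EuclideanSpace ℝ (Fin d),
        ‖Complex.exp (((-2 * Real.pi * inner ℝ y ξ : ℝ) : ℂ) * Complex.I) *
          ((kernel β (y - x t) * w t : ℝ) : ℂ)‖ₑ ≤ ENNReal.ofReal C := by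
      intro t ht
      have : ∀ y : EuclideanSpace ℝ (Fin d),
          ‖Complex.exp (((-2 * Real.pi * inner ℝ y ξ : ℝ) : ℂ) * Complex.I) *
          ((kernel β (y - x t) * w t : ℝ) : ℂ)‖ₑ =
            ENNReal.ofReal (kernel β (y - x t)) * ‖w t‖ₑ := by
        intro y
        rw [enorm_mul, ← ofReal_norm, Complex.norm_exp_ofReal_mul_I, ENNReal.ofReal_one, one_mul,
          enorm_ofReal_complex, enorm_mul, Real.enorm_of_nonneg (kernel_nonneg hβ _)]
      simp_rw [this]
      rw [lintegral_mul_const _ (by fun_prop), lintegral_ofReal_kernel hβ, one_mul, ← ofReal_norm]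
      exact ENNReal.ofReal_le_ofReal (hC t ht)
    refine lt_of_le_of_lt (setLIntegral_mono' measurableSet_Ioc h1) ?_
    simp [ENNReal.mul_lt_top]

/-- The spectral lower bound for the `L²` norm of a regularized current. -/
lemma lintegral_fourier_le_lintegral_field (hβ : 0 < β) (hT : 0 ≤ T) (hx : Measurable x)
    (hv : Measurable v) (hC : ∀ t ∈ Ioc 0 T, ‖v t‖ ≤ C) (i : Fin d) :
    ∫⁻ ξ : EuclideanSpace ℝ (Fin d), ENNReal.ofReal ((1 + 4 * Real.pi ^ 2 * ‖ξ‖ ^ 2) ^ (-(2 * β))) *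
        ‖∫ t in (0 : ℝ)..T, Complex.exp (((-2 * Real.pi * inner ℝ (x t) ξ : ℝ) : ℂ) * Complex.I) *
          (v t i : ℂ)‖ₑ ^ 2 ≤
      ∫⁻ y, ‖∫ t in (0 : ℝ)..T, kernel β (y - x t) • v t‖ₑ ^ 2 := by
  have hm := measurable_kernel (d := d) hβ
  have hvi : Measurable fun t => v t i := by fun_prop
  have hCi : ∀ t ∈ Ioc 0 T, |v t i| ≤ C := fun t ht => (PiLp.norm_apply_le (v t) i).trans (hC t ht)
  set g : EuclideanSpace ℝ (Fin d) → ℂ :=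
    fun y => ((∫ t in (0 : ℝ)..T, kernel β (y - x t) * v t i : ℝ) : ℂ) with hg
  have hint := integrable_kernel_smul_prod hβ hx hv hC
  -- Almost every `y` only: where the vector integrand is not integrable its integral is `0` by
  -- default, which says nothing about the integral of a single coordinate.
  have hgi : ∀ᵐ y, (∫ t in (0 : ℝ)..T, kernel β (y - x t) • v t) i =
      ∫ t in (0 : ℝ)..T, kernel β (y - x t) * v t i := by
    filter_upwards [hint.prod_right_ae] with y hy
    simp_rw [intervalIntegral.integral_of_le hT]
    have := (EuclideanSpace.proj (𝕜 := ℝ) i).integral_comp_comm hy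
    simpa using this.symm
  have hgint : Integrable g := by
    have h1 := ((EuclideanSpace.proj (𝕜 := ℝ) i).integrable_comp hint).integral_prod_left
    simp only [PiLp.proj_apply, PiLp.smul_apply, smul_eq_mul] at h1
    rw [hg]
    simp_rw [intervalIntegral.integral_of_le hT]
    exact h1.ofReal
  have hgm : Measurable g := by
    rw [hg]
    simp_rw [intervalIntegral.integral_of_le hT]
    have hF : StronglyMeasurable (fun p : EuclideanSpace ℝ (Fin d) × ℝ =>
      kernel β (p.1 - x p.2) * v p.2 i) := Measurable.stronglyMeasurable (by fun_prop)
    exact Complex.measurable_ofReal.comp hF.integral_prod_right'.measurable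
  have h1 : ∫⁻ y, ‖g y‖ₑ ^ 2 ≤ ∫⁻ y, ‖∫ t in (0 : ℝ)..T, kernel β (y - x t) • v t‖ₑ ^ 2 := by
    refine lintegral_mono_ae ?_
    filter_upwards [hgi] with y hy
    rw [hg]
    simp only
    rw [← hy, enorm_ofReal_complex]
    gcongr
    rw [← ofReal_norm, ← ofReal_norm]
    exact ENNReal.ofReal_le_ofReal (PiLp.norm_apply_le _ i)
  refine le_trans (le_of_eq ?_) ((lintegral_fourier_sq_le hgint hgm).trans h1)
  refine lintegral_congr fun ξ => ?_
  rw [hg, fourier_kernel_integral hβ hT hx hvi hCi, enorm_mul, mul_pow, enorm_ofReal_complex,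
    Real.enorm_of_nonneg (by positivity), ← ENNReal.ofReal_pow (by positivity)]
  congr 2
  rw [← Real.rpow_mul_natCast (by positivity)]
  congr 1
  push_cast
  ring

lemma lintegral_prod_kernelE_lt_top {α : ℝ} (hα : 0 < α) (hx : Measurable x)
    (hB : ∫⁻ t in Icc 0 T, ∫⁻ s in Icc 0 T, kernelHat α (x t - x s) < ⊤) :
    ∫⁻ z, kernelE α (x z.1 - x z.2)
      ∂((volume.restrict (Ioc 0 T)).prod (volume.restrict (Ioc 0 T))) < ⊤ := by
  have hm := measurable_kernelE (d := d) hα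
  rw [lintegral_prod _ (by fun_prop)]
  refine lt_of_le_of_lt ?_ hB
  refine (lintegral_mono_set Ioc_subset_Icc_self).trans (lintegral_mono fun t => ?_)
  refine (lintegral_mono_set Ioc_subset_Icc_self).trans (lintegral_mono fun s => ?_)
  exact kernelE_le_kernelHat hα _

/-- If the kernel is integrable along the path, the double integral is the squared `L²` norm. -/
lemma lintegral_field_eq_ofReal (hβ : 0 < β) (hT : 0 ≤ T) (hx : Measurable x)
    (hv : Measurable v) (hC : ∀ t ∈ Ioc 0 T, ‖v t‖ ≤ C)
    (hB : ∫⁻ z, kernelE (2 * β) (x z.1 - x z.2)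
      ∂((volume.restrict (Ioc 0 T)).prod (volume.restrict (Ioc 0 T))) < ⊤) :
    0 ≤ ∫ t in (0 : ℝ)..T, ∫ s in (0 : ℝ)..T, kernel (2 * β) (x t - x s) * inner ℝ (v t) (v s) ∧
    ∫⁻ y, ‖∫ t in (0 : ℝ)..T, kernel β (y - x t) • v t‖ₑ ^ 2 =
      ENNReal.ofReal (∫ t in (0 : ℝ)..T, ∫ s in (0 : ℝ)..T,
        kernel (2 * β) (x t - x s) * inner ℝ (v t) (v s)) := by
  have hm := measurable_kernel (d := d) hβ
  have hm2 := measurable_kernelE (d := d) (show 0 < 2 * β by positivity)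
  set μ := (volume : Measure ℝ).restrict (Ioc 0 T) with hμ
  have hint := integrable_kernel_smul_prod hβ hx hv hC
  set F : EuclideanSpace ℝ (Fin d) × (ℝ × ℝ) → ℝ := fun p =>
    kernel β (p.1 - x p.2.1) * kernel β (p.1 - x p.2.2) * inner ℝ (v p.2.1) (v p.2.2) with hF
  have hFm : Measurable F := by fun_prop
  -- Integrating in `y` first merges the two kernels into `kernelE (2 * β)`, so `hB` and the bound
  -- on `v` give absolute integrability. All the exchanges of integrals below rest on it.
  have hFi : Integrable F (volume.prod (μ.prod μ)) := by
    refine ⟨hFm.aestronglyMeasurable, ?_⟩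
    rw [HasFiniteIntegral, lintegral_prod_symm _ (by fun_prop)]
    have hmem : ∀ᵐ z ∂(μ.prod μ), z.1 ∈ Ioc 0 T ∧ z.2 ∈ Ioc 0 T := by
      rw [hμ, Measure.prod_restrict]
      filter_upwards [ae_restrict_mem (measurableSet_Ioc.prod measurableSet_Ioc)] with z hz
      exact hz
    have hle : ∀ᵐ z ∂(μ.prod μ), ∫⁻ y, ‖F (y, z)‖ₑ ≤
        kernelE (2 * β) (x z.1 - x z.2) * ENNReal.ofReal (C * C) := by
      filter_upwards [hmem] with z hz
      have : ∀ y, ‖F (y, z)‖ₑ ≤ ENNReal.ofReal (kernel β (y - x z.1) * kernel β (y - x z.2)) *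
          ENNReal.ofReal (C * C) := by
        intro y
        rw [hF]
        simp only
        rw [enorm_mul, Real.enorm_of_nonneg (mul_nonneg (kernel_nonneg hβ _) (kernel_nonneg hβ _))]
        gcongr
        rw [← ofReal_norm]
        refine ENNReal.ofReal_le_ofReal ((norm_inner_le_norm _ _).trans ?_)
        have h0 : 0 ≤ C := (norm_nonneg _).trans (hC _ hz.1)
        have h1 := hC _ hz.1
        have h2 := hC _ hz.2
        gcongr
      refine (lintegral_mono this).trans ?_
      rw [lintegral_mul_const _ (by fun_prop), lintegral_ofReal_kernel_mul_kernel hβ]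
    refine lt_of_le_of_lt (lintegral_mono_ae hle) ?_
    rw [lintegral_mul_const _ (by fun_prop)]
    exact ENNReal.mul_lt_top hB ENNReal.ofReal_lt_top
  have hsq : ∀ᵐ y, ∫ z, F (y, z) ∂(μ.prod μ) =
      ‖∫ t in (0 : ℝ)..T, kernel β (y - x t) • v t‖ ^ 2 := by
    filter_upwards [hint.prod_right_ae, hFi.prod_right_ae] with y hy hy2
    rw [intervalIntegral.integral_of_le hT, ← real_inner_self_eq_norm_sq]
    rw [integral_prod _ hy2, ← integral_inner hy]
    refine integral_congr_ae (Eventually.of_forall fun t => ?_)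
    simp only
    rw [real_inner_comm, ← integral_inner hy]
    refine integral_congr_ae (Eventually.of_forall fun s => ?_)
    simp only [hF, inner_smul_left, inner_smul_right, conj_trivial]
    rw [real_inner_comm]
    ring
  have hE : ∫ t in (0 : ℝ)..T, ∫ s in (0 : ℝ)..T, kernel (2 * β) (x t - x s) * inner ℝ (v t) (v s) =
      ∫ y, ‖∫ t in (0 : ℝ)..T, kernel β (y - x t) • v t‖ ^ 2 := by
    have h1 : ∀ z : ℝ × ℝ, ∫ y, F (y, z) = kernel (2 * β) (x z.1 - x z.2) *
        inner ℝ (v z.1) (v z.2) := by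
      intro z
      simp only [hF]
      rw [integral_mul_const, integral_kernel_mul_kernel hβ]
    have h2 := hFi.integral_prod_right
    simp_rw [h1] at h2
    rw [← integral_congr_ae hsq, integral_integral_swap hFi]
    simp_rw [h1]
    rw [integral_prod _ h2]
    simp_rw [intervalIntegral.integral_of_le hT, hμ]
  have hi : Integrable fun y => ‖∫ t in (0 : ℝ)..T, kernel β (y - x t) • v t‖ ^ 2 :=
    hFi.integral_prod_left.congr hsq
  refine ⟨hE ▸ integral_nonneg fun y => by positivity, ?_⟩
  rw [hE, ofReal_integral_eq_lintegral_ofReal hi (Eventually.of_forall fun y => by positivity)]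
  refine lintegral_congr fun y => ?_
  rw [ENNReal.ofReal_pow (norm_nonneg _), ofReal_norm]

end Path

end

section

/-! ### Gaussian expectations -/

section Gaussian

variable {Ω : Type*} [MeasurableSpace Ω] {P : Measure Ω}

lemma integral_cos_of_hasGaussianLaw {Z : Ω → ℝ} (hZ : HasGaussianLaw Z P)
    (h0 : ∫ ω, Z ω ∂P = 0) :
    ∫ ω, Real.cos (Z ω) ∂P = Real.exp (-(covariance Z Z P) / 2) := by
  have := hZ.isProbabilityMeasure
  have h := hZ.charFun_map_eq 1
  rw [charFun_apply_real, integral_map hZ.aemeasurable (by fun_prop)] at h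
  have hr := congrArg Complex.re h
  have e1 : ∀ ω, Complex.exp (((1 : ℝ) : ℂ) * (Z ω : ℂ) * Complex.I) =
      Complex.exp ((Z ω : ℂ) * Complex.I) := by intro ω; simp
  simp_rw [e1] at hr
  have hint : Integrable (fun ω => Complex.exp ((Z ω : ℂ) * Complex.I)) P := by
    refine Integrable.of_bound (C := 1) ?_ (Eventually.of_forall fun ω => by
      rw [Complex.norm_exp_ofReal_mul_I])
    have := hZ.aemeasurable
    exact AEMeasurable.aestronglyMeasurable (by fun_prop)
  rw [← RCLike.re_eq_complex_re, ← integral_re hint] at hr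
  simp only [RCLike.re_eq_complex_re, Complex.exp_ofReal_mul_I_re] at hr
  rw [hr, covariance_self hZ.aemeasurable]
  have e2 : (fun ω => inner ℝ (1 : ℝ) (Z ω)) = Z := by ext ω; simp
  rw [e2, h0, Complex.ofReal_zero, zero_mul, zero_sub]
  rw [show (-(((Var[Z; P] : ℝ) : ℂ) / 2)) = ((-Var[Z; P] / 2 : ℝ) : ℂ) by push_cast; ring,
    ← Complex.ofReal_exp, Complex.ofReal_re]

/-- Differentiate the hypothesis twice in `q` at `q = 0`; domination by `|U|` and `U ^ 2` allows
differentiation under the expectation. -/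
lemma integral_cos_mul_sq {W U : Ω → ℝ} [IsProbabilityMeasure P] (hW : AEMeasurable W P)
    (hU : MemLp U 2 P)
    {s κ τ : ℝ} (h : ∀ q : ℝ, ∫ ω, Real.cos (W ω + q * U ω) ∂P =
      Real.exp (-(s + 2 * q * κ + q ^ 2 * τ) / 2)) :
    ∫ ω, Real.cos (W ω) * U ω ^ 2 ∂P = (τ - κ ^ 2) * Real.exp (-s / 2) := by
  have hUi : Integrable U P := hU.integrable one_le_two
  have hU2 : Integrable (fun ω => U ω ^ 2) P := hU.integrable_sq
  have hUm : AEMeasurable U P := hUi.aemeasurable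
  have d1 : ∀ q : ℝ, HasDerivAt (fun q => ∫ ω, Real.cos (W ω + q * U ω) ∂P)
      (∫ ω, -Real.sin (W ω + q * U ω) * U ω ∂P) q := by
    intro q
    refine (hasDerivAt_integral_of_dominated_loc_of_deriv_le (𝕜 := ℝ) (bound := fun ω => |U ω|)
      (F := fun q ω => Real.cos (W ω + q * U ω)) (F' := fun q ω => -Real.sin (W ω + q * U ω) * U ω)
      (s := univ) univ_mem ?_ ?_ ?_ ?_ hUi.abs ?_).2
    · exact Eventually.of_forall fun q => AEMeasurable.aestronglyMeasurable (by fun_prop)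
    · exact Integrable.of_bound (C := 1) (AEMeasurable.aestronglyMeasurable (by fun_prop))
        (Eventually.of_forall fun ω => Real.abs_cos_le_one _)
    · exact AEMeasurable.aestronglyMeasurable (by fun_prop)
    · refine Eventually.of_forall fun ω q _ => ?_
      rw [norm_mul, norm_neg, Real.norm_eq_abs, Real.norm_eq_abs]
      exact mul_le_of_le_one_left (abs_nonneg _) (Real.abs_sin_le_one _)
    · refine Eventually.of_forall fun ω q _ => ?_
      simpa using (((hasDerivAt_id q).mul_const (U ω)).const_add (W ω)).cos
  have d2 : HasDerivAt (fun q => ∫ ω, -Real.sin (W ω + q * U ω) * U ω ∂P)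
      (∫ ω, -(Real.cos (W ω + 0 * U ω) * U ω) * U ω ∂P) 0 := by
    refine (hasDerivAt_integral_of_dominated_loc_of_deriv_le (𝕜 := ℝ) (bound := fun ω => U ω ^ 2)
      (F := fun q ω => -Real.sin (W ω + q * U ω) * U ω)
      (F' := fun q ω => -(Real.cos (W ω + q * U ω) * U ω) * U ω)
      (s := univ) univ_mem ?_ ?_ ?_ ?_ hU2 ?_).2
    · exact Eventually.of_forall fun q => AEMeasurable.aestronglyMeasurable (by fun_prop)
    · refine hUi.mono (AEMeasurable.aestronglyMeasurable (by fun_prop))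
        (Eventually.of_forall fun ω => ?_)
      rw [norm_mul, norm_neg]
      exact mul_le_of_le_one_left (norm_nonneg _) (Real.abs_sin_le_one _)
    · exact AEMeasurable.aestronglyMeasurable (by fun_prop)
    · refine Eventually.of_forall fun ω q _ => ?_
      rw [norm_mul, norm_neg, norm_mul, mul_assoc, ← norm_mul, ← sq, norm_pow, Real.norm_eq_abs,
        Real.norm_eq_abs, sq_abs]
      exact mul_le_of_le_one_left (sq_nonneg _) (Real.abs_cos_le_one _)
    · refine Eventually.of_forall fun ω q _ => ?_
      simpa using ((((hasDerivAt_id q).mul_const (U ω)).const_add (W ω)).sin.neg).mul_const (U ω)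
  have e1 : ∀ q : ℝ, HasDerivAt (fun q : ℝ => Real.exp (-(s + 2 * q * κ + q ^ 2 * τ) / 2))
      (Real.exp (-(s + 2 * q * κ + q ^ 2 * τ) / 2) * (-(κ + q * τ))) q := by
    intro q
    have h1 : HasDerivAt (fun q : ℝ => -(s + 2 * q * κ + q ^ 2 * τ) / 2) (-(κ + q * τ)) q := by
      have := (((((hasDerivAt_id q).const_mul 2).mul_const κ).const_add s).add
        (((hasDerivAt_id q).pow 2).mul_const τ)).neg.div_const 2
      convert! this using 1
      simp; ring
    exact h1.exp
  have e2 : HasDerivAt (fun q : ℝ => Real.exp (-(s + 2 * q * κ + q ^ 2 * τ) / 2) * (-(κ + q * τ)))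
      ((κ ^ 2 - τ) * Real.exp (-s / 2)) 0 := by
    have h1 := (e1 0).mul ((((hasDerivAt_id (0 : ℝ)).mul_const τ).const_add κ).neg)
    convert! h1 using 1
    simp; ring
  have f1 : (fun q : ℝ => ∫ ω, -Real.sin (W ω + q * U ω) * U ω ∂P) =
      fun q : ℝ => Real.exp (-(s + 2 * q * κ + q ^ 2 * τ) / 2) * (-(κ + q * τ)) := by
    ext q
    have := d1 q
    rw [funext h] at this
    exact this.unique (e1 q)
  rw [f1] at d2
  have := d2.unique e2
  have h2 : ∀ ω, -(Real.cos (W ω + 0 * U ω) * U ω) * U ω = -(Real.cos (W ω) * U ω ^ 2) := by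
    intro ω; rw [zero_mul, add_zero]; ring
  simp_rw [h2] at this
  rw [integral_neg] at this
  linarith

/-- Polarization of `integral_cos_mul_sq`: apply it to `U + V` and `U - V`, and use `4UV = (U + V)²
- (U - V)²`. -/
lemma integral_cos_mul_mul {W U V : Ω → ℝ} [IsProbabilityMeasure P] (hW : MemLp W 2 P)
    (hU : MemLp U 2 P) (hV : MemLp V 2 P)
    (hG : ∀ a b : ℝ, HasGaussianLaw (fun ω => W ω + a * U ω + b * V ω) P)
    (hW0 : ∫ ω, W ω ∂P = 0) (hU0 : ∫ ω, U ω ∂P = 0) (hV0 : ∫ ω, V ω ∂P = 0) :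
    ∫ ω, Real.cos (W ω) * (U ω * V ω) ∂P =
      (covariance U V P - covariance W U P * covariance W V P) *
        Real.exp (-(covariance W W P) / 2) := by
  have key : ∀ b : ℝ, ∫ ω, Real.cos (W ω) * (U ω + b * V ω) ^ 2 ∂P =
      (covariance (fun ω => U ω + b * V ω) (fun ω => U ω + b * V ω) P -
        covariance W (fun ω => U ω + b * V ω) P ^ 2) * Real.exp (-(covariance W W P) / 2) := by
    intro b
    have hQ : MemLp (fun ω => U ω + b * V ω) 2 P := hU.add (hV.const_mul b)
    refine integral_cos_mul_sq hW.aemeasurable hQ fun q => ?_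
    have hg := hG q (q * b)
    have he : (fun ω => W ω + q * U ω + q * b * V ω) = fun ω => W ω + q * (U ω + b * V ω) := by
      ext ω; ring
    rw [he] at hg
    rw [integral_cos_of_hasGaussianLaw hg]
    · have hq := hQ.const_mul q
      change Real.exp (-covariance (W + fun ω => q * (U ω + b * V ω))
        (W + fun ω => q * (U ω + b * V ω)) P / 2) = _
      rw [covariance_add_left hW hq (hW.add hq), covariance_add_right hW hW hq,
        covariance_add_right hq hW hq, covariance_const_mul_left, covariance_const_mul_left,
        covariance_const_mul_right, covariance_const_mul_right,
        covariance_comm (fun ω => U ω + b * V ω) W]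
      congr 1
      ring
    · have i1 := hW.integrable one_le_two
      have i2 := hU.integrable one_le_two
      have i3 := hV.integrable one_le_two
      have i4 : Integrable (fun ω => U ω + b * V ω) P := i2.add (i3.const_mul b)
      rw [integral_add i1 (i4.const_mul q), integral_const_mul,
        integral_add i2 (i3.const_mul b), integral_const_mul, hW0, hU0, hV0]
      simp
  have hexp : ∀ b : ℝ, covariance (fun ω => U ω + b * V ω) (fun ω => U ω + b * V ω) P -
        covariance W (fun ω => U ω + b * V ω) P ^ 2 =
      (covariance U U P + 2 * b * covariance U V P + b ^ 2 * covariance V V P) -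
        (covariance W U P + b * covariance W V P) ^ 2 := by
    intro b
    have hb := hV.const_mul b
    change covariance (U + fun ω => b * V ω) (U + fun ω => b * V ω) P -
      covariance W (U + fun ω => b * V ω) P ^ 2 = _
    rw [covariance_add_left hU hb (hU.add hb), covariance_add_right hU hU hb,
        covariance_add_right hb hU hb, covariance_add_right hW hU hb, covariance_const_mul_left,
        covariance_const_mul_left, covariance_const_mul_right, covariance_const_mul_right,
        covariance_const_mul_right, covariance_comm V U]
    ring
  have hint : ∀ b : ℝ, Integrable (fun ω => Real.cos (W ω) * (U ω + b * V ω) ^ 2) P := by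
    intro b
    refine ((hU.add (hV.const_mul b)).integrable_sq).bdd_mul (c := 1) ?_
      (Eventually.of_forall fun ω => Real.abs_cos_le_one _)
    have := hW.aemeasurable
    exact AEMeasurable.aestronglyMeasurable (by fun_prop)
  have h1 := key 1
  have h2 := key (-1)
  rw [hexp] at h1 h2
  have h3 : ∫ ω, Real.cos (W ω) * (U ω * V ω) ∂P =
      (∫ ω, Real.cos (W ω) * (U ω + 1 * V ω) ^ 2 ∂P -
        ∫ ω, Real.cos (W ω) * (U ω + (-1) * V ω) ^ 2 ∂P) / 4 := by
    rw [← integral_sub (hint 1) (hint (-1)), ← integral_div]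
    congr 1 with ω
    ring
  rw [h3, h1, h2]
  ring

end Gaussian

end

section

/-! ### Second order structure of fractional Brownian motion -/

section Basic

variable {Ω : Type*} {d : ℕ} {X : ℝ≥0 → Ω → EuclideanSpace ℝ (Fin d)}

lemma position_of_nonneg {t : ℝ} (ht : 0 ≤ t) (ω : Ω) : position X t ω = X t.toNNReal ω :=
  if_pos ht

lemma position_of_neg {t : ℝ} (ht : t < 0) (ω : Ω) : position X t ω = 0 :=
  if_neg (not_le.2 ht)

lemma symmQuotient_apply (ε t : ℝ) (ω : Ω) (i : Fin d) :
    symmQuotient X ε t ω i = 1 / (2 * ε) * (position X (t + ε) ω i - position X (t - ε) ω i) := by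
  simp [symmQuotient]

lemma inner_position_sub (l : EuclideanSpace ℝ (Fin d)) (s t : ℝ) (ω : Ω) :
    inner ℝ l (position X t ω - position X s ω) =
      ∑ i, l i * (position X t ω i - position X s ω i) := by
  rw [PiLp.inner_apply]
  refine Finset.sum_congr rfl fun i _ => ?_
  simp [mul_comm]

variable [MeasurableSpace Ω] {P : Measure Ω} {H : ℝ}

lemma IsFBM.memLp_position (hX : IsFBM X H P) (t : ℝ) (i : Fin d) :
    MemLp (fun ω => position X t ω i) 2 P := by
  rcases lt_or_ge t 0 with ht | ht
  · simp_rw [position_of_neg ht]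
    simp
  · simp_rw [position_of_nonneg ht]
    exact ((hX.component i).gaussian.hasGaussianLaw_eval t.toNNReal).memLp_two

lemma IsFBM.integral_position (hX : IsFBM X H P) (t : ℝ) (i : Fin d) :
    ∫ ω, position X t ω i ∂P = 0 := by
  rcases lt_or_ge t 0 with ht | ht
  · simp_rw [position_of_neg ht]
    simp
  · simp_rw [position_of_nonneg ht]
    exact (hX.component i).mean_zero _

/-- Gaussianity is assumed one component at a time; independence of the components makes linear
combinations across components Gaussian too. -/
lemma IsFBM.hasGaussianLaw_sum (hX : IsFBM X H P) {n : ℕ} (c : Fin d → Fin n → ℝ)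
    {τ : Fin n → ℝ} (hτ : ∀ k, 0 ≤ τ k) :
    HasGaussianLaw (fun ω => ∑ i, ∑ k, c i k * position X (τ k) ω i) P := by
  simp_rw [position_of_nonneg (hτ _)]
  refine iIndepFun.hasGaussianLaw_fun_sum
    (X := fun i ω => ∑ k, c i k * X (τ k).toNNReal ω i) (fun i => ?_) ?_
  · exact (((hX.component i).gaussian.comp_right (fun k : Fin n => (τ k).toNNReal)).smul
      (c i)).hasGaussianLaw_fun_sum (I := Finset.univ)
  · exact hX.independent.comp (fun i (p : ℝ≥0 → ℝ) => ∑ k, c i k * p (τ k).toNNReal)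
      (fun i => by fun_prop)

lemma IsFBM.covariance_position (hX : IsFBM X H P) {s t : ℝ} (hs : 0 ≤ s) (ht : 0 ≤ t)
    (i j : Fin d) :
    covariance (fun ω => position X s ω i) (fun ω => position X t ω j) P =
      if i = j then (s ^ (2 * H) + t ^ (2 * H) - |t - s| ^ (2 * H)) / 2 else 0 := by
  split_ifs with h
  · subst h
    simp_rw [position_of_nonneg hs, position_of_nonneg ht]
    rw [(hX.component i).covariance_eq, Real.coe_toNNReal _ hs, Real.coe_toNNReal _ ht]
  · refine IndepFun.covariance_eq_zero ?_ (hX.memLp_position s i) (hX.memLp_position t j)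
    simp_rw [position_of_nonneg hs, position_of_nonneg ht]
    exact (hX.independent.indepFun h).comp (φ := fun p : ℝ≥0 → ℝ => p s.toNNReal)
      (ψ := fun p : ℝ≥0 → ℝ => p t.toNNReal) (measurable_pi_apply _) (measurable_pi_apply _)

lemma IsFBM.memLp_symmQuotient (hX : IsFBM X H P) (ε t : ℝ) (i : Fin d) :
    MemLp (fun ω => symmQuotient X ε t ω i) 2 P := by
  simp_rw [symmQuotient_apply]
  exact ((hX.memLp_position _ i).sub (hX.memLp_position _ i)).const_mul _

lemma IsFBM.memLp_inner_increment (hX : IsFBM X H P) (l : EuclideanSpace ℝ (Fin d)) (s t : ℝ) :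
    MemLp (fun ω => inner ℝ l (position X t ω - position X s ω)) 2 P := by
  simp_rw [inner_position_sub]
  exact memLp_finsetSum _ fun i _ =>
    ((hX.memLp_position t i).sub (hX.memLp_position s i)).const_mul (l i)

end Basic

variable {Ω : Type*} [MeasurableSpace Ω] {P : Measure Ω} [IsProbabilityMeasure P] {d : ℕ}
  {X : ℝ≥0 → Ω → EuclideanSpace ℝ (Fin d)} {H : ℝ}

lemma IsFBM.integral_symmQuotient (hX : IsFBM X H P) (ε t : ℝ) (i : Fin d) :
    ∫ ω, symmQuotient X ε t ω i ∂P = 0 := by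
  simp_rw [symmQuotient_apply]
  rw [integral_const_mul, integral_sub ((hX.memLp_position _ i).integrable one_le_two)
    ((hX.memLp_position _ i).integrable one_le_two), hX.integral_position, hX.integral_position]
  simp

/-- The covariance of two symmetric difference quotients at distance `h`. -/
def quotientCov (H ε h : ℝ) : ℝ :=
  (|h + 2 * ε| ^ (2 * H) + |h - 2 * ε| ^ (2 * H) - 2 * |h| ^ (2 * H)) / (8 * ε ^ 2)

/-- The covariance of an increment over a distance `h` with a symmetric difference quotient at one
of its end points. -/
def incrementCov (H ε h : ℝ) : ℝ :=
  (|h + ε| ^ (2 * H) - |h - ε| ^ (2 * H)) / (4 * ε)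

section Cov

variable {s t ε : ℝ}

lemma IsFBM.covariance_increment_increment (hX : IsFBM X H P) {a b s t : ℝ} (ha : 0 ≤ a)
    (hb : 0 ≤ b) (hs : 0 ≤ s) (ht : 0 ≤ t) (i j : Fin d) :
    covariance (fun ω => position X b ω i - position X a ω i)
      (fun ω => position X t ω j - position X s ω j) P =
      if i = j then (|b - s| ^ (2 * H) + |a - t| ^ (2 * H) - |b - t| ^ (2 * H) -
        |a - s| ^ (2 * H)) / 2 else 0 := by
  rw [covariance_fun_sub_fun_sub (hX.memLp_position _ _) (hX.memLp_position _ _)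
    (hX.memLp_position _ _) (hX.memLp_position _ _), hX.covariance_position hb ht,
    hX.covariance_position hb hs, hX.covariance_position ha ht, hX.covariance_position ha hs]
  split_ifs
  · rw [abs_sub_comm s b, abs_sub_comm t b, abs_sub_comm s a, abs_sub_comm t a]
    ring
  · simp

/-- With both times at least `ε`, none of the four positions falls under the convention at negative
times, so stationarity of increments leaves a function of `t - s`. -/
lemma IsFBM.covariance_symmQuotient (hX : IsFBM X H P) (hε : 0 < ε) (hs : ε ≤ s) (ht : ε ≤ t)
    (i : Fin d) :
    covariance (fun ω => symmQuotient X ε t ω i) (fun ω => symmQuotient X ε s ω i) P =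
      quotientCov H ε (t - s) := by
  simp_rw [symmQuotient_apply]
  rw [covariance_const_mul_left, covariance_const_mul_right,
    hX.covariance_increment_increment (by linarith) (by linarith) (by linarith) (by linarith),
    if_pos rfl, quotientCov]
  rw [show t + ε - (s - ε) = t - s + 2 * ε by ring, show t - ε - (s + ε) = t - s - 2 * ε by ring,
    show t + ε - (s + ε) = t - s by ring, show t - ε - (s - ε) = t - s by ring]
  field_simp
  ring

lemma IsFBM.covariance_increment_symmQuotient_right (hX : IsFBM X H P) (hε : 0 < ε) (hs : ε ≤ s)
    (ht : ε ≤ t) (i j : Fin d) :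
    covariance (fun ω => position X t ω i - position X s ω i) (fun ω => symmQuotient X ε t ω j) P =
      if i = j then incrementCov H ε (t - s) else 0 := by
  simp_rw [symmQuotient_apply]
  rw [covariance_const_mul_right,
    hX.covariance_increment_increment (by linarith) (by linarith) (by linarith) (by linarith),
    incrementCov]
  split_ifs
  · rw [show t - (t - ε) = ε by ring, abs_sub_comm s (t + ε), abs_sub_comm s (t - ε),
      show t - (t + ε) = -ε by ring, abs_neg, show t + ε - s = t - s + ε by ring,
      show t - ε - s = t - s - ε by ring]
    field_simp
    ring
  · simp

/-- The value is the same as at the other end point, which is why the correction in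
`integral_cos_mul_symmQuotient` is a perfect square. -/
lemma IsFBM.covariance_increment_symmQuotient_left (hX : IsFBM X H P) (hε : 0 < ε) (hs : ε ≤ s)
    (ht : ε ≤ t) (i j : Fin d) :
    covariance (fun ω => position X t ω i - position X s ω i) (fun ω => symmQuotient X ε s ω j) P =
      if i = j then incrementCov H ε (t - s) else 0 := by
  simp_rw [symmQuotient_apply]
  rw [covariance_const_mul_right,
    hX.covariance_increment_increment (by linarith) (by linarith) (by linarith) (by linarith),
    incrementCov]
  split_ifs
  · rw [show t - (s - ε) = t - s + ε by ring, show s - (s + ε) = -ε by ring, abs_neg,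
      show t - (s + ε) = t - s - ε by ring, show s - (s - ε) = ε by ring]
    field_simp
    ring
  · simp

lemma IsFBM.covariance_inner_increment (hX : IsFBM X H P) (l : EuclideanSpace ℝ (Fin d)) (i : Fin d)
    (s t : ℝ) {U : Ω → ℝ} (hU : MemLp U 2 P) {κ : ℝ}
    (h : ∀ j, covariance (fun ω => position X t ω j - position X s ω j) U P =
      if j = i then κ else 0) :
    covariance (fun ω => inner ℝ l (position X t ω - position X s ω)) U P = l i * κ := by
  simp_rw [inner_position_sub]
  have hj : ∀ j, MemLp (fun ω => l j * (position X t ω j - position X s ω j)) 2 P := fun j =>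
    ((hX.memLp_position t j).sub (hX.memLp_position s j)).const_mul (l j)
  rw [covariance_fun_sum_left hj hU]
  simp_rw [covariance_const_mul_left, h]
  simp

lemma IsFBM.covariance_inner_self (hX : IsFBM X H P) (hH : 0 < H) (l : EuclideanSpace ℝ (Fin d))
    (hs : 0 ≤ s) (ht : 0 ≤ t) :
    covariance (fun ω => inner ℝ l (position X t ω - position X s ω))
      (fun ω => inner ℝ l (position X t ω - position X s ω)) P = ‖l‖ ^ 2 * |t - s| ^ (2 * H) := by
  have hj : ∀ j, MemLp (fun ω => l j * (position X t ω j - position X s ω j)) 2 P := fun j =>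
    ((hX.memLp_position t j).sub (hX.memLp_position s j)).const_mul (l j)
  simp_rw [inner_position_sub]
  rw [covariance_fun_sum_fun_sum hj hj]
  simp_rw [covariance_const_mul_left, covariance_const_mul_right,
    hX.covariance_increment_increment hs ht hs ht]
  simp only [mul_ite, mul_zero, Finset.sum_ite_eq, Finset.mem_univ, if_true]
  rw [EuclideanSpace.norm_sq_eq, Finset.sum_mul]
  refine Finset.sum_congr rfl fun i _ => ?_
  simp only [sub_self, abs_zero, Real.norm_eq_abs, sq_abs]
  rw [Real.zero_rpow (by positivity), abs_sub_comm s t]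
  ring

lemma IsFBM.integral_inner_increment (hX : IsFBM X H P) (l : EuclideanSpace ℝ (Fin d)) (s t : ℝ) :
    ∫ ω, inner ℝ l (position X t ω - position X s ω) ∂P = 0 := by
  simp_rw [inner_position_sub]
  have hj : ∀ j, MemLp (fun ω => l j * (position X t ω j - position X s ω j)) 2 P := fun j =>
    ((hX.memLp_position t j).sub (hX.memLp_position s j)).const_mul (l j)
  rw [integral_finsetSum _ fun j _ => (hj j).integrable one_le_two]
  refine Finset.sum_eq_zero fun j _ => ?_
  rw [integral_const_mul, integral_sub ((hX.memLp_position _ j).integrable one_le_two)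
    ((hX.memLp_position _ j).integrable one_le_two), hX.integral_position, hX.integral_position]
  simp

lemma IsFBM.integral_cos_inner_increment (hX : IsFBM X H P) (hH : 0 < H)
    (l : EuclideanSpace ℝ (Fin d)) (hs : 0 ≤ s) (ht : 0 ≤ t) :
    ∫ ω, Real.cos (inner ℝ l (position X t ω - position X s ω)) ∂P =
      Real.exp (-(‖l‖ ^ 2 * |t - s| ^ (2 * H)) / 2) := by
  rw [integral_cos_of_hasGaussianLaw ?_ (hX.integral_inner_increment l s t),
    hX.covariance_inner_self hH l hs ht]
  have h := hX.hasGaussianLaw_sum (n := 2) (fun j => ![l j, -l j]) (τ := ![t, s]) (by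
    intro k
    fin_cases k <;> simp [hs, ht])
  convert! h using 1
  ext ω
  rw [inner_position_sub]
  refine Finset.sum_congr rfl fun i _ => ?_
  simp only [Fin.sum_univ_two, Matrix.cons_val]
  ring

lemma IsFBM.integral_cos_mul_symmQuotient (hX : IsFBM X H P) (hH : 0 < H)
    (l : EuclideanSpace ℝ (Fin d)) (i : Fin d) (hε : 0 < ε) (hs : ε ≤ s) (ht : ε ≤ t) :
    ∫ ω, Real.cos (inner ℝ l (position X t ω - position X s ω)) *
        (symmQuotient X ε t ω i * symmQuotient X ε s ω i) ∂P =
      (quotientCov H ε (t - s) - (l i * incrementCov H ε (t - s)) ^ 2) *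
        Real.exp (-(‖l‖ ^ 2 * |t - s| ^ (2 * H)) / 2) := by
  rw [integral_cos_mul_mul (hX.memLp_inner_increment l s t) (hX.memLp_symmQuotient ε t i)
    (hX.memLp_symmQuotient ε s i) ?_ ?_ (hX.integral_symmQuotient ε t i)
    (hX.integral_symmQuotient ε s i), hX.covariance_symmQuotient hε hs ht,
    hX.covariance_inner_increment l i s t (hX.memLp_symmQuotient ε t i)
      (fun j => hX.covariance_increment_symmQuotient_right hε hs ht j i),
    hX.covariance_inner_increment l i s t (hX.memLp_symmQuotient ε s i)
      (fun j => hX.covariance_increment_symmQuotient_left hε hs ht j i),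
    hX.covariance_inner_self hH l (by linarith) (by linarith), ← sq]
  · intro a b
    -- The phase and the two quotients together involve six times; the quotients enter only through
    -- component `i`.
    have h := hX.hasGaussianLaw_sum (n := 6)
      (fun j => ![l j, -l j, if j = i then a / (2 * ε) else 0, if j = i then -a / (2 * ε) else 0,
        if j = i then b / (2 * ε) else 0, if j = i then -b / (2 * ε) else 0])
      (τ := ![t, s, t + ε, t - ε, s + ε, s - ε]) (by
        intro k
        fin_cases k <;> simp <;> linarith)
    convert! h using 1
    ext ω
    simp only [Fin.sum_univ_six, inner_position_sub, symmQuotient_apply]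
    simp only [Matrix.cons_val, Finset.sum_add_distrib, ite_mul, zero_mul, Finset.sum_ite_eq',
      Finset.mem_univ, if_true, mul_sub, Finset.sum_sub_distrib, neg_mul, Finset.sum_neg_distrib]
    ring
  · exact hX.integral_inner_increment l s t

lemma IsFBM.integral_position_sq (hX : IsFBM X H P) (hH : 0 < H) (ht : 0 ≤ t) (i : Fin d) :
    ∫ ω, position X t ω i ^ 2 ∂P = t ^ (2 * H) := by
  have h := hX.covariance_position ht ht i i
  rw [covariance_eq_sub (hX.memLp_position t i) (hX.memLp_position t i), hX.integral_position] at h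
  simp only [if_true, sub_self, abs_zero, Real.zero_rpow (show 2 * H ≠ 0 by positivity),
    mul_zero, sub_zero] at h
  simp_rw [sq]
  change ∫ ω, ((fun ω => position X t ω i) * fun ω => position X t ω i) ω ∂P = _
  rw [h]
  ring

lemma IsFBM.integral_symmQuotient_sq_of_lt (hX : IsFBM X H P) (hH : 0 < H) (ht : 0 ≤ t)
    (htε : t < ε) (i : Fin d) :
    ∫ ω, symmQuotient X ε t ω i ^ 2 ∂P = (t + ε) ^ (2 * H) / (4 * ε ^ 2) := by
  simp_rw [symmQuotient_apply, position_of_neg (sub_neg.2 htε)]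
  simp only [PiLp.zero_apply, sub_zero, mul_pow]
  rw [integral_const_mul, hX.integral_position_sq hH (by linarith)]
  field_simp
  ring

/-- A crude bound at fixed `ε`, serving only to justify Fubini. -/
lemma IsFBM.integral_symmQuotient_sq_le (hX : IsFBM X H P) (hH : 0 < H) (hε : 0 < ε) {T : ℝ}
    (ht : t ∈ Icc 0 T) (i : Fin d) :
    ∫ ω, symmQuotient X ε t ω i ^ 2 ∂P ≤ (T + ε) ^ (2 * H) / ε ^ 2 := by
  have hp : ∀ u ≤ T + ε, ∫ ω, position X u ω i ^ 2 ∂P ≤ (T + ε) ^ (2 * H) := by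
    intro u hu
    rcases lt_or_ge u 0 with h | h
    · simp_rw [position_of_neg h]
      have : 0 ≤ T + ε := by linarith [ht.1, ht.2]
      simp only [PiLp.zero_apply, ne_eq, OfNat.ofNat_ne_zero, not_false_eq_true, zero_pow,
        integral_zero]
      positivity
    · rw [hX.integral_position_sq hH h]
      gcongr
  have h1 : ∀ ω, symmQuotient X ε t ω i ^ 2 ≤ 1 / (2 * ε ^ 2) *
      (position X (t + ε) ω i ^ 2 + position X (t - ε) ω i ^ 2) := by
    intro ω
    rw [symmQuotient_apply, mul_pow, one_div, inv_pow, mul_pow]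
    have : (position X (t + ε) ω i - position X (t - ε) ω i) ^ 2 ≤
        2 * (position X (t + ε) ω i ^ 2 + position X (t - ε) ω i ^ 2) := by
      nlinarith [sq_nonneg (position X (t + ε) ω i + position X (t - ε) ω i)]
    calc _ ≤ (2 ^ 2 * ε ^ 2)⁻¹ *
        (2 * (position X (t + ε) ω i ^ 2 + position X (t - ε) ω i ^ 2)) := by gcongr
      _ = _ := by field_simp
  have i1 := (hX.memLp_position (t + ε) i).integrable_sq
  have i2 := (hX.memLp_position (t - ε) i).integrable_sq
  refine (integral_mono (hX.memLp_symmQuotient ε t i).integrable_sq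
    ((i1.add i2).const_mul _) h1).trans ?_
  rw [integral_const_mul]
  change _ * ∫ ω, (position X (t + ε) ω i ^ 2 + position X (t - ε) ω i ^ 2) ∂P ≤ _
  rw [integral_add i1 i2]
  have h2 := hp (t + ε) (by linarith [ht.2])
  have h3 := hp (t - ε) (by linarith [ht.2])
  calc _ ≤ 1 / (2 * ε ^ 2) * ((T + ε) ^ (2 * H) + (T + ε) ^ (2 * H)) := by gcongr
    _ = _ := by field_simp; ring

end Cov

end

section

/-! ### Lower bounds for the local oscillation -/

/-- For `0 ≤ B ≤ C` with `C > 0`, the ratio satisfies `B / C ≤ (B / C) ^ H`, which gives the bound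
with base `C`; since `H - 1 ≤ 0`, the base may be lowered to `M` when `A` is the larger. The number
`A` may vanish. -/
lemma abs_rpow_sub_rpow_le {H A M : ℝ} (hH : 0 ≤ H) (hH1 : H ≤ 1) (hA : 0 ≤ A) (hM : 0 < M) :
    |A ^ H - M ^ H| ≤ M ^ (H - 1) * |A - M| := by
  have key : ∀ B C : ℝ, 0 ≤ B → 0 < C → B ≤ C → C ^ H - B ^ H ≤ C ^ (H - 1) * (C - B) := by
    intro B C hB hC hBC
    have h1 : B / C ≤ (B / C) ^ H := by
      have := Real.rpow_le_rpow_of_exponent_ge' (x := B / C) (by positivity)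
        ((div_le_one hC).2 hBC) hH hH1
      rwa [Real.rpow_one] at this
    rw [Real.div_rpow hB hC.le, div_le_div_iff₀ hC (by positivity)] at h1
    rw [Real.rpow_sub_one hC.ne', div_mul_eq_mul_div, le_div_iff₀ hC]
    nlinarith
  have hmono := fun (B C : ℝ) (hB : 0 ≤ B) (h : B ≤ C) => Real.rpow_le_rpow hB h hH
  rcases le_total A M with h | h
  · rw [abs_of_nonpos (sub_nonpos.2 (hmono A M hA h)), abs_of_nonpos (sub_nonpos.2 h)]
    simpa using key A M hA hM h
  · rw [abs_of_nonneg (sub_nonneg.2 (hmono M A hM.le h)), abs_of_nonneg (sub_nonneg.2 h)]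
    refine (key M A hM.le (hM.trans_le h) h).trans ?_
    refine mul_le_mul_of_nonneg_right ?_ (sub_nonneg.2 h)
    exact Real.rpow_le_rpow_of_nonpos hM h (by linarith)

lemma abs_rpow_two_mul (H x : ℝ) : |x| ^ (2 * H) = (x ^ 2) ^ H := by
  rw [Real.rpow_mul (abs_nonneg x), Real.rpow_two, sq_abs]

lemma sq_rpow_sub_one {ε : ℝ} (hε : 0 < ε) (H : ℝ) : (ε ^ 2) ^ (H - 1) = ε ^ (2 * H - 2) := by
  rw [← Real.rpow_natCast_mul hε.le]
  congr 1
  push_cast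
  ring

/-- The function `|x|^(2H)` need not be Lipschitz at `0`, so it is treated as the `H`-th power of
`x²`. The squares of `h ± ε` differ by `4εh`, and the larger one is at least `ε²`, hence a bound
linear in `|h|` for every `h`. -/
lemma abs_incrementCov_le {H ε : ℝ} (hH : 0 ≤ H) (hH1 : H ≤ 1) (hε : 0 < ε) (h : ℝ) :
    |incrementCov H ε h| ≤ ε ^ (2 * H - 2) * |h| := by
  have key : ∀ M A : ℝ, ε ^ 2 ≤ M → 0 ≤ A → |A - M| = 4 * ε * |h| →
      |A ^ H - M ^ H| ≤ ε ^ (2 * H - 2) * (4 * ε * |h|) := by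
    intro M A hM hA hAM
    refine (abs_rpow_sub_rpow_le hH hH1 hA (lt_of_lt_of_le (by positivity) hM)).trans ?_
    rw [hAM, ← sq_rpow_sub_one hε]
    gcongr ?_ * _
    exact Real.rpow_le_rpow_of_nonpos (by positivity) hM (by linarith)
  have h4 : |((h + ε) ^ 2) ^ H - ((h - ε) ^ 2) ^ H| ≤ ε ^ (2 * H - 2) * (4 * ε * |h|) := by
    have e : (h + ε) ^ 2 - (h - ε) ^ 2 = 4 * ε * h := by ring
    rcases le_total 0 h with h0 | h0
    · rw [abs_sub_comm]
      refine key _ _ (by nlinarith) (sq_nonneg _) ?_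
      rw [abs_sub_comm, e, abs_mul, abs_of_pos (by positivity : 0 < 4 * ε)]
    · refine key _ _ (by nlinarith) (sq_nonneg _) ?_
      rw [e, abs_mul, abs_of_pos (by positivity : 0 < 4 * ε)]
  rw [incrementCov, abs_rpow_two_mul, abs_rpow_two_mul, abs_div,
    abs_of_pos (by positivity : 0 < 4 * ε), div_le_iff₀ (by positivity)]
  linarith

/-- For `|h|` much smaller than `ε`, both `|h ± 2ε|^(2H)` are close to `(2ε)^(2H)`, the error being
controlled through `(h ± 2ε)² - 4ε² = h² ± 4εh`. -/
lemma le_quotientCov {H ε : ℝ} (hH : 0 ≤ H) (hH1 : H ≤ 1) (hε : 0 < ε) (h : ℝ) :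
    ε ^ (2 * H - 2) / 4 * (1 - 4 * (|h| / ε) - (|h| / ε) ^ 2 - (|h| / ε) ^ (2 * H)) ≤
      quotientCov H ε h := by
  have hM : 0 < 4 * ε ^ 2 := by positivity
  have hMle : ε ^ 2 ≤ 4 * ε ^ 2 := by nlinarith [sq_nonneg ε]
  have hpow : ε ^ (2 * H) = ε ^ (2 * H - 2) * ε ^ 2 := by
    rw [← Real.rpow_natCast, ← Real.rpow_add hε]; congr 1; push_cast; ring
  have key : ∀ σ : ℝ, |σ| = 1 → ε ^ (2 * H) - ε ^ (2 * H - 2) * (h ^ 2 + 4 * ε * |h|) ≤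
      |h + σ * (2 * ε)| ^ (2 * H) := by
    intro σ hσ
    have hσ2 : σ ^ 2 = 1 := by rw [← sq_abs, hσ, one_pow]
    rw [abs_rpow_two_mul]
    have h1 := abs_rpow_sub_rpow_le hH hH1 (sq_nonneg (h + σ * (2 * ε))) hM
    have h2 : |(h + σ * (2 * ε)) ^ 2 - 4 * ε ^ 2| ≤ h ^ 2 + 4 * ε * |h| := by
      have : (h + σ * (2 * ε)) ^ 2 - 4 * ε ^ 2 = h ^ 2 + σ * (4 * ε) * h := by
        linear_combination (4 * ε ^ 2) * hσ2
      rw [this]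
      refine (abs_add_le _ _).trans ?_
      rw [abs_mul, abs_mul, hσ, one_mul, abs_of_pos (by positivity : 0 < 4 * ε),
        abs_of_nonneg (sq_nonneg h)]
    have h3 : (4 * ε ^ 2) ^ (H - 1) ≤ ε ^ (2 * H - 2) := by
      rw [← sq_rpow_sub_one hε]
      exact Real.rpow_le_rpow_of_nonpos (by positivity) hMle (by linarith)
    have h4 : ε ^ (2 * H) ≤ (4 * ε ^ 2) ^ H := by
      rw [← abs_of_pos hε, abs_rpow_two_mul, abs_of_pos hε]
      exact Real.rpow_le_rpow (by positivity) hMle hH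
    have h5 : (4 * ε ^ 2) ^ (H - 1) * |(h + σ * (2 * ε)) ^ 2 - 4 * ε ^ 2| ≤
        ε ^ (2 * H - 2) * (h ^ 2 + 4 * ε * |h|) := by gcongr
    have h6 := (abs_le.1 (h1.trans h5)).1
    linarith
  have k1 := key 1 (by simp)
  have k2 := key (-1) (by simp)
  rw [one_mul] at k1
  rw [neg_one_mul, ← sub_eq_add_neg] at k2
  rw [quotientCov, le_div_iff₀ (by positivity), Real.div_rpow (abs_nonneg _) hε.le, hpow]
  rw [hpow] at k1 k2
  have hp : 0 < ε ^ (2 * H - 2) := by positivity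
  calc _ = 2 * (ε ^ (2 * H - 2) * ε ^ 2 - ε ^ (2 * H - 2) * (|h| ^ 2 + 4 * ε * |h|)) -
        2 * |h| ^ (2 * H) := by field_simp; ring
    _ ≤ _ := by rw [sq_abs]; linarith

/-- The error profile in the lower bound for the local oscillation. -/
def errorProfile (H y : ℝ) : ℝ :=
  (4 * |y| + 5 * |y| ^ 2 + |y| ^ (2 * H)) * Real.exp (-|y| ^ (2 * H) / 2)

lemma errorProfile_nonneg (H y : ℝ) : 0 ≤ errorProfile H y := by
  unfold errorProfile; positivity

lemma integrable_errorProfile {H : ℝ} (hH : 0 < H) : Integrable (errorProfile H) := by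
  have h1 : ∀ q : ℝ, -1 < q → IntegrableOn (fun y : ℝ => y ^ q * Real.exp (-(1 / 2) * y ^ (2 * H)))
    (Ioi 0) := fun q hq => integrableOn_rpow_mul_exp_neg_mul_rpow hq (by positivity) (by positivity)
  have h2 : IntegrableOn (errorProfile H) (Ioi 0) := by
    refine IntegrableOn.congr_fun ((((h1 1 (by norm_num)).const_mul 4).add
      ((h1 2 (by norm_num)).const_mul 5)).add (h1 (2 * H) (by linarith))) ?_ measurableSet_Ioi
    intro y hy
    have hy : 0 < y := hy
    simp only [Pi.add_apply, errorProfile, abs_of_pos hy, Real.rpow_one, Real.rpow_two]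
    rw [show -y ^ (2 * H) / 2 = -(1 / 2) * y ^ (2 * H) by ring]
    ring
  have h3 : IntegrableOn (errorProfile H) (Iio 0) := by
    have h4 : errorProfile H = fun y => errorProfile H (-y) := by
      ext y; simp [errorProfile]
    rw [h4]
    have h5 : IntegrableOn (errorProfile H) (Ioi (-0)) := by rwa [neg_zero]
    exact h5.comp_neg_Iio
  rw [← integrableOn_univ, ← Iic_union_Ioi (a := (0 : ℝ)), integrableOn_union,
    integrableOn_Iic_iff_integrableOn_Iio]
  exact ⟨h3, h2⟩

/-- In the variable `y = |t - s| / r` the integrand is at least `ε^(2H-2)/4` times `exp(-y^(2H)/2)`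
minus `δ` times the error profile, where `δ` is a positive power of `r/ε`. The main term integrates
to at least `r/2` and the error to at most `r/4`, whence the constant `1/16`. The number `l` stands
for one coordinate of a frequency of norm `r^(-H)`. -/
lemma exists_le_integral_quotientCov {H : ℝ} (hH : 0 < H) (hH1 : H < 1) :
    ∃ η > 0, ∀ ε > 0, ∀ r > 0, ∀ T, r ≤ η * ε → 2 * r ≤ T - ε → ∀ t ∈ Icc ε T, ∀ l : ℝ,
      l ^ 2 ≤ r ^ (-(2 * H)) →
      ε ^ (2 * H - 2) * r / 16 ≤ ∫ s in Icc ε T,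
        (quotientCov H ε (t - s) - (l * incrementCov H ε (t - s)) ^ 2) *
          Real.exp (-(r ^ (-(2 * H)) * |t - s| ^ (2 * H)) / 2) := by
  set J := ∫ y, errorProfile H y with hJ
  have hJ0 : 0 ≤ J := integral_nonneg (errorProfile_nonneg H)
  -- The errors carry the powers `1`, `2`, `2H` and `2 - 2H` of `r/ε ≤ 1`; the exponent `b` bounds
  -- them all by one `δ`, and it is positive because `0 < H < 1`.
  set b := min 1 (min (2 * H) (2 - 2 * H)) with hb
  have hb0 : 0 < b := lt_min one_pos (lt_min (by linarith) (by linarith))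
  have hex : ∃ η > 0, η ≤ 1 ∧ η ^ b * J ≤ 1 / 4 := by
    have : Tendsto (fun η : ℝ => η ^ b * J) (𝓝[>] 0) (𝓝 0) := by
      have h := ((Real.continuous_rpow_const hb0.le).tendsto 0).mul_const J
      rw [Real.zero_rpow hb0.ne', zero_mul] at h
      exact h.mono_left nhdsWithin_le_nhds
    have h1 := this.eventually (gt_mem_nhds (show (0 : ℝ) < 1 / 4 by norm_num))
    have h2 : ∀ᶠ η : ℝ in 𝓝[>] 0, η ≤ 1 :=
      (eventually_le_nhds one_pos).filter_mono nhdsWithin_le_nhds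
    obtain ⟨η, ⟨h3, h4⟩, h5⟩ := ((h1.and h2).and self_mem_nhdsWithin).exists
    exact ⟨η, h5, h4, h3.le⟩
  obtain ⟨η, hη, hη1, hηJ⟩ := hex
  refine ⟨η, hη, fun ε hε r hr T hrη hrT t ht l hl => ?_⟩
  have hq : 0 < ε ^ (2 * H - 2) := by positivity
  set δ := (r / ε) ^ b with hδ
  have hrε : r / ε ≤ η := by rwa [div_le_iff₀ hε]
  have hrε1 : r / ε ≤ 1 := hrε.trans hη1
  have hrε0 : 0 < r / ε := by positivity
  have hδJ : δ * J ≤ 1 / 4 := by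
    exact (mul_le_mul_of_nonneg_right (Real.rpow_le_rpow hrε0.le hrε hb0.le) hJ0).trans hηJ
  have hδ0 : 0 < δ := by positivity
  have hδpow : ∀ a : ℝ, b ≤ a → (r / ε) ^ a ≤ δ := fun a ha =>
    Real.rpow_le_rpow_of_exponent_ge hrε0 hrε1 ha
  have hpt : ∀ s, ε ^ (2 * H - 2) / 4 * ((Icc (t - r) (t + r)).indicator (fun _ => (1 / 2 : ℝ)) s -
      δ * errorProfile H ((t - s) / r)) ≤
      (quotientCov H ε (t - s) - (l * incrementCov H ε (t - s)) ^ 2) *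
          Real.exp (-(r ^ (-(2 * H)) * |t - s| ^ (2 * H)) / 2) := by
    intro s
    set h := t - s with hh
    set y := |h| / r with hy
    have hy0 : 0 ≤ y := by positivity
    have hexp : r ^ (-(2 * H)) * |h| ^ (2 * H) = y ^ (2 * H) := by
      rw [hy, Real.div_rpow (abs_nonneg _) hr.le, Real.rpow_neg hr.le]; field_simp
    rw [hexp]
    have hE : errorProfile H (h / r) = (4 * y + 5 * y ^ 2 + y ^ (2 * H)) *
        Real.exp (-y ^ (2 * H) / 2) := by
      rw [errorProfile, abs_div, abs_of_pos hr]
    rw [hE]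
    -- For `y ≤ 1` the exponential is at least `1 - y^(2H)/2 ≥ 1/2`.
    have hind : (Icc (t - r) (t + r)).indicator (fun _ => (1 / 2 : ℝ)) s ≤
        Real.exp (-y ^ (2 * H) / 2) := by
      by_cases hs : s ∈ Icc (t - r) (t + r)
      · rw [indicator_of_mem hs]
        have hy1 : y ≤ 1 := by
          rw [hy, div_le_one hr, hh, abs_le]
          constructor <;> linarith [hs.1, hs.2]
        have := Real.rpow_le_one hy0 hy1 (by positivity : 0 ≤ 2 * H)
        have h2 := Real.add_one_le_exp (-y ^ (2 * H) / 2)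
        linarith
      · rw [indicator_of_notMem hs]; positivity
    have hq1 := le_quotientCov hH.le hH1.le hε h
    have hyε : |h| / ε = r / ε * y := by rw [hy]; field_simp
    rw [hyε, Real.mul_rpow hrε0.le hy0, mul_pow] at hq1
    -- With `|h| = r y`, the product of `r^(-2H)` and `(ε^(2H-2) r y)²` regroups as `ε^(2H-2)
    -- (r/ε)^(2-2H) y²`.
    have hi : (l * incrementCov H ε h) ^ 2 ≤ ε ^ (2 * H - 2) * ((r / ε) ^ (2 - 2 * H) * y ^ 2) := by
      have h1 := abs_incrementCov_le hH.le hH1.le hε h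
      have h2 : incrementCov H ε h ^ 2 ≤ (ε ^ (2 * H - 2) * |h|) ^ 2 := by
        rw [← sq_abs]; gcongr
      rw [mul_pow]
      calc _ ≤ r ^ (-(2 * H)) * (ε ^ (2 * H - 2) * |h|) ^ 2 := by gcongr
        _ = _ := by
          have e1 : |h| = r * y := by rw [hy]; field_simp
          have e2 : (r / ε) ^ (2 - 2 * H) = r ^ 2 * r ^ (-(2 * H)) * ε ^ (2 * H - 2) := by
            rw [Real.div_rpow hr.le hε.le, sub_eq_add_neg, Real.rpow_add hr, Real.rpow_two,
              div_eq_mul_inv, ← Real.rpow_neg hε.le]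
            congr 2
            ring
          rw [e1, e2]
          ring
    have d1 : r / ε ≤ δ := by simpa using hδpow 1 (min_le_left _ _)
    have d2 : (r / ε) ^ 2 ≤ δ := by
      have := hδpow 2 ((min_le_left _ _).trans one_le_two)
      rwa [Real.rpow_two] at this
    have d3 : (r / ε) ^ (2 * H) ≤ δ := hδpow _ ((min_le_right _ _).trans (min_le_left _ _))
    have d4 : (r / ε) ^ (2 - 2 * H) ≤ δ := hδpow _ ((min_le_right _ _).trans (min_le_right _ _))
    have hyH : 0 ≤ y ^ (2 * H) := by positivity
    -- The coefficient `5` of `y²` is `1` from `le_quotientCov` plus `4` from the squared term, once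
    -- the common factor `1/4` is taken out.
    have hlow : ε ^ (2 * H - 2) / 4 * (1 - δ * (4 * y + 5 * y ^ 2 + y ^ (2 * H))) ≤
        quotientCov H ε h - (l * incrementCov H ε h) ^ 2 := by
      have b1 : r / ε * y ≤ δ * y := by gcongr
      have b2 : (r / ε) ^ 2 * y ^ 2 ≤ δ * y ^ 2 := by gcongr
      have b3 : (r / ε) ^ (2 * H) * y ^ (2 * H) ≤ δ * y ^ (2 * H) := by gcongr
      have b4 : (r / ε) ^ (2 - 2 * H) * y ^ 2 ≤ δ * y ^ 2 := by gcongr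
      have b5 : ε ^ (2 * H - 2) / 4 * (1 - δ * (4 * y + 5 * y ^ 2 + y ^ (2 * H))) ≤
          ε ^ (2 * H - 2) / 4 * ((1 - 4 * (r / ε * y) - (r / ε) ^ 2 * y ^ 2 -
            (r / ε) ^ (2 * H) * y ^ (2 * H)) - 4 * ((r / ε) ^ (2 - 2 * H) * y ^ 2)) := by
        exact mul_le_mul_of_nonneg_left (by linarith) (by positivity)
      linarith
    calc _ ≤ ε ^ (2 * H - 2) / 4 * (Real.exp (-y ^ (2 * H) / 2) -
          δ * ((4 * y + 5 * y ^ 2 + y ^ (2 * H)) * Real.exp (-y ^ (2 * H) / 2))) := by gcongr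
      _ = ε ^ (2 * H - 2) / 4 * (1 - δ * (4 * y + 5 * y ^ 2 + y ^ (2 * H))) *
          Real.exp (-y ^ (2 * H) / 2) := by ring
      _ ≤ _ := by gcongr
  have hEint : Integrable (fun s => errorProfile H ((t - s) / r)) :=
    ((integrable_errorProfile hH).comp_div hr.ne').comp_sub_left t
  have hEval : ∫ s, errorProfile H ((t - s) / r) = r * J := by
    rw [integral_sub_left_eq_self (fun s => errorProfile H (s / r)) volume t,
      Measure.integral_comp_div, abs_of_pos hr, smul_eq_mul]
  have hIint : Integrable ((Icc (t - r) (t + r)).indicator (fun _ => (1 / 2 : ℝ))) :=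
    (integrable_indicator_iff measurableSet_Icc).2 (by simp)
  have hcont : ∀ c : ℝ, Continuous fun s : ℝ => |t - s + c| ^ (2 * H) := fun c =>
    Continuous.rpow_const (by fun_prop) (fun _ => Or.inr (by positivity))
  refine le_trans ?_ (setIntegral_mono_on (μ := volume) (s := Icc ε T)
    ((hIint.sub (hEint.const_mul δ)).const_mul _).integrableOn ?_ measurableSet_Icc
    (fun s _ => hpt s))
  · rw [integral_const_mul]
    have hsub := integral_sub (μ := volume.restrict (Icc ε T)) hIint.integrableOn
      (hEint.const_mul δ).integrableOn
    -- Even for `t` at an end point, a piece of length at least `r` of the window `[t - r, t + r]`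
    -- lies in `[ε, T]`, because `2r ≤ T - ε`.
    have h1 : r / 2 ≤ ∫ s in Icc ε T, (Icc (t - r) (t + r)).indicator (fun _ => (1 / 2 : ℝ)) s := by
      rw [setIntegral_indicator measurableSet_Icc, setIntegral_const, Icc_inter_Icc,
        measureReal_def, Real.volume_Icc, smul_eq_mul]
      have : r ≤ min T (t + r) - max ε (t - r) := by
        rw [le_sub_iff_add_le, le_min_iff]
        constructor
        · rw [← le_sub_iff_add_le', max_le_iff]
          constructor <;> linarith [ht.2]
        · rw [← le_sub_iff_add_le', max_le_iff]
          constructor <;> linarith [ht.1]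
      rw [ENNReal.toReal_ofReal (by linarith)]
      change r / 2 ≤ (min T (t + r) - max ε (t - r)) * (1 / 2)
      linarith
    have h2 : ∫ s in Icc ε T, δ * errorProfile H ((t - s) / r) ≤ r / 4 := by
      rw [integral_const_mul]
      have : ∫ s in Icc ε T, errorProfile H ((t - s) / r) ≤ r * J := by
        rw [← hEval]
        exact setIntegral_le_integral hEint (Eventually.of_forall fun s => errorProfile_nonneg H _)
      calc _ ≤ δ * (r * J) := by gcongr
        _ = r * (δ * J) := by ring
        _ ≤ r * (1 / 4) := by gcongr
        _ = r / 4 := by ring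
    change _ ≤ ε ^ (2 * H - 2) / 4 * ∫ s in Icc ε T, ((Icc (t - r) (t + r)).indicator
      (fun _ => (1 / 2 : ℝ)) s - δ * errorProfile H ((t - s) / r))
    rw [hsub]
    calc ε ^ (2 * H - 2) * r / 16 = ε ^ (2 * H - 2) / 4 * (r / 4) := by ring
      _ ≤ _ := by gcongr; linarith
  · refine ContinuousOn.integrableOn_Icc (Continuous.continuousOn ?_)
    have c0 := hcont 0
    have c1 := hcont ε
    have c2 := hcont (-ε)
    have c3 := hcont (2 * ε)
    have c4 := hcont (-(2 * ε))
    simp only [← sub_eq_add_neg, add_zero] at c0 c2 c4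
    unfold quotientCov incrementCov
    fun_prop

end

section

/-! ### Second moments of oscillatory integrals -/

lemma norm_sq_integral_eq {μ : Measure ℝ} [SFinite μ] {f : ℝ → ℂ} (hf : Integrable f μ) :
    ‖∫ t, f t ∂μ‖ ^ 2 = ∫ z, (f z.1 * (starRingEnd ℂ) (f z.2)).re ∂(μ.prod μ) := by
  have hcf : Integrable (fun t => (starRingEnd ℂ) (f t)) μ := by
    simpa using Complex.conjLIE.integrable_comp_iff.2 hf
  have h1 := integral_prod_mul (μ := μ) (ν := μ) f (fun t => (starRingEnd ℂ) (f t))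
  rw [integral_conj, Complex.mul_conj, Complex.normSq_eq_norm_sq] at h1
  have h2 := congrArg Complex.re h1
  have h3 : Integrable (fun z : ℝ × ℝ => f z.1 * (starRingEnd ℂ) (f z.2)) (μ.prod μ) :=
    hf.mul_prod hcf
  rw [Complex.ofReal_re, ← RCLike.re_eq_complex_re, ← integral_re h3] at h2
  exact h2.symm

lemma re_exp_mul_conj_exp (a b x y : ℝ) :
    (Complex.exp ((a : ℂ) * Complex.I) * (x : ℂ) *
      (starRingEnd ℂ) (Complex.exp ((b : ℂ) * Complex.I) * (y : ℂ))).re =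
      Real.cos (a - b) * (x * y) := by
  simp only [map_mul, Complex.conj_ofReal, ← Complex.exp_conj, Complex.conj_I]
  have h3 : Complex.exp ((a : ℂ) * Complex.I) * (x : ℂ) *
      (Complex.exp ((b : ℂ) * -Complex.I) * (y : ℂ)) =
      Complex.exp (((a - b : ℝ) : ℂ) * Complex.I) * ((x * y : ℝ) : ℂ) := by
    rw [mul_mul_mul_comm, ← Complex.exp_add]
    push_cast
    ring_nf
  rw [h3, Complex.re_mul_ofReal, Complex.exp_ofReal_mul_I_re]

section Oscillatory

variable {Ω : Type*} [MeasurableSpace Ω] {P : Measure Ω} {μ : Measure ℝ} {D θ : Ω → ℝ → ℝ} {M : ℝ}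

lemma integrable_cos_mul (hθ : Measurable (Function.uncurry θ))
    (hD2 : ∀ t, MemLp (fun ω => D ω t) 2 P) (t s : ℝ) :
    Integrable (fun ω => Real.cos (θ ω t - θ ω s) * (D ω t * D ω s)) P := by
  have h1 : Measurable fun ω => θ ω t := hθ.comp (by fun_prop : Measurable fun ω => (ω, t))
  have h2 : Measurable fun ω => θ ω s := hθ.comp (by fun_prop : Measurable fun ω => (ω, s))
  exact ((hD2 t).integrable_mul (hD2 s)).bdd_mul (c := 1)
    (Measurable.aestronglyMeasurable (by fun_prop))
    (Eventually.of_forall fun ω => Real.abs_cos_le_one _)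

lemma integral_norm_cos_mul_le (hθ : Measurable (Function.uncurry θ))
    (hD2 : ∀ t, MemLp (fun ω => D ω t) 2 P) {t s : ℝ}
    (ht : ∫ ω, D ω t ^ 2 ∂P ≤ M) (hs : ∫ ω, D ω s ^ 2 ∂P ≤ M) :
    ∫ ω, ‖Real.cos (θ ω t - θ ω s) * (D ω t * D ω s)‖ ∂P ≤ M := by
  have h1 : ∫ ω, ‖Real.cos (θ ω t - θ ω s) * (D ω t * D ω s)‖ ∂P ≤
      ∫ ω, (D ω t ^ 2 + D ω s ^ 2) / 2 ∂P := by
    refine integral_mono (integrable_cos_mul hθ hD2 t s).norm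
      (((hD2 t).integrable_sq.add (hD2 s).integrable_sq).div_const 2) fun ω => ?_
    simp only [norm_mul, Real.norm_eq_abs]
    refine (mul_le_of_le_one_left (by positivity) (Real.abs_cos_le_one _)).trans ?_
    nlinarith [sq_nonneg (|D ω t| - |D ω s|), sq_abs (D ω t), sq_abs (D ω s)]
  rw [integral_div, integral_add (hD2 t).integrable_sq (hD2 s).integrable_sq] at h1
  linarith

lemma measurable_cos_mul (hD : Measurable (Function.uncurry D))
    (hθ : Measurable (Function.uncurry θ)) :
    Measurable fun p : Ω × (ℝ × ℝ) =>
      Real.cos (θ p.1 p.2.1 - θ p.1 p.2.2) * (D p.1 p.2.1 * D p.1 p.2.2) := by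
  have h1 : Measurable fun p : Ω × (ℝ × ℝ) => θ p.1 p.2.1 :=
    hθ.comp (by fun_prop : Measurable fun p : Ω × (ℝ × ℝ) => (p.1, p.2.1))
  have h2 : Measurable fun p : Ω × (ℝ × ℝ) => θ p.1 p.2.2 :=
    hθ.comp (by fun_prop : Measurable fun p : Ω × (ℝ × ℝ) => (p.1, p.2.2))
  have h3 : Measurable fun p : Ω × (ℝ × ℝ) => D p.1 p.2.1 :=
    hD.comp (by fun_prop : Measurable fun p : Ω × (ℝ × ℝ) => (p.1, p.2.1))
  have h4 : Measurable fun p : Ω × (ℝ × ℝ) => D p.1 p.2.2 :=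
    hD.comp (by fun_prop : Measurable fun p : Ω × (ℝ × ℝ) => (p.1, p.2.2))
  exact (Real.measurable_cos.comp (h1.sub h2)).mul (h3.mul h4)

variable [IsProbabilityMeasure P] [IsFiniteMeasure μ]

lemma integrable_uncurry_of_sq_le (hD : Measurable (Function.uncurry D))
    (hD2 : ∀ t, MemLp (fun ω => D ω t) 2 P) (hM : ∀ᵐ t ∂μ, ∫ ω, D ω t ^ 2 ∂P ≤ M) :
    Integrable (Function.uncurry D) (P.prod μ) := by
  rw [integrable_prod_iff' hD.aestronglyMeasurable]
  refine ⟨Eventually.of_forall fun t => (hD2 t).integrable one_le_two, ?_⟩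
  refine Integrable.of_bound (C := (1 + M) / 2)
    hD.stronglyMeasurable.norm.integral_prod_left'.aestronglyMeasurable ?_
  filter_upwards [hM] with t ht
  rw [Real.norm_of_nonneg (integral_nonneg fun ω => norm_nonneg _)]
  have h1 : ∫ ω, ‖D ω t‖ ∂P ≤ ∫ ω, (1 + D ω t ^ 2) / 2 ∂P := by
    refine integral_mono ((hD2 t).integrable one_le_two).norm
      (((integrable_const 1).add (hD2 t).integrable_sq).div_const 2) fun ω => ?_
    simp only [Real.norm_eq_abs]
    nlinarith [sq_nonneg (|D ω t| - 1), sq_abs (D ω t)]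
  have h2 : ∫ ω, (1 + D ω t ^ 2) / 2 ∂P = (1 + ∫ ω, D ω t ^ 2 ∂P) / 2 := by
    rw [integral_div, integral_add (integrable_const 1) (hD2 t).integrable_sq]
    simp
  rw [h2] at h1
  exact h1.trans (by linarith)

lemma integrable_cos_mul_prod (hD : Measurable (Function.uncurry D))
    (hθ : Measurable (Function.uncurry θ)) (hD2 : ∀ t, MemLp (fun ω => D ω t) 2 P)
    (hM : ∀ᵐ t ∂μ, ∫ ω, D ω t ^ 2 ∂P ≤ M) :
    Integrable (fun p : Ω × (ℝ × ℝ) =>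
      Real.cos (θ p.1 p.2.1 - θ p.1 p.2.2) * (D p.1 p.2.1 * D p.1 p.2.2))
      (P.prod (μ.prod μ)) := by
  have hGm := measurable_cos_mul hD hθ
  have hMM : ∀ᵐ z ∂(μ.prod μ), ∫ ω, D ω z.1 ^ 2 ∂P ≤ M ∧ ∫ ω, D ω z.2 ^ 2 ∂P ≤ M :=
    (Measure.quasiMeasurePreserving_fst.ae hM).and (Measure.quasiMeasurePreserving_snd.ae hM)
  rw [integrable_prod_iff' hGm.aestronglyMeasurable]
  refine ⟨Eventually.of_forall fun z => integrable_cos_mul hθ hD2 z.1 z.2, ?_⟩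
  refine Integrable.of_bound (C := M)
    hGm.stronglyMeasurable.norm.integral_prod_left'.aestronglyMeasurable ?_
  filter_upwards [hMM] with z hz
  rw [Real.norm_of_nonneg (integral_nonneg fun ω => norm_nonneg _)]
  exact integral_norm_cos_mul_le hθ hD2 hz.1 hz.2

lemma norm_sq_integral_exp_mul {θ D : ℝ → ℝ} (hθ : Measurable θ) (hD : Integrable D μ) :
    ‖∫ t, Complex.exp ((θ t : ℂ) * Complex.I) * (D t : ℂ) ∂μ‖ ^ 2 =
      ∫ z, Real.cos (θ z.1 - θ z.2) * (D z.1 * D z.2) ∂(μ.prod μ) := by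
  have hm : AEStronglyMeasurable (fun t => Complex.exp ((θ t : ℂ) * Complex.I)) μ :=
    Measurable.aestronglyMeasurable (by fun_prop)
  have hD' : Integrable (fun t => (D t : ℂ)) μ := hD.ofReal
  have hf : Integrable (fun t => Complex.exp ((θ t : ℂ) * Complex.I) * (D t : ℂ)) μ :=
    hD'.bdd_mul hm (c := 1)
      (Eventually.of_forall fun t => (Complex.norm_exp_ofReal_mul_I (θ t)).le)
  rw [norm_sq_integral_eq hf]
  simp only [re_exp_mul_conj_exp]

/-- The squared modulus expands into a double time integral of cosines of phase differences; the
bound `M` on second moments gives the absolute integrability that lets the expectation pass inside.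
-/
lemma integral_norm_sq_oscillatory (hD : Measurable (Function.uncurry D))
    (hθ : Measurable (Function.uncurry θ)) (hD2 : ∀ t, MemLp (fun ω => D ω t) 2 P)
    (hM : ∀ᵐ t ∂μ, ∫ ω, D ω t ^ 2 ∂P ≤ M) :
    Integrable (fun ω => ‖∫ t, Complex.exp ((θ ω t : ℂ) * Complex.I) * (D ω t : ℂ) ∂μ‖ ^ 2) P ∧
    Integrable (fun z : ℝ × ℝ => ∫ ω, Real.cos (θ ω z.1 - θ ω z.2) * (D ω z.1 * D ω z.2) ∂P)
      (μ.prod μ) ∧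
    ∫ ω, ‖∫ t, Complex.exp ((θ ω t : ℂ) * Complex.I) * (D ω t : ℂ) ∂μ‖ ^ 2 ∂P =
      ∫ t, ∫ s, ∫ ω, Real.cos (θ ω t - θ ω s) * (D ω t * D ω s) ∂P ∂μ ∂μ := by
  have hGi := integrable_cos_mul_prod hD hθ hD2 hM
  have hsq : ∀ᵐ ω ∂P,
      ∫ z : ℝ × ℝ, Real.cos (θ ω z.1 - θ ω z.2) * (D ω z.1 * D ω z.2) ∂(μ.prod μ) =
      ‖∫ t, Complex.exp ((θ ω t : ℂ) * Complex.I) * (D ω t : ℂ) ∂μ‖ ^ 2 := by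
    filter_upwards [(integrable_uncurry_of_sq_le hD hD2 hM).prod_right_ae] with ω hω
    exact (norm_sq_integral_exp_mul (hθ.comp measurable_prodMk_left) hω).symm
  have hGz := hGi.integral_prod_right
  refine ⟨hGi.integral_prod_left.congr hsq, hGz, ?_⟩
  rw [← integral_congr_ae hsq]
  have h1 := integral_integral_swap (f := fun ω (z : ℝ × ℝ) =>
    Real.cos (θ ω z.1 - θ ω z.2) * (D ω z.1 * D ω z.2)) hGi
  rw [h1, integral_prod _ hGz]

lemma integral_norm_sq_oscillatory_le (hD : Measurable (Function.uncurry D))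
    (hθ : Measurable (Function.uncurry θ)) (hD2 : ∀ t, MemLp (fun ω => D ω t) 2 P)
    (hM : ∀ᵐ t ∂μ, ∫ ω, D ω t ^ 2 ∂P ≤ M) :
    ∫ ω, ‖∫ t, Complex.exp ((θ ω t : ℂ) * Complex.I) * (D ω t : ℂ) ∂μ‖ ^ 2 ∂P ≤
      M * μ.real univ ^ 2 := by
  obtain ⟨-, hi, h⟩ := integral_norm_sq_oscillatory hD hθ hD2 hM
  rw [h, ← integral_prod _ hi]
  have hMM : ∀ᵐ z ∂(μ.prod μ), ∫ ω, D ω z.1 ^ 2 ∂P ≤ M ∧ ∫ ω, D ω z.2 ^ 2 ∂P ≤ M :=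
    (Measure.quasiMeasurePreserving_fst.ae hM).and (Measure.quasiMeasurePreserving_snd.ae hM)
  have h1 : ∀ᵐ z ∂(μ.prod μ),
      ∫ ω, Real.cos (θ ω z.1 - θ ω z.2) * (D ω z.1 * D ω z.2) ∂P ≤ M := by
    filter_upwards [hMM] with z hz
    exact (le_abs_self _).trans ((norm_integral_le_integral_norm _).trans
      (integral_norm_cos_mul_le hθ hD2 hz.1 hz.2))
  refine (integral_mono_ae hi (integrable_const M) h1).trans (le_of_eq ?_)
  rw [integral_const, smul_eq_mul, measureReal_def, Measure.prod_apply MeasurableSet.univ]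
  simp [measureReal_def, sq, mul_comm]

end Oscillatory

end

section

/-! ### Fourier coefficients of the current of a fractional Brownian motion -/

section Fourier

variable {Ω : Type*} [MeasurableSpace Ω] {P : Measure Ω} {d : ℕ}
  {X : ℝ≥0 → Ω → EuclideanSpace ℝ (Fin d)} {H T ε : ℝ}

lemma measurable_uncurry_symmQuotient
    (hXm : Measurable fun p : Ω × ℝ => position X p.2 p.1) (ε : ℝ) :
    Measurable fun p : Ω × ℝ => symmQuotient X ε p.2 p.1 := by
  have h1 : Measurable fun p : Ω × ℝ => position X (p.2 + ε) p.1 :=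
    hXm.comp (by fun_prop : Measurable fun p : Ω × ℝ => (p.1, p.2 + ε))
  have h2 : Measurable fun p : Ω × ℝ => position X (p.2 - ε) p.1 :=
    hXm.comp (by fun_prop : Measurable fun p : Ω × ℝ => (p.1, p.2 - ε))
  exact (h1.sub h2).const_smul (1 / (2 * ε))

lemma measurable_uncurry_symmQuotient_apply
    (hXm : Measurable fun p : Ω × ℝ => position X p.2 p.1) (ε : ℝ) (i : Fin d) :
    Measurable (Function.uncurry fun ω t => symmQuotient X ε t ω i) :=
  (by fun_prop : Measurable fun v : EuclideanSpace ℝ (Fin d) => v i).comp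
    (measurable_uncurry_symmQuotient hXm ε)

lemma measurable_uncurry_phase (hXm : Measurable fun p : Ω × ℝ => position X p.2 p.1)
    (l : EuclideanSpace ℝ (Fin d)) :
    Measurable (Function.uncurry fun ω t => -inner ℝ (position X t ω) l) := by
  change Measurable fun p : Ω × ℝ => -inner ℝ (position X p.2 p.1) l
  fun_prop

/-- The integral of `exp (-i ⟨X_t, l⟩)` against the `i`-th component of the difference quotient. -/
def oscillatory (X : ℝ≥0 → Ω → EuclideanSpace ℝ (Fin d)) (ε : ℝ) (i : Fin d)
    (l : EuclideanSpace ℝ (Fin d)) (s : Set ℝ) (ω : Ω) : ℂ :=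
  ∫ t in s, Complex.exp (((-inner ℝ (position X t ω) l : ℝ) : ℂ) * Complex.I) *
    (symmQuotient X ε t ω i : ℂ)

variable [IsProbabilityMeasure P]

lemma IsFBM.integrable_oscillatory_sq (hX : IsFBM X H P) (hH : 0 < H) (hε : 0 < ε)
    (hXm : Measurable fun p : Ω × ℝ => position X p.2 p.1) (l : EuclideanSpace ℝ (Fin d))
    (i : Fin d) {s : Set ℝ} (hs : MeasurableSet s) (hsT : s ⊆ Icc 0 T) :
    Integrable (fun ω => ‖oscillatory X ε i l s ω‖ ^ 2) P := by
  have : IsFiniteMeasure (volume.restrict s) :=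
    isFiniteMeasure_restrict.2 ((measure_mono hsT).trans_lt measure_Icc_lt_top).ne
  exact (integral_norm_sq_oscillatory (μ := volume.restrict s)
    (measurable_uncurry_symmQuotient_apply hXm ε i) (measurable_uncurry_phase hXm l)
    (fun t => hX.memLp_symmQuotient ε t i) (M := (T + ε) ^ (2 * H) / ε ^ 2)
    (ae_restrict_of_forall_mem hs fun t ht => hX.integral_symmQuotient_sq_le hH hε (hsT ht) i)).1

lemma IsFBM.integral_oscillatory_sq_Icc (hX : IsFBM X H P) (hH : 0 < H) (hε : 0 < ε)
    (hXm : Measurable fun p : Ω × ℝ => position X p.2 p.1) (l : EuclideanSpace ℝ (Fin d))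
    (i : Fin d) :
    Integrable (fun t => ∫ s in Icc ε T, (quotientCov H ε (t - s) -
      (l i * incrementCov H ε (t - s)) ^ 2) * Real.exp (-(‖l‖ ^ 2 * |t - s| ^ (2 * H)) / 2))
      (volume.restrict (Icc ε T)) ∧
    ∫ ω, ‖oscillatory X ε i l (Icc ε T) ω‖ ^ 2 ∂P =
      ∫ t in Icc ε T, ∫ s in Icc ε T, (quotientCov H ε (t - s) -
        (l i * incrementCov H ε (t - s)) ^ 2) * Real.exp (-(‖l‖ ^ 2 * |t - s| ^ (2 * H)) / 2) := by
  obtain ⟨-, h2, h3⟩ := integral_norm_sq_oscillatory (μ := volume.restrict (Icc ε T))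
    (measurable_uncurry_symmQuotient_apply hXm ε i) (measurable_uncurry_phase hXm l)
    (fun t => hX.memLp_symmQuotient ε t i) (M := (T + ε) ^ (2 * H) / ε ^ 2)
    (ae_restrict_of_forall_mem measurableSet_Icc fun t ht =>
      hX.integral_symmQuotient_sq_le hH hε ⟨hε.le.trans ht.1, ht.2⟩ i)
  have hE : ∀ t ∈ Icc ε T, ∫ s in Icc ε T, ∫ ω, Real.cos (-inner ℝ (position X t ω) l -
      -inner ℝ (position X s ω) l) * (symmQuotient X ε t ω i * symmQuotient X ε s ω i) ∂P =
      ∫ s in Icc ε T, (quotientCov H ε (t - s) - (l i * incrementCov H ε (t - s)) ^ 2) *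
        Real.exp (-(‖l‖ ^ 2 * |t - s| ^ (2 * H)) / 2) := by
    intro t ht
    refine setIntegral_congr_fun measurableSet_Icc fun s hs => ?_
    beta_reduce
    rw [← hX.integral_cos_mul_symmQuotient hH l i hε hs.1 ht.1]
    refine integral_congr_ae (Eventually.of_forall fun ω => ?_)
    beta_reduce
    rw [inner_sub_right, real_inner_comm, real_inner_comm l (position X s ω), ← Real.cos_neg]
    ring_nf
  refine ⟨h2.integral_prod_left.congr
    (ae_restrict_of_forall_mem measurableSet_Icc fun t ht => hE t ht), ?_⟩
  rw [← setIntegral_congr_fun measurableSet_Icc hE]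
  exact h3

/-- For `t < ε` the quotient is `X_{t+ε} / (2ε)`, with variance at most `(2ε)^(2H) / (4ε²)`; the
squared length `ε²` of the interval cancels the denominator. The result is smaller by a factor `ε`
than the main order `ε^(2H-1)`. -/
lemma IsFBM.integral_oscillatory_sq_Ioo_le (hX : IsFBM X H P) (hH : 0 < H) (hH1 : H < 1)
    (hε : 0 < ε) (hXm : Measurable fun p : Ω × ℝ => position X p.2 p.1)
    (l : EuclideanSpace ℝ (Fin d)) (i : Fin d) :
    ∫ ω, ‖oscillatory X ε i l (Ioo 0 ε) ω‖ ^ 2 ∂P ≤ ε ^ (2 * H) := by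
  have h := integral_norm_sq_oscillatory_le (μ := volume.restrict (Ioo 0 ε))
    (measurable_uncurry_symmQuotient_apply hXm ε i) (measurable_uncurry_phase hXm l)
    (fun t => hX.memLp_symmQuotient ε t i) (M := (2 * ε) ^ (2 * H) / (4 * ε ^ 2))
    (ae_restrict_of_forall_mem measurableSet_Ioo fun t ht => by
      rw [hX.integral_symmQuotient_sq_of_lt hH ht.1.le ht.2]
      have := ht.1
      have := ht.2
      gcongr
      linarith)
  refine h.trans ?_
  have h2 : (2 : ℝ) ^ (2 * H) ≤ 4 := by
    calc (2 : ℝ) ^ (2 * H) ≤ 2 ^ (2 : ℝ) :=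
          Real.rpow_le_rpow_of_exponent_le (by norm_num) (by linarith)
      _ = 4 := by norm_num
  have h3 : 0 < ε ^ (2 * H) := by positivity
  rw [measureReal_restrict_apply MeasurableSet.univ, univ_inter, Real.volume_real_Ioo_of_le hε.le,
    sub_zero, Real.mul_rpow (by norm_num) hε.le]
  field_simp
  nlinarith

/-- The exact covariances are available on `[ε, T]` only. This inequality transfers a lower bound
from there to `(0, T]` at the cost of a factor `2` and the initial piece. -/
lemma IsFBM.oscillatory_sq_le (hX : IsFBM X H P) (hH : 0 < H) (hε : 0 < ε) (hεT : ε ≤ T)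
    (hXm : Measurable fun p : Ω × ℝ => position X p.2 p.1) (l : EuclideanSpace ℝ (Fin d))
    (i : Fin d) :
    ∀ᵐ ω ∂P, ‖oscillatory X ε i l (Icc ε T) ω‖ ^ 2 ≤
      2 * ‖oscillatory X ε i l (Ioc 0 T) ω‖ ^ 2 + 2 * ‖oscillatory X ε i l (Ioo 0 ε) ω‖ ^ 2 := by
  have hi := integrable_uncurry_of_sq_le (P := P) (μ := volume.restrict (Ioc 0 T))
    (measurable_uncurry_symmQuotient_apply hXm ε i) (fun t => hX.memLp_symmQuotient ε t i)
    (M := (T + ε) ^ (2 * H) / ε ^ 2) (ae_restrict_of_forall_mem measurableSet_Ioc fun t ht =>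
      hX.integral_symmQuotient_sq_le hH hε ⟨ht.1.le, ht.2⟩ i)
  filter_upwards [hi.prod_right_ae] with ω hω
  have hm : Measurable fun t => -inner ℝ (position X t ω) l :=
    (measurable_uncurry_phase hXm l).comp measurable_prodMk_left
  have hD : Integrable (fun t => (symmQuotient X ε t ω i : ℂ)) (volume.restrict (Ioc 0 T)) :=
    hω.ofReal
  have hf : IntegrableOn (fun t => Complex.exp (((-inner ℝ (position X t ω) l : ℝ) : ℂ) *
      Complex.I) * (symmQuotient X ε t ω i : ℂ)) (Ioc 0 T) :=
    hD.bdd_mul (Measurable.aestronglyMeasurable (by fun_prop)) (c := 1)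
      (Eventually.of_forall fun t => (Complex.norm_exp_ofReal_mul_I _).le)
  have hU : Ioo 0 ε ∪ Icc ε T = Ioc 0 T := Ioo_union_Icc_eq_Ioc hε hεT
  have hd : Disjoint (Ioo 0 ε) (Icc ε T) :=
    Set.disjoint_left.2 fun t h1 h2 => (h1.2.trans_le h2.1).false
  have hS : oscillatory X ε i l (Ioc 0 T) ω =
      oscillatory X ε i l (Ioo 0 ε) ω + oscillatory X ε i l (Icc ε T) ω := by
    simp only [oscillatory]
    rw [← hU] at hf ⊢
    exact setIntegral_union hd measurableSet_Icc hf.left_of_union hf.right_of_union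
  have hB : oscillatory X ε i l (Icc ε T) ω =
      oscillatory X ε i l (Ioc 0 T) ω - oscillatory X ε i l (Ioo 0 ε) ω := by
    rw [hS]; ring
  have h1 := norm_sub_le (oscillatory X ε i l (Ioc 0 T) ω) (oscillatory X ε i l (Ioo 0 ε) ω)
  rw [← hB] at h1
  nlinarith [norm_nonneg (oscillatory X ε i l (Icc ε T) ω),
    sq_nonneg (‖oscillatory X ε i l (Ioc 0 T) ω‖ - ‖oscillatory X ε i l (Ioo 0 ε) ω‖)]

lemma IsFBM.exists_le_integral_oscillatory_sq (hX : IsFBM X H P) (hH : 0 < H) (hH1 : H < 1)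
    (hXm : Measurable fun p : Ω × ℝ => position X p.2 p.1) (i : Fin d) :
    ∃ η > 0, ∀ ε > 0, ∀ r > 0, ∀ T, r ≤ η * ε → 2 * r ≤ T - ε → ∀ l : EuclideanSpace ℝ (Fin d),
      ‖l‖ ^ 2 = r ^ (-(2 * H)) →
      (T - ε) * ε ^ (2 * H - 2) * r / 32 - ε ^ (2 * H) ≤
        ∫ ω, ‖oscillatory X ε i l (Ioc 0 T) ω‖ ^ 2 ∂P := by
  obtain ⟨η, hη, h⟩ := exists_le_integral_quotientCov hH hH1
  refine ⟨η, hη, fun ε hε r hr T hrη hrT l hl => ?_⟩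
  have hεT : ε ≤ T := by linarith
  have hli : l i ^ 2 ≤ r ^ (-(2 * H)) := by
    rw [← hl, ← sq_abs]
    exact pow_le_pow_left₀ (abs_nonneg _) (PiLp.norm_apply_le l i) 2
  obtain ⟨hi, hB⟩ := hX.integral_oscillatory_sq_Icc (T := T) hH hε hXm l i
  rw [hl] at hi hB
  have h1 : (T - ε) * (ε ^ (2 * H - 2) * r / 16) ≤
      ∫ ω, ‖oscillatory X ε i l (Icc ε T) ω‖ ^ 2 ∂P := by
    rw [hB]
    calc (T - ε) * (ε ^ (2 * H - 2) * r / 16) =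
        ∫ t in Icc ε T, ε ^ (2 * H - 2) * r / 16 := by
          rw [setIntegral_const, smul_eq_mul, Real.volume_real_Icc_of_le hεT]
      _ ≤ _ := setIntegral_mono_on (integrable_const _) hi measurableSet_Icc
          fun t ht => h ε hε r hr T hrη hrT t ht (l i) hli
  have iA := hX.integrable_oscillatory_sq hH hε hXm l i measurableSet_Ioo
    (Ioo_subset_Icc_self : Ioo 0 ε ⊆ Icc 0 ε)
  have iS := hX.integrable_oscillatory_sq hH hε hXm l i measurableSet_Ioc
    (Ioc_subset_Icc_self : Ioc 0 T ⊆ Icc 0 T)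
  have iB := hX.integrable_oscillatory_sq hH hε hXm l i measurableSet_Icc
    (Icc_subset_Icc_left hε.le : Icc ε T ⊆ Icc 0 T)
  have h2 := integral_mono_ae iB ((iS.const_mul 2).add (iA.const_mul 2))
    (hX.oscillatory_sq_le hH hε hεT hXm l i)
  simp only [Pi.add_apply] at h2
  rw [integral_add (iS.const_mul 2) (iA.const_mul 2), integral_const_mul, integral_const_mul] at h2
  have h3 := hX.integral_oscillatory_sq_Ioo_le hH hH1 hε hXm l i
  linarith

/-- The Fourier coefficients at frequencies of order `ε ^ (-H)` have second moment of order at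
least `ε ^ (2H - 1)`. -/
lemma IsFBM.exists_le_lintegral_oscillatory_sq (hX : IsFBM X H P) (hH : 0 < H) (hH1 : H < 1)
    (hT : 0 < T) (hXm : Measurable fun p : Ω × ℝ => position X p.2 p.1) (i : Fin d) :
    ∃ η > 0, ∃ c > 0, ∀ᶠ ε : ℝ in 𝓝[>] 0, ∀ l : EuclideanSpace ℝ (Fin d),
      (η * ε) ^ (-H) ≤ ‖l‖ → ‖l‖ ≤ 2 * (η * ε) ^ (-H) →
      ENNReal.ofReal (c * ε ^ (2 * H - 1)) ≤
        ∫⁻ ω, ‖oscillatory X ε i l (Ioc 0 T) ω‖ₑ ^ 2 ∂P := by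
  obtain ⟨η, hη, h⟩ := hX.exists_le_integral_oscillatory_sq hH hH1 hXm i
  -- In the bound `(T - ε) ε^(2H-2) r / 32` one has `T - ε ≥ T/2` and `r ≥ 2^(-1/H) η ε`. Half of
  -- `c` is given up later to absorb the initial piece `ε^(2H)`.
  set c : ℝ := T * (2 ^ (-(1 / H)) * η) / 64 with hc
  have hc0 : 0 < c := by positivity
  refine ⟨η, hη, c / 2, by positivity, ?_⟩
  have e1 : ∀ᶠ ε : ℝ in 𝓝[>] 0, ε < T / 2 :=
    nhdsWithin_le_nhds (eventually_lt_nhds (by positivity))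
  have e2 : ∀ᶠ ε : ℝ in 𝓝[>] 0, ε < c / 2 :=
    nhdsWithin_le_nhds (eventually_lt_nhds (by positivity))
  have e3 : ∀ᶠ ε : ℝ in 𝓝[>] 0, ε < T / (4 * η) :=
    nhdsWithin_le_nhds (eventually_lt_nhds (by positivity))
  filter_upwards [e1, e2, e3, self_mem_nhdsWithin] with ε h1 h2 h3 hε l hl1 hl2
  have hε : 0 < ε := hε
  have hηε : 0 < η * ε := by positivity
  have hl0 : 0 < ‖l‖ := lt_of_lt_of_le (by positivity) hl1
  have hHinv : -H * (-(1 / H)) = 1 := by field_simp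
  -- The decorrelation scale of the frequency, `‖l‖ = r^(-H)`. The two bounds on `‖l‖` place `r`
  -- between `2^(-1/H) η ε` and `η ε`.
  set r := ‖l‖ ^ (-(1 / H)) with hr
  have hr0 : 0 < r := by positivity
  have hrη : r ≤ η * ε := by
    calc r ≤ ((η * ε) ^ (-H)) ^ (-(1 / H)) :=
          Real.rpow_le_rpow_of_nonpos (by positivity) hl1 (by simp [hH.le])
      _ = η * ε := by rw [← Real.rpow_mul hηε.le, hHinv, Real.rpow_one]
  have hrη2 : 2 ^ (-(1 / H)) * η * ε ≤ r := by
    calc 2 ^ (-(1 / H)) * η * ε = (2 * (η * ε) ^ (-H)) ^ (-(1 / H)) := by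
          rw [Real.mul_rpow (by norm_num) (by positivity), ← Real.rpow_mul hηε.le, hHinv,
            Real.rpow_one, mul_assoc]
      _ ≤ r := Real.rpow_le_rpow_of_nonpos hl0 hl2 (by simp [hH.le])
  have hlr : ‖l‖ ^ 2 = r ^ (-(2 * H)) := by
    rw [hr, ← Real.rpow_mul hl0.le, ← Real.rpow_natCast]
    congr 1
    field_simp
    norm_num
  have h4 : 4 * (η * ε) ≤ T := by
    rw [lt_div_iff₀ (by positivity)] at h3
    linarith
  have hfin := h ε hε r hr0 T hrη (by linarith) l hlr
  have hp1 : ε ^ (2 * H - 2) * ε = ε ^ (2 * H - 1) := by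
    rw [← Real.rpow_add_one hε.ne']
    ring_nf
  have hp2 : ε ^ (2 * H) = ε ^ (2 * H - 1) * ε := by
    rw [← Real.rpow_add_one hε.ne']
    ring_nf
  have hlow : c * ε ^ (2 * H - 1) ≤ (T - ε) * ε ^ (2 * H - 2) * r / 32 := by
    calc c * ε ^ (2 * H - 1) = T / 2 * ε ^ (2 * H - 2) * (2 ^ (-(1 / H)) * η * ε) / 32 := by
          rw [hc, ← hp1]; ring
      _ ≤ (T - ε) * ε ^ (2 * H - 2) * r / 32 := by
          have : 0 ≤ (T - ε) * ε ^ (2 * H - 2) := mul_nonneg (by linarith) (by positivity)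
          gcongr
          linarith
  have hup : ε ^ (2 * H) ≤ c / 2 * ε ^ (2 * H - 1) := by
    rw [hp2, mul_comm]
    gcongr
  have hi := hX.integrable_oscillatory_sq hH hε hXm l i measurableSet_Ioc
    (Ioc_subset_Icc_self : Ioc 0 T ⊆ Icc 0 T)
  calc ENNReal.ofReal (c / 2 * ε ^ (2 * H - 1)) ≤
      ENNReal.ofReal (∫ ω, ‖oscillatory X ε i l (Ioc 0 T) ω‖ ^ 2 ∂P) :=
        ENNReal.ofReal_le_ofReal (by linarith)
    _ = ∫⁻ ω, ‖oscillatory X ε i l (Ioc 0 T) ω‖ₑ ^ 2 ∂P := by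
        rw [ofReal_integral_eq_lintegral_ofReal hi (Eventually.of_forall fun ω => sq_nonneg _)]
        refine lintegral_congr fun ω => ?_
        rw [ENNReal.ofReal_pow (norm_nonneg _), ofReal_norm]

end Fourier

end

section

/-! ### Divergence of the norm of the current -/

section Divergence

variable {Ω : Type*} {d : ℕ} {X : ℝ≥0 → Ω → EuclideanSpace ℝ (Fin d)} {H T ε α : ℝ}

lemma exists_norm_symmQuotient_le {ω : Ω} (hb : ∀ R, ∃ C, ∀ t ≤ R, ‖position X t ω‖ ≤ C)
    (ε T : ℝ) : ∃ C, ∀ t ∈ Ioc 0 T, ‖symmQuotient X ε t ω‖ ≤ C := by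
  obtain ⟨C, hC⟩ := hb (T + |ε|)
  refine ⟨|1 / (2 * ε)| * (C + C), fun t ht => ?_⟩
  rw [symmQuotient, norm_smul, Real.norm_eq_abs]
  gcongr
  exact (norm_sub_le _ _).trans (add_le_add (hC _ (by linarith [ht.2, le_abs_self ε]))
    (hC _ (by linarith [ht.2, neg_abs_le ε])))

variable [MeasurableSpace Ω] {P : Measure Ω}

lemma measurable_position_right (hXm : Measurable fun p : Ω × ℝ => position X p.2 p.1) (ω : Ω) :
    Measurable fun t => position X t ω := by
  have h := hXm.comp (measurable_prodMk_left (x := ω))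
  exact h

lemma measurable_symmQuotient_right (hXm : Measurable fun p : Ω × ℝ => position X p.2 p.1)
    (ε : ℝ) (ω : Ω) : Measurable fun t => symmQuotient X ε t ω := by
  have h := (measurable_uncurry_symmQuotient hXm ε).comp (measurable_prodMk_left (x := ω))
  exact h

lemma lintegral_oscillatory_le_currentNormSq (hα : 0 < α) (hT : 0 ≤ T)
    (hXm : Measurable fun p : Ω × ℝ => position X p.2 p.1) {ω : Ω}
    (hb : ∀ R, ∃ C, ∀ t ≤ R, ‖position X t ω‖ ≤ C) (ε : ℝ) (i : Fin d) :
    ∫⁻ ξ : EuclideanSpace ℝ (Fin d),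
        ENNReal.ofReal ((1 + 4 * Real.pi ^ 2 * ‖ξ‖ ^ 2) ^ (-α)) *
          ‖oscillatory X ε i ((2 * Real.pi) • ξ) (Ioc 0 T) ω‖ₑ ^ 2 ≤
      currentNormSq X T α ε ω := by
  obtain ⟨C, hC⟩ := exists_norm_symmQuotient_le hb ε T
  have hx : Measurable fun t => position X t ω := measurable_position_right hXm ω
  have hv : Measurable fun t => symmQuotient X ε t ω := measurable_symmQuotient_right hXm ε ω
  have h := lintegral_fourier_le_lintegral_field (half_pos hα) hT hx hv hC i
  rw [mul_div_cancel₀ α (two_ne_zero' ℝ)] at h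
  have h2 : ∀ ξ, oscillatory X ε i ((2 * Real.pi) • ξ) (Ioc 0 T) ω =
      ∫ t in (0 : ℝ)..T, Complex.exp (((-2 * Real.pi * inner ℝ (position X t ω) ξ : ℝ) : ℂ) *
        Complex.I) * (symmQuotient X ε t ω i : ℂ) := by
    intro ξ
    rw [intervalIntegral.integral_of_le hT, oscillatory]
    simp only [inner_smul_right, neg_mul]
  simp only [h2, currentNormSq, currentField]
  exact h

lemma measurable_oscillatory (hXm : Measurable fun p : Ω × ℝ => position X p.2 p.1) (ε : ℝ)
    (i : Fin d) (s : Set ℝ) :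
    Measurable fun p : Ω × EuclideanSpace ℝ (Fin d) => oscillatory X ε i p.2 s p.1 := by
  have hg : Measurable fun q : (Ω × EuclideanSpace ℝ (Fin d)) × ℝ => (q.1.1, q.2) := by fun_prop
  have h1 := hXm.comp hg
  have h2 := (measurable_uncurry_symmQuotient_apply hXm ε i).comp hg
  have h3 := h1.inner (𝕜 := ℝ) (measurable_fst.snd :
    Measurable fun q : (Ω × EuclideanSpace ℝ (Fin d)) × ℝ => q.1.2)
  have h4 := (Complex.measurable_exp.comp
    ((Complex.measurable_ofReal.comp h3.neg).mul_const Complex.I)).mul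
      (Complex.measurable_ofReal.comp h2)
  exact (h4.stronglyMeasurable.integral_prod_right' (ν := volume.restrict s)).measurable

/-- This ball sits inside the shell `ρ ≤ |ξ| ≤ 2ρ` and has volume of the same order `ρ^d`; the
direction `i` merely supplies a unit vector. -/
lemma volume_ball_single (i : Fin d) {ρ : ℝ} (hρ : 0 < ρ) :
    volume (Metric.ball (EuclideanSpace.single i (3 * ρ / 2)) (ρ / 2)) =
      ENNReal.ofReal ((ρ / 2) ^ d) * volume (Metric.ball (0 : EuclideanSpace ℝ (Fin d)) 1) := by
  rw [Measure.addHaar_ball_of_pos _ _ (by positivity), finrank_euclideanSpace_fin]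

lemma norm_mem_of_mem_ball_single (i : Fin d) {ρ : ℝ} (hρ : 0 < ρ) {ξ : EuclideanSpace ℝ (Fin d)}
    (hξ : ξ ∈ Metric.ball (EuclideanSpace.single i (3 * ρ / 2)) (ρ / 2)) :
    ρ ≤ ‖ξ‖ ∧ ‖ξ‖ ≤ 2 * ρ := by
  rw [mem_ball_iff_norm] at hξ
  have h1 : ‖EuclideanSpace.single i (3 * ρ / 2)‖ = 3 * ρ / 2 := by
    rw [PiLp.norm_single, Real.norm_of_nonneg (by positivity)]
  have h2 := abs_norm_sub_norm_le ξ (EuclideanSpace.single i (3 * ρ / 2))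
  rw [h1, abs_le] at h2
  constructor <;> linarith

variable [IsProbabilityMeasure P]

/-- The spectral lower bound is restricted to a ball of frequencies of order `ε^(-H)`. Weight,
second moment and volume supply the powers `2Hα`, `2H - 1` and `-Hd` of `ε`, and their sum is `2H(α
- α_H)`. -/
lemma IsFBM.exists_le_lintegral_currentNormSq (hX : IsFBM X H P) (hH : 0 < H) (hH1 : H < 1)
    (hT : 0 < T) (hα : 0 < α) (hXm : Measurable fun p : Ω × ℝ => position X p.2 p.1)
    (hb : ∀ ω R, ∃ C, ∀ t ≤ R, ‖position X t ω‖ ≤ C) (i : Fin d) :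
    ∃ c > 0, ∀ᶠ ε : ℝ in 𝓝[>] 0,
      ENNReal.ofReal (c * ε ^ (2 * H * (α - criticalExponent d H))) *
        volume (Metric.ball (0 : EuclideanSpace ℝ (Fin d)) 1) ≤
        ∫⁻ ω, currentNormSq X T α ε ω ∂P := by
  obtain ⟨η, hη, c, hc, h⟩ := hX.exists_le_lintegral_oscillatory_sq hH hH1 hT hXm i
  refine ⟨5 ^ (-α) * η ^ (2 * H * α - H * d) * (4 * Real.pi) ^ (-(d : ℝ)) * c, by positivity, ?_⟩
  have e1 : ∀ᶠ ε : ℝ in 𝓝[>] 0, ε < 1 / η :=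
    nhdsWithin_le_nhds (eventually_lt_nhds (by positivity))
  filter_upwards [h, e1, self_mem_nhdsWithin] with ε hε' hε1 hε
  have hε : 0 < ε := hε
  have hηε : 0 < η * ε := by positivity
  have hηε1 : η * ε ≤ 1 := by
    rw [lt_div_iff₀ hη] at hε1
    linarith
  set R := (η * ε) ^ (-H) with hR
  have hR1 : 1 ≤ R := Real.one_le_rpow_of_pos_of_le_one_of_nonpos hηε hηε1 (by linarith)
  set ρ := R / (2 * Real.pi) with hρ
  have hpi := Real.pi_pos
  have hρ0 : 0 < ρ := by positivity
  have hρR : 2 * Real.pi * ρ = R := by rw [hρ]; field_simp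
  set B := Metric.ball (EuclideanSpace.single i (3 * ρ / 2)) (ρ / 2) with hB
  have hm := measurable_oscillatory hXm ε i (Ioc 0 T)
  have hm2 : Measurable fun p : Ω × EuclideanSpace ℝ (Fin d) =>
      ENNReal.ofReal ((1 + 4 * Real.pi ^ 2 * ‖p.2‖ ^ 2) ^ (-α)) *
        ‖oscillatory X ε i ((2 * Real.pi) • p.2) (Ioc 0 T) p.1‖ₑ ^ 2 := by
    have h1 : Measurable fun p : Ω × EuclideanSpace ℝ (Fin d) =>
        oscillatory X ε i ((2 * Real.pi) • p.2) (Ioc 0 T) p.1 := by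
      have h := hm.comp (by fun_prop : Measurable fun p : Ω × EuclideanSpace ℝ (Fin d) =>
        (p.1, (2 * Real.pi) • p.2))
      exact h
    exact Measurable.mul (by fun_prop) (h1.enorm.pow_const 2)
  have hmξ : ∀ ξ, Measurable fun ω => ‖oscillatory X ε i ((2 * Real.pi) • ξ) (Ioc 0 T) ω‖ₑ ^ 2 := by
    intro ξ
    have h1 : Measurable fun ω => oscillatory X ε i ((2 * Real.pi) • ξ) (Ioc 0 T) ω := by
      have h := hm.comp (by fun_prop : Measurable fun ω : Ω => (ω, (2 * Real.pi) • ξ))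
      exact h
    exact h1.enorm.pow_const 2
  -- On the ball `2π|ξ| ≤ 2R`, and `R ≥ 1`, so `1 + 4π²|ξ|² ≤ 1 + 4R² ≤ 5R²`.
  have hpt : ∀ ξ ∈ B, ENNReal.ofReal ((5 * R ^ 2) ^ (-α)) * ENNReal.ofReal (c * ε ^ (2 * H - 1)) ≤
      ∫⁻ ω, ENNReal.ofReal ((1 + 4 * Real.pi ^ 2 * ‖ξ‖ ^ 2) ^ (-α)) *
        ‖oscillatory X ε i ((2 * Real.pi) • ξ) (Ioc 0 T) ω‖ₑ ^ 2 ∂P := by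
    intro ξ hξ
    obtain ⟨h1, h2⟩ := norm_mem_of_mem_ball_single i hρ0 hξ
    have h3 : ‖(2 * Real.pi) • ξ‖ = 2 * Real.pi * ‖ξ‖ := by
      rw [norm_smul, Real.norm_of_nonneg (by positivity)]
    have h4 : 2 * Real.pi * ‖ξ‖ ≤ 2 * R := by
      rw [← hρR]
      nlinarith
    rw [lintegral_const_mul _ (hmξ ξ)]
    refine mul_le_mul' (ENNReal.ofReal_le_ofReal ?_) (hε' _ ?_ ?_)
    · refine Real.rpow_le_rpow_of_nonpos (by positivity) ?_ (by linarith)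
      have : (2 * Real.pi * ‖ξ‖) ^ 2 ≤ (2 * R) ^ 2 := pow_le_pow_left₀ (by positivity) h4 2
      nlinarith
    · rw [h3, ← hρR]
      gcongr
    · rw [h3]
      exact h4
  have hexp : 2 * H * (α - criticalExponent d H) = 2 * H * α - H * d + (2 * H - 1) := by
    rw [criticalExponent]
    field_simp
    ring
  have hconst : 5 ^ (-α) * η ^ (2 * H * α - H * d) * (4 * Real.pi) ^ (-(d : ℝ)) * c *
      ε ^ (2 * H * (α - criticalExponent d H)) =
      (5 * R ^ 2) ^ (-α) * (c * ε ^ (2 * H - 1)) * (ρ / 2) ^ d := by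
    have h1 : (5 * R ^ 2) ^ (-α) = 5 ^ (-α) * (η * ε) ^ (2 * H * α) := by
      rw [Real.mul_rpow (by norm_num) (by positivity), hR, ← Real.rpow_natCast,
        ← Real.rpow_mul hηε.le, ← Real.rpow_mul hηε.le]
      congr 2
      push_cast
      ring
    have h2 : (ρ / 2) ^ d = (η * ε) ^ (-(H * d)) * (4 * Real.pi) ^ (-(d : ℝ)) := by
      rw [hρ, show R / (2 * Real.pi) / 2 = R * (4 * Real.pi)⁻¹ by field_simp; norm_num, mul_pow,
        hR, ← Real.rpow_natCast ((η * ε) ^ (-H)), ← Real.rpow_mul hηε.le, inv_pow, neg_mul,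
        Real.rpow_neg (by positivity : 0 ≤ 4 * Real.pi), Real.rpow_natCast]
    have h3 : η ^ (2 * H * α - H * d) * ε ^ (2 * H * (α - criticalExponent d H)) =
        (η * ε) ^ (2 * H * α) * (η * ε) ^ (-(H * d)) * ε ^ (2 * H - 1) := by
      rw [hexp, Real.rpow_add hε, ← Real.rpow_add hηε, Real.mul_rpow hη.le hε.le, ← sub_eq_add_neg]
      ring
    rw [h1, h2]
    linear_combination (5 ^ (-α) * (4 * Real.pi) ^ (-(d : ℝ)) * c) * h3
  calc ENNReal.ofReal (5 ^ (-α) * η ^ (2 * H * α - H * d) * (4 * Real.pi) ^ (-(d : ℝ)) * c *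
        ε ^ (2 * H * (α - criticalExponent d H))) *
          volume (Metric.ball (0 : EuclideanSpace ℝ (Fin d)) 1)
      = ∫⁻ ξ in B, ENNReal.ofReal ((5 * R ^ 2) ^ (-α)) * ENNReal.ofReal (c * ε ^ (2 * H - 1)) := by
        rw [setLIntegral_const, hB, volume_ball_single i hρ0, hconst,
          ENNReal.ofReal_mul (by positivity), ENNReal.ofReal_mul (by positivity), mul_assoc]
    _ ≤ ∫⁻ ξ in B, ∫⁻ ω, ENNReal.ofReal ((1 + 4 * Real.pi ^ 2 * ‖ξ‖ ^ 2) ^ (-α)) *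
        ‖oscillatory X ε i ((2 * Real.pi) • ξ) (Ioc 0 T) ω‖ₑ ^ 2 ∂P :=
        setLIntegral_mono' measurableSet_ball hpt
    _ ≤ ∫⁻ ξ, ∫⁻ ω, ENNReal.ofReal ((1 + 4 * Real.pi ^ 2 * ‖ξ‖ ^ 2) ^ (-α)) *
        ‖oscillatory X ε i ((2 * Real.pi) • ξ) (Ioc 0 T) ω‖ₑ ^ 2 ∂P := setLIntegral_le_lintegral _ _
    _ = ∫⁻ ω, (∫⁻ ξ, ENNReal.ofReal ((1 + 4 * Real.pi ^ 2 * ‖ξ‖ ^ 2) ^ (-α)) *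
        ‖oscillatory X ε i ((2 * Real.pi) • ξ) (Ioc 0 T) ω‖ₑ ^ 2) ∂P :=
        (lintegral_lintegral_swap (f := fun ω (ξ : EuclideanSpace ℝ (Fin d)) =>
          ENNReal.ofReal ((1 + 4 * Real.pi ^ 2 * ‖ξ‖ ^ 2) ^ (-α)) *
            ‖oscillatory X ε i ((2 * Real.pi) • ξ) (Ioc 0 T) ω‖ₑ ^ 2) hm2.aemeasurable).symm
    _ ≤ ∫⁻ ω, currentNormSq X T α ε ω ∂P := lintegral_mono fun ω =>
        lintegral_oscillatory_le_currentNormSq hα hT.le hXm (hb ω) ε i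

lemma IsFBM.tendsto_lintegral_currentNormSq (hX : IsFBM X H P) (hH : 0 < H) (hH1 : H < 1)
    (hT : 0 < T) (hα : 0 < α) (hαH : α < criticalExponent d H)
    (hXm : Measurable fun p : Ω × ℝ => position X p.2 p.1)
    (hb : ∀ ω R, ∃ C, ∀ t ≤ R, ‖position X t ω‖ ≤ C) (i : Fin d) :
    Tendsto (fun ε : ℝ => ∫⁻ ω, currentNormSq X T α ε ω ∂P) (𝓝[>] 0) (𝓝 ⊤) := by
  obtain ⟨c, hc, h⟩ := hX.exists_le_lintegral_currentNormSq hH hH1 hT hα hXm hb i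
  have hneg : 2 * H * (α - criticalExponent d H) < 0 :=
    mul_neg_of_pos_of_neg (by positivity) (by linarith)
  have h1 : Tendsto (fun ε : ℝ => ENNReal.ofReal (c * ε ^ (2 * H * (α - criticalExponent d H))))
      (𝓝[>] 0) (𝓝 ⊤) :=
    ENNReal.tendsto_ofReal_atTop.comp ((tendsto_rpow_neg_nhdsGT_zero hneg).const_mul_atTop hc)
  have h2 : volume (Metric.ball (0 : EuclideanSpace ℝ (Fin d)) 1) ≠ 0 :=
    (Metric.measure_ball_pos _ _ one_pos).ne'
  have h3 := ENNReal.Tendsto.mul_const (b := volume (Metric.ball (0 : EuclideanSpace ℝ (Fin d)) 1))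
    h1 (Or.inl ENNReal.top_ne_zero)
  rw [ENNReal.top_mul h2] at h3
  exact tendsto_of_tendsto_of_tendsto_of_le_of_le' h3 tendsto_const_nhds h
    (Eventually.of_forall fun _ => le_top)

end Divergence

end

section

/-! ### A modification with continuous paths -/

section Modification

variable {Ω : Type*} {d : ℕ} {X : ℝ≥0 → Ω → EuclideanSpace ℝ (Fin d)} {H T α : ℝ}

/-- The process `X` stopped at the origin on the exceptional set `N`. -/
def vanishOn (X : ℝ≥0 → Ω → EuclideanSpace ℝ (Fin d)) (N : Set Ω) (t : ℝ≥0) (ω : Ω) :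
    EuclideanSpace ℝ (Fin d) :=
  Nᶜ.indicator (X t) ω

lemma vanishOn_of_mem {N : Set Ω} {ω : Ω} (h : ω ∈ N) (t : ℝ≥0) : vanishOn X N t ω = 0 :=
  indicator_of_notMem (by simpa using h) _

lemma vanishOn_of_notMem {N : Set Ω} {ω : Ω} (h : ω ∉ N) (t : ℝ≥0) : vanishOn X N t ω = X t ω :=
  indicator_of_mem (by simpa using h) _

lemma position_vanishOn {N : Set Ω} {ω : Ω} (h : ω ∉ N) (t : ℝ) :
    position (vanishOn X N) t ω = position X t ω := by
  simp only [position, vanishOn_of_notMem h]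

lemma symmQuotient_vanishOn {N : Set Ω} {ω : Ω} (h : ω ∉ N) (ε t : ℝ) :
    symmQuotient (vanishOn X N) ε t ω = symmQuotient X ε t ω := by
  simp only [symmQuotient, position_vanishOn h]

lemma kernelIntegrable_vanishOn {N : Set Ω} {ω : Ω} (h : ω ∉ N) :
    KernelIntegrable (vanishOn X N) T α ω ↔ KernelIntegrable X T α ω := by
  simp only [KernelIntegrable, position_vanishOn h]

lemma energy_vanishOn {N : Set Ω} {ω : Ω} (h : ω ∉ N) (ε : ℝ) :
    energy (vanishOn X N) T α ε ω = energy X T α ε ω := by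
  simp only [energy, position_vanishOn h, symmQuotient_vanishOn h]

lemma currentNormSq_vanishOn {N : Set Ω} {ω : Ω} (h : ω ∉ N) (ε : ℝ) :
    currentNormSq (vanishOn X N) T α ε ω = currentNormSq X T α ε ω := by
  simp only [currentNormSq, currentField, position_vanishOn h, symmQuotient_vanishOn h]

lemma exists_norm_position_le {ω : Ω} (hc : Continuous fun t => X t ω) (R : ℝ) :
    ∃ C, ∀ t ≤ R, ‖position X t ω‖ ≤ C := by
  obtain ⟨C, hC⟩ := (isCompact_Icc (a := 0) (b := R.toNNReal)).exists_bound_of_continuousOn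
    hc.continuousOn
  refine ⟨max C 0, fun t ht => ?_⟩
  rcases lt_or_ge t 0 with h | h
  · simp [position_of_neg h]
  · rw [position_of_nonneg h]
    exact (hC _ ⟨zero_le, Real.toNNReal_le_toNNReal ht⟩).trans (le_max_left _ _)

variable [MeasurableSpace Ω] {P : Measure Ω}

lemma IsFBM.measurable (hX : IsFBM X H P) (t : ℝ≥0) : Measurable (X t) := by
  have h : Measurable fun ω i => X t ω i := measurable_pi_lambda _ fun i =>
    (hX.component i).measurable t
  exact (MeasurableEquiv.toLp 2 (Fin d → ℝ)).measurable.comp h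

lemma IsFBM.ae_continuous (hX : IsFBM X H P) : ∀ᵐ ω ∂P, Continuous fun t => X t ω := by
  filter_upwards [ae_all_iff.2 fun i => (hX.component i).continuous_paths] with ω hω
  have h : Continuous fun t i => X t ω i := continuous_pi hω
  exact (PiLp.continuous_toLp 2 _).comp h

lemma IsFBM.vanishOn (hX : IsFBM X H P) {N : Set Ω} (hN : MeasurableSet N) (hN0 : P N = 0) :
    IsFBM (vanishOn X N) H P := by
  have hae : ∀ᵐ ω ∂P, ω ∉ N := measure_eq_zero_iff_ae_notMem.1 hN0
  have hi : ∀ (i : Fin d) (t : ℝ≥0),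
      (fun ω => X t ω i) =ᵐ[P] fun ω => FBMCurrent.vanishOn X N t ω i := by
    intro i t
    filter_upwards [hae] with ω hω
    rw [vanishOn_of_notMem hω]
  refine ⟨fun i => ⟨fun t => ?_, ?_, fun t => ?_, fun s t => ?_, ?_⟩, ?_⟩
  · have h : Measurable (FBMCurrent.vanishOn X N t) := (hX.measurable t).indicator hN.compl
    fun_prop
  · exact (hX.component i).gaussian.congr (hi i)
  · rw [← integral_congr_ae (hi i t)]
    exact (hX.component i).mean_zero t
  · rw [← (hX.component i).covariance_eq s t]
    simp only [covariance]
    rw [integral_congr_ae (hi i t), integral_congr_ae (hi i s)]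
    refine integral_congr_ae ?_
    filter_upwards [hi i t, hi i s] with ω h1 h2
    rw [h1, h2]
  · filter_upwards [hae, (hX.component i).continuous_paths] with ω hω h
    simpa only [vanishOn_of_notMem hω] using h
  · refine hX.independent.congr fun i => ?_
    filter_upwards [hae] with ω hω
    simp only [vanishOn_of_notMem hω]

lemma measurable_uncurry_position (hX : ∀ t, Measurable (X t))
    (hc : ∀ ω, Continuous fun t => X t ω) :
    Measurable fun p : Ω × ℝ => position X p.2 p.1 := by
  have h1 := measurable_uncurry_of_continuous_of_measurable (u := X) hc hX
  have h2 := h1.comp (by fun_prop : Measurable fun p : Ω × ℝ => (p.2.toNNReal, p.1))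
  exact Measurable.ite (measurableSet_le measurable_const measurable_snd) h2 measurable_const

/-- A fractional Brownian motion agrees, off a null set, with one whose paths are all continuous. -/
lemma IsFBM.exists_regular (hX : IsFBM X H P) :
    ∃ N : Set Ω, (∀ᵐ ω ∂P, ω ∉ N) ∧ IsFBM (FBMCurrent.vanishOn X N) H P ∧
      (Measurable fun p : Ω × ℝ => position (FBMCurrent.vanishOn X N) p.2 p.1) ∧
      ∀ ω R, ∃ C, ∀ t ≤ R, ‖position (FBMCurrent.vanishOn X N) t ω‖ ≤ C := by
  -- The set of discontinuous paths need not be measurable, so it is replaced by a measurable hull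
  -- of the same measure.
  set N := toMeasurable P {ω | ¬ Continuous fun t => X t ω} with hN
  have hNm : MeasurableSet N := measurableSet_toMeasurable _ _
  have hN0 : P N = 0 := by
    rw [hN, measure_toMeasurable]
    exact ae_iff.1 hX.ae_continuous
  have hc : ∀ ω, Continuous fun t => FBMCurrent.vanishOn X N t ω := by
    intro ω
    by_cases h : ω ∈ N
    · simp only [vanishOn_of_mem h]
      exact continuous_const
    · simp only [vanishOn_of_notMem h]
      by_contra h'
      exact h (subset_toMeasurable _ _ h')
  have hX' := hX.vanishOn hNm hN0
  exact ⟨N, measure_eq_zero_iff_ae_notMem.1 hN0, hX',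
    measurable_uncurry_position hX'.measurable hc, fun ω R => exists_norm_position_le (hc ω) R⟩

/-- Whenever the kernel is integrable along the path, the double integral is the squared norm of the
current. -/
lemma currentNormSq_eq_ofReal_energy (hα : 0 < α) (hT : 0 ≤ T)
    (hXm : Measurable fun p : Ω × ℝ => position X p.2 p.1) {ω : Ω}
    (hb : ∀ R, ∃ C, ∀ t ≤ R, ‖position X t ω‖ ≤ C) (hB : KernelIntegrable X T α ω) (ε : ℝ) :
    0 ≤ energy X T α ε ω ∧ currentNormSq X T α ε ω = ENNReal.ofReal (energy X T α ε ω) := by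
  obtain ⟨C, hC⟩ := exists_norm_symmQuotient_le hb ε T
  have hx := measurable_position_right hXm ω
  have hB' := lintegral_prod_kernelE_lt_top hα hx hB
  have h2 : 2 * (α / 2) = α := mul_div_cancel₀ α (two_ne_zero' ℝ)
  rw [← h2] at hB'
  have h := lintegral_field_eq_ofReal (half_pos hα) hT hx (measurable_symmQuotient_right hXm ε ω)
    hC hB'
  rw [h2] at h
  exact h

lemma IsFBM.energy_nonneg_and_eq (hX : IsFBM X H P) (hα : 0 < α) (hT : 0 ≤ T)
    (hB : ∀ᵐ ω ∂P, KernelIntegrable X T α ω) (ε : ℝ) :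
    ∀ᵐ ω ∂P, 0 ≤ energy X T α ε ω ∧
      currentNormSq X T α ε ω = ENNReal.ofReal (energy X T α ε ω) := by
  obtain ⟨N, hN, -, hm, hb⟩ := hX.exists_regular
  filter_upwards [hN, hB] with ω hω hBω
  have h := currentNormSq_eq_ofReal_energy hα hT hm (hb ω) ((kernelIntegrable_vanishOn hω).2 hBω) ε
  rwa [energy_vanishOn hω, currentNormSq_vanishOn hω] at h

lemma IsFBM.liminf_lintegral_currentNormSq [IsProbabilityMeasure P] (hX : IsFBM X H P) (hd : 1 ≤ d)
    (hH : 0 < H) (hH1 : H < 1) (hT : 0 < T) (hα : 0 < α) (hαH : α < criticalExponent d H) :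
    liminf (fun ε : ℝ => ∫⁻ ω, currentNormSq X T α ε ω ∂P) (𝓝[>] 0) = ⊤ := by
  obtain ⟨N, hN, hX', hm, hb⟩ := hX.exists_regular
  have h := (hX'.tendsto_lintegral_currentNormSq hH hH1 hT hα hαH hm hb ⟨0, hd⟩).liminf_eq
  rw [← h]
  congr 1
  ext ε
  refine lintegral_congr_ae ?_
  filter_upwards [hN] with ω hω
  rw [currentNormSq_vanishOn hω]

end Modification

end

section

open FourierTransform

/-! ### Integrability of the kernel along the path -/

section HeatExpectation

variable {d : ℕ}

/-- The real part of `fourier_heat` at the frequency `-x / (2π)`. -/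
lemma integral_cos_inner_mul_heat {w : ℝ} (hw : 0 < w) (x : EuclideanSpace ℝ (Fin d)) :
    ∫ l, Real.cos (inner ℝ l x) * heat w l = Real.exp (-(‖x‖ ^ 2 * w)) := by
  have h := fourier_heat hw ((-(1 / (2 * Real.pi))) • x)
  have hpi := Real.pi_pos
  rw [fourier_eq_integral_mul] at h
  have h1 : ∀ l : EuclideanSpace ℝ (Fin d),
      -2 * Real.pi * inner ℝ l ((-(1 / (2 * Real.pi))) • x) = inner ℝ l x := by
    intro l
    rw [inner_smul_right]
    field_simp
  have h2 : -(4 * Real.pi ^ 2 * ‖(-(1 / (2 * Real.pi))) • x‖ ^ 2) * w = -(‖x‖ ^ 2 * w) := by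
    rw [norm_smul, mul_pow, Real.norm_eq_abs, sq_abs]
    field_simp
    norm_num
  simp_rw [h1] at h
  rw [h2] at h
  have hi : Integrable fun l : EuclideanSpace ℝ (Fin d) =>
      Complex.exp (((inner ℝ l x : ℝ) : ℂ) * Complex.I) * (heat w l : ℂ) :=
    (integrable_heat hw).ofReal.bdd_mul (c := 1) (Continuous.aestronglyMeasurable (by fun_prop))
      (Eventually.of_forall fun l => (Complex.norm_exp_ofReal_mul_I _).le)
  have h3 := congrArg Complex.re h
  rw [← RCLike.re_eq_complex_re, ← integral_re hi] at h3
  simp only [RCLike.re_eq_complex_re, Complex.re_mul_ofReal, Complex.exp_ofReal_mul_I_re,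
    Complex.ofReal_re] at h3
  exact h3

lemma heat_mul_exp {w v : ℝ} (hw : 0 < w) (hv : 0 ≤ v) (l : EuclideanSpace ℝ (Fin d)) :
    heat w l * Real.exp (-(‖l‖ ^ 2 * v)) =
      (1 + 4 * w * v) ^ (-(d : ℝ) / 2) * heat (w / (1 + 4 * w * v)) l := by
  have h0 : 0 < 1 + 4 * w * v := by positivity
  unfold heat
  rw [mul_assoc, ← Real.exp_add, ← mul_assoc, ← Real.mul_rpow (by positivity) (by positivity)]
  congr 2
  · field_simp
  · field_simp
    ring

variable {Ω : Type*} [MeasurableSpace Ω] {P : Measure Ω} [IsProbabilityMeasure P]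
  {Y : Ω → EuclideanSpace ℝ (Fin d)} {v : ℝ}

/-- The Gaussian function of `Y` is an average of `cos⟨l, Y⟩` over a Gaussian `l`. Swapping the two
averages, the mean follows from the cosine transform alone, without a density for `Y`. -/
lemma integral_exp_neg_norm_sq (hY : Measurable Y) (hv : 0 ≤ v)
    (h : ∀ l, ∫ ω, Real.cos (inner ℝ l (Y ω)) ∂P = Real.exp (-(‖l‖ ^ 2 * v))) {w : ℝ}
    (hw : 0 < w) :
    ∫ ω, Real.exp (-(‖Y ω‖ ^ 2 * w)) ∂P = (1 + 4 * w * v) ^ (-(d : ℝ) / 2) := by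
  have hm : Measurable fun p : Ω × EuclideanSpace ℝ (Fin d) =>
      Real.cos (inner ℝ p.2 (Y p.1)) * heat w p.2 := by fun_prop
  have hi : Integrable (fun p : Ω × EuclideanSpace ℝ (Fin d) =>
      Real.cos (inner ℝ p.2 (Y p.1)) * heat w p.2) (P.prod volume) :=
    ((integrable_heat hw).comp_snd P).bdd_mul (c := 1)
      (Measurable.aestronglyMeasurable (by fun_prop))
      (Eventually.of_forall fun p => Real.abs_cos_le_one _)
  have hswap := integral_integral_swap (f := fun ω (l : EuclideanSpace ℝ (Fin d)) =>
      Real.cos (inner ℝ l (Y ω)) * heat w l) hi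
  simp_rw [integral_cos_inner_mul_heat hw, integral_mul_const, h] at hswap
  rw [hswap]
  simp_rw [mul_comm (Real.exp _), heat_mul_exp hw hv]
  rw [integral_const_mul, integral_heat (by positivity), mul_one]

lemma lintegral_heat_comp (hY : Measurable Y) (hv : 0 ≤ v)
    (h : ∀ l, ∫ ω, Real.cos (inner ℝ l (Y ω)) ∂P = Real.exp (-(‖l‖ ^ 2 * v))) {u : ℝ}
    (hu : 0 < u) :
    ∫⁻ ω, ENNReal.ofReal (heat u (Y ω)) ∂P =
      ENNReal.ofReal ((4 * Real.pi * (u + v)) ^ (-(d : ℝ) / 2)) := by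
  have hi : Integrable (fun ω => Real.exp (-(‖Y ω‖ ^ 2 * (1 / (4 * u))))) P :=
    Integrable.of_bound (C := 1) (Measurable.aestronglyMeasurable (by fun_prop))
      (Eventually.of_forall fun ω => by
        rw [Real.norm_of_nonneg (Real.exp_nonneg _)]
        exact Real.exp_le_one_iff.2 (neg_nonpos.2 (by positivity)))
  have h1 : ∀ ω, heat u (Y ω) =
      (4 * Real.pi * u) ^ (-(d : ℝ) / 2) * Real.exp (-(‖Y ω‖ ^ 2 * (1 / (4 * u)))) := by
    intro ω
    rw [heat]
    congr 2
    ring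
  rw [← ofReal_integral_eq_lintegral_ofReal _ (Eventually.of_forall fun ω => heat_nonneg hu.le _)]
  · simp_rw [h1]
    rw [integral_const_mul, integral_exp_neg_norm_sq hY hv h (by positivity),
      ← Real.mul_rpow (by positivity) (by positivity)]
    congr 2
    field_simp
  · simp_rw [h1]
    exact hi.const_mul _

/-- The probability that `Y = 0` is at most the mean of `exp(-w|Y|²)`, which tends to `0` as `w → ∞`
since `d ≥ 1`. This is needed because `kernelHat` is infinite at the origin. -/
lemma ae_ne_zero_of_integral_cos (hd : 1 ≤ d) (hY : Measurable Y) (hv : 0 < v)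
    (h : ∀ l, ∫ ω, Real.cos (inner ℝ l (Y ω)) ∂P = Real.exp (-(‖l‖ ^ 2 * v))) :
    ∀ᵐ ω ∂P, Y ω ≠ 0 := by
  have hs : MeasurableSet {ω | Y ω = 0} := hY (measurableSet_singleton 0)
  have h1 : ∀ w : ℝ, 0 < w → P.real {ω | Y ω = 0} ≤ (1 + 4 * w * v) ^ (-(d : ℝ) / 2) := by
    intro w hw
    rw [← integral_exp_neg_norm_sq hY hv.le h hw, ← integral_indicator_one hs]
    refine integral_mono ((integrable_const 1).indicator hs)
      (Integrable.of_bound (C := 1) (Measurable.aestronglyMeasurable (by fun_prop))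
        (Eventually.of_forall fun ω => ?_)) fun ω => ?_
    · rw [Real.norm_of_nonneg (Real.exp_nonneg _)]
      exact Real.exp_le_one_iff.2 (neg_nonpos.2 (by positivity))
    · by_cases hω : Y ω = 0
      · simp [indicator, hω]
      · simp [indicator, hω, Real.exp_nonneg]
  have h2 : Tendsto (fun w : ℝ => (1 + 4 * w * v) ^ (-(d : ℝ) / 2)) atTop (𝓝 0) := by
    have h3 : Tendsto (fun w : ℝ => 1 + 4 * w * v) atTop atTop :=
      tendsto_atTop_add_const_left _ _ ((tendsto_id.const_mul_atTop four_pos).atTop_mul_const hv)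
    have h4 : (0 : ℝ) < d / 2 := by positivity
    rw [neg_div]
    exact (tendsto_rpow_neg_atTop h4).comp h3
  have h5 : P.real {ω | Y ω = 0} ≤ 0 :=
    ge_of_tendsto h2 ((eventually_gt_atTop 0).mono fun w hw => h1 w hw)
  have h6 : P {ω | Y ω = 0} = 0 := by
    have := le_antisymm h5 measureReal_nonneg
    rwa [measureReal_eq_zero_iff] at this
  simpa [ae_iff] using h6

/-- The mean of the heat kernel is `(4π(u + v))^(-d/2)`. Splitting the exponent, `(u + v)^(-d/2) ≤
u^(-a) v^(-b)` separates the mixing variable from the variance. -/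
lemma lintegral_kernelHat_comp_le (hd : 1 ≤ d) (hY : Measurable Y) (hv : 0 < v)
    (h : ∀ l, ∫ ω, Real.cos (inner ℝ l (Y ω)) ∂P = Real.exp (-(‖l‖ ^ 2 * v))) {α a b : ℝ}
    (hα : 0 < α) (ha : 0 ≤ a) (hb : 0 ≤ b) (hab : a + b = d / 2) :
    ∫⁻ ω, kernelHat α (Y ω) ∂P ≤
      (∫⁻ u, ENNReal.ofReal (u ^ (-a)) ∂(gammaMeasure α 1)) * ENNReal.ofReal (v ^ (-b)) := by
  have h1 : ∫⁻ ω, kernelHat α (Y ω) ∂P = ∫⁻ ω, kernelE α (Y ω) ∂P := by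
    refine lintegral_congr_ae ?_
    filter_upwards [ae_ne_zero_of_integral_cos hd hY hv h] with ω hω
    exact kernelHat_of_ne_zero hα hω
  have := isProbabilityMeasure_gammaMeasure hα one_pos
  rw [h1]
  simp only [kernelE]
  rw [lintegral_lintegral_swap (Measurable.aemeasurable (by fun_prop)),
    ← lintegral_mul_const _ (by fun_prop)]
  refine lintegral_mono_ae ((ae_pos_gammaMeasure α).mono fun u hu => ?_)
  rw [lintegral_heat_comp hY hv.le h hu, ← ENNReal.ofReal_mul (by positivity)]
  refine ENNReal.ofReal_le_ofReal ?_
  have hpi := Real.pi_gt_three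
  have huv : 0 < u + v := by positivity
  calc (4 * Real.pi * (u + v)) ^ (-(d : ℝ) / 2) ≤ (u + v) ^ (-(d : ℝ) / 2) := by
        refine Real.rpow_le_rpow_of_nonpos huv (by nlinarith) ?_
        rw [neg_div]
        exact neg_nonpos.2 (by positivity)
    _ = (u + v) ^ (-a) * (u + v) ^ (-b) := by
        rw [← Real.rpow_add huv]
        congr 1
        linarith
    _ ≤ u ^ (-a) * v ^ (-b) := by
        gcongr ?_ * ?_
        · exact Real.rpow_le_rpow_of_nonpos hu (by linarith) (by linarith)
        · exact Real.rpow_le_rpow_of_nonpos hv (by linarith) (by linarith)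

lemma lintegral_rpow_gammaMeasure_lt_top {α a : ℝ} (hα : 0 < α) (ha : a < α) :
    ∫⁻ u, ENNReal.ofReal (u ^ (-a)) ∂(gammaMeasure α 1) < ⊤ := by
  have hG := Real.Gamma_pos_of_pos hα
  rw [lintegral_gammaMeasure (by fun_prop)]
  have hi := ((Real.GammaIntegral_convergent (sub_pos.2 ha)).const_mul (1 / Real.Gamma α))
  refine lt_of_le_of_lt (le_of_eq ?_) hi.lintegral_lt_top
  refine setLIntegral_congr_fun measurableSet_Ioi fun u hu => ?_
  have hu : 0 < u := hu
  rw [← ENNReal.ofReal_mul (by positivity)]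
  congr 1
  rw [show α - a - 1 = α - 1 + -a by ring, Real.rpow_add hu]
  ring

lemma integrableOn_abs_rpow {a : ℝ} (ha : -1 < a) (T : ℝ) :
    IntegrableOn (fun h : ℝ => |h| ^ a) (Icc (-T) T) := by
  have h1 : IntegrableOn (fun h : ℝ => |h| ^ a) (Ioc 0 T) := by
    refine IntegrableOn.congr_fun (f := fun h : ℝ => h ^ a) ?_ (fun h hh => ?_) measurableSet_Ioc
    · exact (intervalIntegral.intervalIntegrable_rpow' ha).1
    · rw [abs_of_pos hh.1]
  have h2 : IntegrableOn (fun h : ℝ => |h| ^ a) (Ico (-T) 0) := by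
    have h := h1.comp_neg
    simpa using h
  have h3 : IntegrableOn (fun h : ℝ => |h| ^ a) {0} := by simp
  refine ((h1.union h2).union h3).mono_set fun x hx => ?_
  rcases lt_trichotomy x 0 with h | h | h
  · exact Or.inl (Or.inr ⟨hx.1, h⟩)
  · exact Or.inr h
  · exact Or.inl (Or.inl ⟨h, hx.2⟩)

lemma lintegral_abs_sub_rpow_le {a T t : ℝ} (ht : t ∈ Icc 0 T) :
    ∫⁻ s in Icc 0 T, ENNReal.ofReal (|t - s| ^ a) ≤
      ∫⁻ h in Icc (-T) T, ENNReal.ofReal (|h| ^ a) := by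
  rw [← lintegral_indicator measurableSet_Icc, ← lintegral_indicator measurableSet_Icc,
    ← lintegral_sub_left_eq_self _ t]
  refine lintegral_mono fun s => ?_
  by_cases hs : t - s ∈ Icc 0 T
  · rw [indicator_of_mem hs, indicator_of_mem, sub_sub_cancel]
    exact ⟨by linarith [ht.1, hs.2], by linarith [ht.2, hs.1]⟩
  · rw [indicator_of_notMem hs]
    exact zero_le

variable {X : ℝ≥0 → Ω → EuclideanSpace ℝ (Fin d)} {H T α : ℝ}

lemma IsFBM.lintegral_kernelHat_le (hX : IsFBM X H P) (hd : 1 ≤ d) (hH : 0 < H) (hα : 0 < α)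
    {a b : ℝ} (ha : 0 ≤ a) (hb : 0 ≤ b) (hab : a + b = d / 2) {s t : ℝ} (hs : 0 ≤ s) (ht : 0 ≤ t)
    (hst : s ≠ t) :
    ∫⁻ ω, kernelHat α (position X t ω - position X s ω) ∂P ≤
      (∫⁻ u, ENNReal.ofReal (u ^ (-a)) ∂(gammaMeasure α 1)) *
        (ENNReal.ofReal ((1 / 2) ^ (-b)) * ENNReal.ofReal (|t - s| ^ (-(2 * H * b)))) := by
  have hpos : 0 < |t - s| := abs_pos.2 (sub_ne_zero.2 hst.symm)
  have hm : Measurable fun ω => position X t ω - position X s ω := by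
    simp_rw [position_of_nonneg hs, position_of_nonneg ht]
    exact (hX.measurable _).sub (hX.measurable _)
  refine (lintegral_kernelHat_comp_le hd hm (v := 1 / 2 * |t - s| ^ (2 * H)) (by positivity)
    (fun l => ?_) hα ha hb hab).trans (le_of_eq ?_)
  · rw [hX.integral_cos_inner_increment hH l hs ht]
    congr 1
    ring
  · rw [← ENNReal.ofReal_mul (by positivity), Real.mul_rpow (by norm_num) (by positivity),
      ← Real.rpow_mul hpos.le, mul_neg]

lemma IsFBM.ae_kernelIntegrable_of_measurable (hX : IsFBM X H P) (hd : 1 ≤ d) (hH : 0 < H)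
    (hα : 0 < α) (hαH : (d : ℝ) / 2 - 1 / (2 * H) < α)
    (hXm : Measurable fun p : Ω × ℝ => position X p.2 p.1) :
    ∀ᵐ ω ∂P, KernelIntegrable X T α ω := by
  have hd0 : (0 : ℝ) < d / 2 := by positivity
  -- The condition `a < α` makes `u^(-a)` integrable for the Gamma law, and `a > d/2 - 1/(2H)` gives
  -- `2Hb < 1`, so that `|t - s|^(-2Hb)` is integrable in time. Both can be met because `α > d/2 -
  -- 1/(2H)`.
  obtain ⟨a, ha1, ha2⟩ : ∃ a, max 0 ((d : ℝ) / 2 - 1 / (2 * H)) < a ∧ a < min ((d : ℝ) / 2) α := by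
    refine exists_between (max_lt (lt_min hd0 hα) (lt_min ?_ hαH))
    exact sub_lt_self _ (by positivity)
  obtain ⟨ha0, haH⟩ := max_lt_iff.1 ha1
  obtain ⟨had, haα⟩ := lt_min_iff.1 ha2
  set b : ℝ := d / 2 - a with hb
  have hb0 : 0 < b := by linarith
  have hbH : -1 < -(2 * H * b) := by
    have h1 : b < 1 / (2 * H) := by linarith
    rw [lt_div_iff₀ (by positivity)] at h1
    linarith
  set C := (∫⁻ u, ENNReal.ofReal (u ^ (-a)) ∂(gammaMeasure α 1)) * ENNReal.ofReal ((1 / 2) ^ (-b))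
    with hC
  have hC0 : C < ⊤ := ENNReal.mul_lt_top (lintegral_rpow_gammaMeasure_lt_top hα haα)
    ENNReal.ofReal_lt_top
  have hmk := measurable_kernelHat (d := d) hα
  have hm3 : Measurable fun p : (Ω × ℝ) × ℝ =>
      kernelHat α (position X p.1.2 p.1.1 - position X p.2 p.1.1) := by
    have h1 := hXm.comp (by fun_prop : Measurable fun p : (Ω × ℝ) × ℝ => (p.1.1, p.1.2))
    have h2 := hXm.comp (by fun_prop : Measurable fun p : (Ω × ℝ) × ℝ => (p.1.1, p.2))
    exact hmk.comp (h1.sub h2)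
  have hm2 : Measurable fun p : Ω × ℝ => ∫⁻ s in Icc (0 : ℝ) T,
      kernelHat α (position X p.2 p.1 - position X s p.1) := hm3.lintegral_prod_right'
  have hm1 : Measurable fun ω => ∫⁻ t in Icc (0 : ℝ) T, ∫⁻ s in Icc (0 : ℝ) T,
      kernelHat α (position X t ω - position X s ω) := hm2.lintegral_prod_right'
  refine ae_lt_top hm1 (ne_of_lt ?_)
  have hinner : ∀ t ∈ Icc 0 T, ∫⁻ ω, (∫⁻ s in Icc (0 : ℝ) T,
      kernelHat α (position X t ω - position X s ω)) ∂P ≤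
      C * ∫⁻ h in Icc (-T) T, ENNReal.ofReal (|h| ^ (-(2 * H * b))) := by
    intro t ht
    have hmt := hm3.comp (by fun_prop : Measurable fun p : Ω × ℝ => ((p.1, t), p.2))
    rw [lintegral_lintegral_swap (f := fun ω s => kernelHat α (position X t ω - position X s ω))
      hmt.aemeasurable]
    refine le_trans ?_ (mul_le_mul_right (lintegral_abs_sub_rpow_le ht) C)
    rw [← lintegral_const_mul _ (by fun_prop)]
    have hne : ∀ᵐ s : ℝ, s ≠ t := by simp [ae_iff]
    refine lintegral_mono_ae ?_
    filter_upwards [ae_restrict_mem measurableSet_Icc, ae_restrict_of_ae hne] with s hs hst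
    refine (hX.lintegral_kernelHat_le hd hH hα ha0.le hb0.le (by rw [hb]; ring) hs.1 ht.1
      hst).trans (le_of_eq (mul_assoc _ _ _).symm)
  rw [lintegral_lintegral_swap (f := fun ω t => ∫⁻ s in Icc (0 : ℝ) T,
    kernelHat α (position X t ω - position X s ω)) hm2.aemeasurable]
  refine (setLIntegral_mono' measurableSet_Icc hinner).trans_lt ?_
  rw [setLIntegral_const]
  exact ENNReal.mul_lt_top (ENNReal.mul_lt_top hC0
    (integrableOn_abs_rpow hbH T).lintegral_lt_top) measure_Icc_lt_top

lemma IsFBM.ae_kernelIntegrable (hX : IsFBM X H P) (hd : 1 ≤ d) (hH : 0 < H)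
    (hα : 0 < α) (hαH : (d : ℝ) / 2 - 1 / (2 * H) < α) :
    ∀ᵐ ω ∂P, KernelIntegrable X T α ω := by
  obtain ⟨N, hN, hX', hm, -⟩ := hX.exists_regular
  filter_upwards [hN, hX'.ae_kernelIntegrable_of_measurable (T := T) hd hH hα hαH hm] with ω hω h
  exact (kernelIntegrable_vanishOn hω).1 h

end HeatExpectation

end

end FBMCurrent

end

/-! ### Conclusion: the three claims together -/

theorem mainTheorem4 {Ω : Type*} [MeasurableSpace Ω] (P : Measure Ω) [IsProbabilityMeasure P]
    (d : ℕ) (hd : 1 ≤ d) (H T : ℝ) (hH : 1 / 4 < H) (hH1 : H < 1) (hT : 0 < T)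
    (X : ℝ≥0 → Ω → EuclideanSpace ℝ (Fin d)) (hX : FBMCurrent.IsFBM X H P)
    (α : ℝ) (hα0 : 0 < α) (hα : α < FBMCurrent.criticalExponent d H) :
    ((d : ℝ) / 2 - 1 / (2 * H) < α → ∀ᵐ ω ∂P, FBMCurrent.KernelIntegrable X T α ω) ∧
    ((∀ᵐ ω ∂P, FBMCurrent.KernelIntegrable X T α ω) →
      (∀ ε > 0, ∀ᵐ ω ∂P, 0 ≤ FBMCurrent.energy X T α ε ω) ∧
      liminf (fun ε : ℝ => ∫⁻ ω, ENNReal.ofReal (FBMCurrent.energy X T α ε ω) ∂P) (𝓝[>] 0) = ⊤) ∧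
    liminf (fun ε : ℝ => ∫⁻ ω, FBMCurrent.currentNormSq X T α ε ω ∂P) (𝓝[>] 0) = ⊤ := by
  have hH0 : 0 < H := by linarith
  refine ⟨hX.ae_kernelIntegrable hd hH0 hα0, fun hB => ?_,
    hX.liminf_lintegral_currentNormSq hd hH0 hH1 hT hα0 hα⟩
  refine ⟨fun ε _ => (hX.energy_nonneg_and_eq hα0 hT.le hB ε).mono fun ω h => h.1, ?_⟩
  -- Under (B) the double integral and the squared norm agree almost surely for each `ε`, so the two
  -- expectations are the same function of `ε`.
  rw [← hX.liminf_lintegral_currentNormSq hd hH0 hH1 hT hα0 hα]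
  congr 1
  ext ε
  exact lintegral_congr_ae ((hX.energy_nonneg_and_eq hα0 hT.le hB ε).mono fun ω h => h.2.symm)
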